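/- **Setting.** Let $N\ge 2$, let $\Omega\subset\mathbb R^N$ be a bounded domain (nonempty, open, connected) with Lipschitz boundary, and let $0<\alpha\le\tilde\beta$. Let $\tilde{\mathcal M}(\alpha,\tilde\beta)$ be the set of $N\times N$ matrix functions $A=A(x)$ on $\Omega$ with real measurable entries such that, for a.e. $x\in\Omega$ and all $\xi\in\mathbb R^N$, $A(x)\xi\cdot\xi\ge\alpha|\xi|^2$ and $A(x)^{-1}\xi\cdot\xi\ge\tilde\beta^{-1}|\xi|^2$. Let $W^{1,2}(\Omega)$ carry the norm $(\|u\|_{L^2}^2+\|\nabla u\|_{L^2}^2)^{1/2}$, and let $W^{1,2}_0(\Omega)$ be the closure of $C^\infty_c(\Omega)$. Let $W^{1/2,2}(\partial\Omega)\subset L^2(\partial\Omega)$ be the space of traces of $W^{1,2}(\Omega)$ functions, with norm $\|\varphi\|=\inf\{\|u\|_{W^{1,2}(\Omega)}: u=\varphi\text{ on }\partial\Omega\}$, let $W^{-1/2,2}(\partial\Omega)$ be its dual with the dual norm, let $W^{-1/2,2}_*(\partial\Omega)=\{g\in W^{-1/2,2}(\partial\Omega):\langle g,1\rangle=0\}$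 and $W^{1/2,2}_*(\partial\Omega)=\{\varphi\in W^{1/2,2}(\partial\Omega):\int_{\partial\Omega}\varphi=0\}$, with the norms of the ambient spaces. For $A\in\tilde{\mathcal M}(\alpha,\tilde\beta)$, $F\in(W^{1,2}(\Omega))^*$ and $\varphi\in W^{1,2}(\Omega)$ let $u=u(A,F,\varphi)$ be the weak solution of $-\mathrm{div}(A\nabla u)=F$ in $\Omega$, $u=\varphi$ on $\partial\Omega$, that is $u-\varphi\in W^{1,2}_0(\Omega)$ and $\int_\Omega A\nabla u\cdot\nabla\psi=\langle F,\psi\rangle$ for all $\psi\in W^{1,2}_0(\Omega)$; for $\varphi\in W^{1/2,2}(\partial\Omega)$, $u(A,0,\varphi)$ means $u(A,0,\varphi')$ with any $\varphi'\in W^{1,2}(\Omega)$ of trace $\varphi$. For $g\in W^{-1/2,2}_*(\partial\Omega)$ let $v=v(A,g)\in W^{1,2}(\Omega)$ be the solution of the Neumann problem: $\int_{\partial\Omega}v=0$ and $\int_\Omega A\nabla v\cdot\nabla\psi=\langle g,\psi|_{\partial\Omega}\rangle$ for all $\psi\in W^{1,2}(\Omega)$. The sequence $A_n\in\tilde{\mathcal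 M}(\alpha,\tilde\beta)$ *$H$-converges* to $A$ if for every $F\in(W^{1,2}(\Omega))^*$, with $u_n=u(A_n,F,0)$ and $u=u(A,F,0)$, one has $u_n\rightharpoonup u$ weakly in $W^{1,2}_0(\Omega)$ and $A_n\nabla u_n\rightharpoonup A\nabla u$ weakly in $L^2(\Omega,\mathbb R^N)$. Fix bounded linear operators $\hat\Lambda_D:W^{1/2,2}(\partial\Omega)\to W^{-1/2,2}_*(\partial\Omega)$ and $\hat\Lambda_N:W^{-1/2,2}_*(\partial\Omega)\to W^{1/2,2}_*(\partial\Omega)$, and for $A\in\tilde{\mathcal M}(\alpha,\tilde\beta)$ define - $D\text{-}N(A):W^{1/2,2}(\partial\Omega)\to W^{-1/2,2}_*(\partial\Omega)$, $D\text{-}N(A)(\varphi)[\psi]=\int_\Omega A\nabla u(A,0,\varphi)\cdot\nabla\tilde\psi$ for any $\tilde\psi\in W^{1,2}(\Omega)$ with trace $\psi$; - $N\text{-}D(A):W^{-1/2,2}_*(\partial\Omega)\to W^{1/2,2}_*(\partial\Omega)$, $N\text{-}D(A)(g)=v(A,g)|_{\partial\Omega}$; - $KD_i(A):W^{1/2,2}(\partial\Omega)\to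 L^2(\Omega,\mathbb R^N)$, $KD_i(A)[\varphi]=A^{i/2}\big(\nabla u(A,0,\varphi)-\nabla v(A,\hat\Lambda_D(\varphi))\big)$; - $KN_i(A):W^{-1/2,2}_*(\partial\Omega)\to L^2(\Omega,\mathbb R^N)$, $KN_i(A)[g]=A^{i/2}\big(\nabla u(A,0,\hat\Lambda_N(g))-\nabla v(A,g)\big)$, for $i=1,2$, where for $i=1$ the tensor $A$ is required to be symmetric a.e. and $A^{1/2}$ is its positive square root. **Theorem.** For all tensors in $\tilde{\mathcal M}(\alpha,\tilde\beta)$ (symmetric ones for $i=1$) these are well-defined bounded linear operators, uniquely determined by the formulas above. If $A_n\in\tilde{\mathcal M}(\alpha,\tilde\beta)$, $n\in\mathbb N$, $H$-converges to $A\in\tilde{\mathcal M}(\alpha,\tilde\beta)$, then, in the operator norms between the spaces indicated, $$\|D\text{-}N(A)-\hat\Lambda_D\|\le\liminf_n\|D\text{-}N(A_n)-\hat\Lambda_D\|,\qquad \|N\text{-}D(A)-\hat\Lambda_N\|\le\liminf_n\|N\text{-}D(A_n)-\hat\Lambda_N\|,$$ $$\|KD_2(A)\|\le\liminf_n\|KD_2(A_n)\|,\qquad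 \|KN_2(A)\|\le\liminf_n\|KN_2(A_n)\|.$$ If moreover every $A_n$ is symmetric a.e. in $\Omega$, then so is $A$, and $$\|KD_1(A)\|\le\liminf_n\|KD_1(A_n)\|,\qquad \|KN_1(A)\|\le\liminf_n\|KN_1(A_n)\|.$$ -/

import Mathlib

open MeasureTheory Filter Topology
open scoped ContDiff ENNReal Matrix NNReal

noncomputable section

namespace Conductivity

/-- The Euclidean space `ℝ^N`. -/
abbrev Eu (N : ℕ) : Type := EuclideanSpace ℝ (Fin N)

/-- Real `N × N` matrices. -/
abbrev Mat (N : ℕ) : Type := Matrix (Fin N) (Fin N) ℝ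

variable {N : ℕ}

/-! ### Domains -/

/-- The open set `Ω` has Lipschitz boundary: near each boundary point `p` there are a unit vector
`e` (the vertical direction) and a Lipschitz function `γ` such that, inside a ball around `p`, the
set `Ω` is exactly the part lying strictly above the graph of `γ`, where `x` has horizontal part
`x - ⟪e, x⟫ e` and height `⟪e, x⟫`. -/
def HasLipschitzBoundary (Ω : Set (Eu N)) : Prop :=
  ∀ p ∈ frontier Ω, ∃ (e : Eu N) (γ : Eu N → ℝ) (K : ℝ≥0) (r : ℝ),
    ‖e‖ = 1 ∧ LipschitzWith K γ ∧ 0 < r ∧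
      ∀ x ∈ Metric.ball p r, (x ∈ Ω ↔ γ (x - inner ℝ e x • e) < inner ℝ e x)

/-- A bounded domain (nonempty connected open set) with Lipschitz boundary. -/
structure IsBoundedLipschitzDomain (Ω : Set (Eu N)) : Prop where
  isOpen : IsOpen Ω
  isConnected : IsConnected Ω
  isBounded : Bornology.IsBounded Ω
  lipschitz : HasLipschitzBoundary Ω

/-! ### Conductivity tensors -/

/-- The ellipticity condition `M ξ · ξ ≥ α |ξ|²` and `M⁻¹ ξ · ξ ≥ β⁻¹ |ξ|²` for all `ξ`. -/
def Elliptic (α β : ℝ) (M : Mat N) : Prop :=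
  (∀ ξ : Fin N → ℝ, α * (ξ ⬝ᵥ ξ) ≤ (M *ᵥ ξ) ⬝ᵥ ξ) ∧
    ∀ ξ : Fin N → ℝ, β⁻¹ * (ξ ⬝ᵥ ξ) ≤ (M⁻¹ *ᵥ ξ) ⬝ᵥ ξ

/-- The class of conductivity tensors in `Ω` with (Lebesgue) measurable entries which satisfy the
ellipticity condition almost everywhere in `Ω`. -/
structure IsTensor (Ω : Set (Eu N)) (α β : ℝ) (A : Eu N → Mat N) : Prop where
  measurable : ∀ i j, AEMeasurable (fun x => A x i j) (volume.restrict Ω)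
  elliptic : ∀ᵐ x ∂(volume.restrict Ω), Elliptic α β (A x)

/-- The tensor is symmetric almost everywhere in `Ω`. -/
def IsSymmTensor (Ω : Set (Eu N)) (A : Eu N → Mat N) : Prop :=
  ∀ᵐ x ∂(volume.restrict Ω), (A x).IsSymm

/-! ### Sobolev spaces -/

/-- The Lebesgue space `L²(Ω)`. -/
abbrev L2 (Ω : Set (Eu N)) : Type := Lp ℝ 2 (volume.restrict Ω)

/-- The Lebesgue space `L²(Ω, ℝ^N)`. -/
abbrev L2Vec (Ω : Set (Eu N)) : Type := Lp (Eu N) 2 (volume.restrict Ω)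

/-- Test functions: smooth with compact support contained in `Ω`. -/
structure IsTest (Ω : Set (Eu N)) (φ : Eu N → ℝ) : Prop where
  smooth : ContDiff ℝ ∞ φ
  compact : HasCompactSupport φ
  support : tsupport φ ⊆ Ω

/-- The `i`-th partial derivative. -/
def partialD (i : Fin N) (φ : Eu N → ℝ) (x : Eu N) : ℝ :=
  fderiv ℝ φ x (EuclideanSpace.single i 1)

/-- `G` is the weak (distributional) gradient of `f` in `Ω`. -/
def IsWeakGradient (Ω : Set (Eu N)) (f : Eu N → ℝ) (G : Eu N → Eu N) : Prop :=
  ∀ φ : Eu N → ℝ, IsTest Ω φ → ∀ i : Fin N,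
    ∫ x in Ω, f x * partialD i φ x = - ∫ x in Ω, G x i * φ x

theorem IsTest.memLp {Ω : Set (Eu N)} {φ : Eu N → ℝ} (h : IsTest Ω φ) :
    MemLp φ 2 (volume.restrict Ω) :=
  (h.smooth.continuous.memLp_of_hasCompactSupport h.compact).restrict Ω

theorem IsTest.memLp_partialD {Ω : Set (Eu N)} {φ : Eu N → ℝ} (h : IsTest Ω φ) (i : Fin N) :
    MemLp (partialD i φ) 2 (volume.restrict Ω) := by
  have hc : Continuous (partialD i φ) := by
    have := h.smooth.continuous_fderiv (by simp)
    unfold partialD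
    fun_prop
  have hs : HasCompactSupport (partialD i φ) := h.compact.fderiv_apply (𝕜 := ℝ) _
  exact (hc.memLp_of_hasCompactSupport hs).restrict Ω

theorem memLp_coord {μ : Measure (Eu N)} {G : Eu N → Eu N} (hG : MemLp G 2 μ) (i : Fin N) :
    MemLp (fun x => G x i) 2 μ :=
  (EuclideanSpace.proj (𝕜 := ℝ) i : Eu N →L[ℝ] ℝ).comp_memLp' hG

/-- The Sobolev space `W^{1,2}(Ω)`, as the space of pairs `(u, ∇u)` in `L²(Ω) × L²(Ω, ℝ^N)`. -/
def sobolev (Ω : Set (Eu N)) : Submodule ℝ (WithLp 2 (L2 Ω × L2Vec Ω)) where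
  carrier := {w | IsWeakGradient Ω w.fst w.snd}
  zero_mem' := by
    intro φ _ i
    have h1 : ∀ᵐ x ∂(volume.restrict Ω),
        (((0 : WithLp 2 (L2 Ω × L2Vec Ω)).fst : L2 Ω) : Eu N → ℝ) x = 0 :=
      Lp.coeFn_zero ℝ 2 (volume.restrict Ω)
    have h2 : ∀ᵐ x ∂(volume.restrict Ω),
        (((0 : WithLp 2 (L2 Ω × L2Vec Ω)).snd : L2Vec Ω) : Eu N → Eu N) x = 0 :=
      Lp.coeFn_zero (Eu N) 2 (volume.restrict Ω)
    rw [integral_eq_zero_of_ae, integral_eq_zero_of_ae, neg_zero]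
    · filter_upwards [h2] with x hx
      simp only [hx, PiLp.zero_apply, zero_mul, Pi.zero_apply]
    · filter_upwards [h1] with x hx
      simp only [hx, zero_mul, Pi.zero_apply]
  add_mem' := by
    intro a b ha hb φ hφ i
    have h1 := Lp.coeFn_add a.fst b.fst
    have h2 := Lp.coeFn_add a.snd b.snd
    have i1 := (Lp.memLp a.fst).integrable_mul (hφ.memLp_partialD i)
    have i2 := (Lp.memLp b.fst).integrable_mul (hφ.memLp_partialD i)
    have j1 := (memLp_coord (Lp.memLp a.snd) i).integrable_mul hφ.memLp
    have j2 := (memLp_coord (Lp.memLp b.snd) i).integrable_mul hφ.memLp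
    have e1 : ∫ x in Ω, (a + b).fst x * partialD i φ x =
        (∫ x in Ω, a.fst x * partialD i φ x) + ∫ x in Ω, b.fst x * partialD i φ x := by
      refine Eq.trans ?_ (integral_add i1 i2)
      refine integral_congr_ae ?_
      filter_upwards [h1] with x hx
      simp only [WithLp.add_fst, hx, Pi.add_apply, add_mul]
    have e2 : ∫ x in Ω, (a + b).snd x i * φ x =
        (∫ x in Ω, a.snd x i * φ x) + ∫ x in Ω, b.snd x i * φ x := by
      refine Eq.trans ?_ (integral_add j1 j2)
      refine integral_congr_ae ?_
      filter_upwards [h2] with x hx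
      simp only [WithLp.add_snd, hx, Pi.add_apply, PiLp.add_apply, add_mul]
    rw [e1, e2, ha φ hφ i, hb φ hφ i]
    ring
  smul_mem' := by
    intro c a ha φ hφ i
    have h1 := Lp.coeFn_smul c a.fst
    have h2 := Lp.coeFn_smul c a.snd
    have e1 : ∫ x in Ω, (c • a).fst x * partialD i φ x =
        c * ∫ x in Ω, a.fst x * partialD i φ x := by
      rw [← integral_const_mul]
      refine integral_congr_ae ?_
      filter_upwards [h1] with x hx
      simp only [WithLp.smul_fst, hx, Pi.smul_apply, smul_eq_mul, mul_assoc]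
    have e2 : ∫ x in Ω, (c • a).snd x i * φ x = c * ∫ x in Ω, a.snd x i * φ x := by
      rw [← integral_const_mul]
      refine integral_congr_ae ?_
      filter_upwards [h2] with x hx
      simp only [WithLp.smul_snd, hx, Pi.smul_apply, PiLp.smul_apply, smul_eq_mul, mul_assoc]
    rw [e1, e2, ha φ hφ i]
    ring

/-- `W^{1,2}(Ω)` with the Hilbert norm `(‖u‖² + ‖∇u‖²)^{1/2}`. -/
abbrev W12 (Ω : Set (Eu N)) : Type := ↥(sobolev Ω)

/-- The function underlying an element of `W^{1,2}(Ω)`. -/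
def W12.fn {Ω : Set (Eu N)} (u : W12 Ω) : L2 Ω := u.1.fst

/-- The weak gradient of an element of `W^{1,2}(Ω)`. -/
def W12.grad {Ω : Set (Eu N)} (u : W12 Ω) : L2Vec Ω := u.1.snd

/-- `W^{1,2}_0(Ω)`: the closure of the test functions in `W^{1,2}(Ω)`. -/
def W120 (Ω : Set (Eu N)) : Set (W12 Ω) :=
  closure {u | ∃ φ : Eu N → ℝ, IsTest Ω φ ∧ u.fn =ᵐ[volume.restrict Ω] φ}

/-! ### Traces -/

/-- The surface measure on `∂Ω`: the `(N-1)`-dimensional Hausdorff measure. -/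
def surface (Ω : Set (Eu N)) : Measure (Eu N) :=
  (Measure.hausdorffMeasure ((N : ℝ) - 1)).restrict (frontier Ω)

/-- The pairs `(f|_Ω, f|_{∂Ω})` for `f` smooth up to the boundary. -/
def smoothTraceGraph (Ω : Set (Eu N)) : Submodule ℝ (W12 Ω × Lp ℝ 2 (surface Ω)) where
  carrier := {p | ∃ f : Eu N → ℝ, ContDiff ℝ ∞ f ∧
    p.1.fn =ᵐ[volume.restrict Ω] f ∧ p.2 =ᵐ[surface Ω] f}
  zero_mem' := ⟨fun _ => 0, contDiff_const, Lp.coeFn_zero _ _ _, Lp.coeFn_zero _ _ _⟩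
  add_mem' := by
    rintro a b ⟨f, hf, hf1, hf2⟩ ⟨g, hg, hg1, hg2⟩
    exact ⟨fun x => f x + g x, hf.add hg, (Lp.coeFn_add a.1.fn b.1.fn).trans (hf1.add hg1),
      (Lp.coeFn_add a.2 b.2).trans (hf2.add hg2)⟩
  smul_mem' := by
    rintro c a ⟨f, hf, hf1, hf2⟩
    exact ⟨fun x => c * f x, contDiff_const.mul hf,
      (Lp.coeFn_smul c a.1.fn).trans (hf1.const_smul c),
      (Lp.coeFn_smul c a.2).trans (hf2.const_smul c)⟩

/-- The graph of the trace operator `W^{1,2}(Ω) → L²(∂Ω)`: the closure of the graph of the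
restriction `f|_Ω ↦ f|_{∂Ω}` of functions smooth up to the boundary. -/
def traceGraph (Ω : Set (Eu N)) : Submodule ℝ (W12 Ω × Lp ℝ 2 (surface Ω)) :=
  (smoothTraceGraph Ω).topologicalClosure

/-- The space of the traces on `∂Ω` of `W^{1,2}(Ω)` functions, inside `L²(∂Ω)`. -/
def traceSubmodule (Ω : Set (Eu N)) : Submodule ℝ (Lp ℝ 2 (surface Ω)) :=
  (traceGraph Ω).map (LinearMap.snd ℝ (W12 Ω) (Lp ℝ 2 (surface Ω)))

/-- `h` is the trace of `u`. -/
def IsTraceAux {Ω : Set (Eu N)} (u : W12 Ω) (h : traceSubmodule Ω) : Prop :=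
  (u, h.1) ∈ traceGraph Ω

theorem IsTraceAux.exists {Ω : Set (Eu N)} (h : traceSubmodule Ω) : ∃ u : W12 Ω, IsTraceAux u h := by
  obtain ⟨p, hp, hp2⟩ := h.2
  refine ⟨p.1, ?_⟩
  have h2 : p.2 = h.1 := hp2
  unfold IsTraceAux
  rw [← h2]
  exact hp

theorem IsTraceAux.zero {Ω : Set (Eu N)} : IsTraceAux (0 : W12 Ω) (0 : traceSubmodule Ω) :=
  (traceGraph Ω).zero_mem

theorem IsTraceAux.add {Ω : Set (Eu N)} {u v : W12 Ω} {h k : traceSubmodule Ω}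
    (hu : IsTraceAux u h) (hv : IsTraceAux v k) : IsTraceAux (u + v) (h + k) :=
  (traceGraph Ω).add_mem hu hv

theorem IsTraceAux.smul {Ω : Set (Eu N)} {u : W12 Ω} {h : traceSubmodule Ω} (c : ℝ)
    (hu : IsTraceAux u h) : IsTraceAux (c • u) (c • h) :=
  (traceGraph Ω).smul_mem c hu

theorem IsTraceAux.neg {Ω : Set (Eu N)} {u : W12 Ω} {h : traceSubmodule Ω}
    (hu : IsTraceAux u h) : IsTraceAux (-u) (-h) := by
  simpa using hu.smul (-1)

/-- The norm of `W^{1/2,2}(∂Ω)`: the infimum of the `W^{1,2}(Ω)` norms of all extensions. -/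
def traceNorm {Ω : Set (Eu N)} (h : traceSubmodule Ω) : ℝ := ⨅ u : {u : W12 Ω // IsTraceAux u h}, ‖u.1‖

theorem traceNorm_le {Ω : Set (Eu N)} {u : W12 Ω} {h : traceSubmodule Ω} (hu : IsTraceAux u h) :
    traceNorm h ≤ ‖u‖ :=
  ciInf_le (f := fun u : {u : W12 Ω // IsTraceAux u h} => ‖u.1‖)
    ⟨0, by rintro _ ⟨u, rfl⟩; exact norm_nonneg _⟩ ⟨u, hu⟩

theorem le_traceNorm {Ω : Set (Eu N)} {c : ℝ} {h : traceSubmodule Ω}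
    (hc : ∀ u : W12 Ω, IsTraceAux u h → c ≤ ‖u‖) : c ≤ traceNorm h := by
  obtain ⟨u, hu⟩ := IsTraceAux.exists h
  have : Nonempty {u : W12 Ω // IsTraceAux u h} := ⟨⟨u, hu⟩⟩
  exact le_ciInf fun v => hc v.1 v.2

theorem traceNorm_smul_le {Ω : Set (Eu N)} (c : ℝ) (h : traceSubmodule Ω) :
    traceNorm (c • h) ≤ ‖c‖ * traceNorm h := by
  rcases eq_or_ne c 0 with rfl | hc
  · rw [zero_smul, norm_zero, zero_mul]
    exact (traceNorm_le IsTraceAux.zero).trans_eq norm_zero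
  · have hpos : 0 < ‖c‖ := norm_pos_iff.2 hc
    rw [← div_le_iff₀' hpos]
    refine le_traceNorm fun u hu => ?_
    rw [div_le_iff₀' hpos, ← norm_smul]
    exact traceNorm_le (hu.smul c)

theorem traceNorm_zero {Ω : Set (Eu N)} : traceNorm (0 : traceSubmodule Ω) = 0 :=
  le_antisymm ((traceNorm_le IsTraceAux.zero).trans_eq norm_zero)
    (le_traceNorm fun _ _ => norm_nonneg _)

theorem traceNorm_add_le {Ω : Set (Eu N)} (h k : traceSubmodule Ω) :
    traceNorm (h + k) ≤ traceNorm h + traceNorm k := by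
  rw [← sub_le_iff_le_add]
  refine le_traceNorm fun u hu => ?_
  rw [sub_le_iff_le_add, ← sub_le_iff_le_add']
  refine le_traceNorm fun v hv => ?_
  rw [sub_le_iff_le_add']
  exact (traceNorm_le (hu.add hv)).trans (norm_add_le u v)

theorem traceNorm_neg {Ω : Set (Eu N)} (h : traceSubmodule Ω) : traceNorm (-h) = traceNorm h := by
  have key : ∀ h : traceSubmodule Ω, traceNorm (-h) ≤ traceNorm h := fun h =>
    le_traceNorm fun u hu => (traceNorm_le hu.neg).trans_eq (norm_neg u)
  exact le_antisymm (key h) (by simpa using key (-h))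

/-- `W^{1/2,2}(∂Ω)`: the space of traces, with the norm `traceNorm`. -/
def W12half (Ω : Set (Eu N)) : Type := ↥(traceSubmodule Ω)

instance instGroupW12half (Ω : Set (Eu N)) : SeminormedAddCommGroup (W12half Ω) :=
  AddGroupSeminorm.toSeminormedAddCommGroup (E := ↥(traceSubmodule Ω))
    { toFun := traceNorm
      map_zero' := traceNorm_zero
      add_le' := traceNorm_add_le
      neg' := traceNorm_neg }

instance instSpaceW12half (Ω : Set (Eu N)) : NormedSpace ℝ (W12half Ω) where
  toModule := inferInstanceAs (Module ℝ ↥(traceSubmodule Ω))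
  norm_smul_le := traceNorm_smul_le

/-- The inclusion of `W^{1/2,2}(∂Ω)` in `L²(∂Ω)`. -/
def W12half.toL2 {Ω : Set (Eu N)} : W12half Ω →ₗ[ℝ] Lp ℝ 2 (surface Ω) :=
  (traceSubmodule Ω).subtype

/-- `u = h` on `∂Ω` in the sense of traces. -/
def IsTrace {Ω : Set (Eu N)} (u : W12 Ω) (h : W12half Ω) : Prop :=
  (u, h.toL2) ∈ traceGraph Ω

/-- The norm of `W^{1/2,2}(∂Ω)` is the infimum of the `W^{1,2}(Ω)` norms of all extensions. -/
theorem W12half.norm_def {Ω : Set (Eu N)} (h : W12half Ω) :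
    ‖h‖ = ⨅ u : {u : W12 Ω // IsTrace u h}, ‖u.1‖ := rfl

/-- The dual space `W^{-1/2,2}(∂Ω)` of `W^{1/2,2}(∂Ω)`, with the dual norm. -/
abbrev W12minus (Ω : Set (Eu N)) : Type := W12half Ω →L[ℝ] ℝ

/-- `W^{-1/2,2}_*(∂Ω)`: the functionals which vanish on the constant function `1`. -/
def W12minusStar (Ω : Set (Eu N)) : Submodule ℝ (W12minus Ω) where
  carrier := {g | ∀ h : W12half Ω, h.toL2 =ᵐ[surface Ω] (fun _ => (1 : ℝ)) → g h = 0}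
  zero_mem' := fun _ _ => rfl
  add_mem' := by
    intro a b ha hb h hh
    simp [ha h hh, hb h hh]
  smul_mem' := by
    intro c a ha h hh
    simp [ha h hh]

/-- `W^{1/2,2}_*(∂Ω)`: the elements of `W^{1/2,2}(∂Ω)` with zero mean on `∂Ω`. -/
def W12halfStar (Ω : Set (Eu N)) : Submodule ℝ (W12half Ω) where
  carrier := {h | Integrable h.toL2 (surface Ω) ∧ ∫ x, h.toL2 x ∂(surface Ω) = 0}
  zero_mem' := by
    rw [Set.mem_ofPred_eq, map_zero]
    have h0 := Lp.coeFn_zero ℝ 2 (surface Ω)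
    exact ⟨(integrable_zero _ _ _).congr h0.symm, by
      rw [integral_congr_ae h0]; simp⟩
  add_mem' := by
    rintro a b ⟨ha, ha'⟩ ⟨hb, hb'⟩
    rw [Set.mem_ofPred_eq, map_add]
    have h0 := Lp.coeFn_add a.toL2 b.toL2
    refine ⟨(ha.add hb).congr h0.symm, ?_⟩
    rw [integral_congr_ae h0, integral_add' ha hb, ha', hb', add_zero]
  smul_mem' := by
    rintro c a ⟨ha, ha'⟩
    rw [Set.mem_ofPred_eq, map_smul]
    have h0 := Lp.coeFn_smul c a.toL2
    refine ⟨(ha.smul c).congr h0.symm, ?_⟩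
    rw [integral_congr_ae h0]
    simp only [Pi.smul_apply]
    rw [integral_smul, ha', smul_zero]

/-- Shortcut instances: the subspaces carry the norms of the ambient spaces. -/
instance instGroupW12minusStar (Ω : Set (Eu N)) : SeminormedAddCommGroup (W12minusStar Ω) :=
  Submodule.seminormedAddCommGroup _

instance instSpaceW12minusStar (Ω : Set (Eu N)) : NormedSpace ℝ (W12minusStar Ω) :=
  Submodule.normedSpace _

instance instGroupW12halfStar (Ω : Set (Eu N)) : SeminormedAddCommGroup (W12halfStar Ω) :=
  Submodule.seminormedAddCommGroup _

instance instSpaceW12halfStar (Ω : Set (Eu N)) : NormedSpace ℝ (W12halfStar Ω) :=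
  Submodule.normedSpace _

/-! ### Boundary value problems -/

/-- The form `∫_Ω A ∇u · ∇ψ`. -/
def form {Ω : Set (Eu N)} (A : Eu N → Mat N) (u ψ : W12 Ω) : ℝ :=
  ∫ x in Ω, (A x *ᵥ (u.grad x).ofLp) ⬝ᵥ (ψ.grad x).ofLp

/-- `u` is a weak solution of `-div (A ∇u) = F` in `Ω`, `u = φ` on `∂Ω`. -/
def IsDirichletSol {Ω : Set (Eu N)} (A : Eu N → Mat N) (F : W12 Ω →L[ℝ] ℝ) (φ u : W12 Ω) : Prop :=
  u - φ ∈ W120 Ω ∧ ∀ ψ ∈ W120 Ω, form A u ψ = F ψ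

/-- `u` is a weak solution of `-div (A ∇u) = 0` in `Ω`, `u = φ` on `∂Ω`, for a boundary datum
`φ` in `W^{1/2,2}(∂Ω)`. -/
def IsDirichletSolBdry {Ω : Set (Eu N)} (A : Eu N → Mat N) (φ : W12half Ω) (u : W12 Ω) : Prop :=
  ∃ φ' : W12 Ω, IsTrace φ' φ ∧ IsDirichletSol A 0 φ' u

/-- `v` is a weak solution of `-div (A ∇v) = 0` in `Ω`, `A ∇v · ν = g` on `∂Ω`,
`∫_{∂Ω} v = 0`. -/
def IsNeumannSol {Ω : Set (Eu N)} (A : Eu N → Mat N) (g : W12minusStar Ω) (v : W12 Ω) : Prop :=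
  (∃ h ∈ W12halfStar Ω, IsTrace v h) ∧
    ∀ (ψ : W12 Ω) (k : W12half Ω), IsTrace ψ k → form A v ψ = g.1 k

/-- `H`-convergence of `An n` to `A` in `Ω`: for every `F` in the dual of `W^{1,2}(Ω)` the
solutions with zero Dirichlet data converge weakly in `W^{1,2}`, and the corresponding fluxes
converge weakly in `L²(Ω, ℝ^N)`. -/
def HConverges (Ω : Set (Eu N)) (An : ℕ → Eu N → Mat N) (A : Eu N → Mat N) : Prop :=
  ∀ (F : W12 Ω →L[ℝ] ℝ) (un : ℕ → W12 Ω) (u : W12 Ω),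
    (∀ n, IsDirichletSol (An n) F 0 (un n)) → IsDirichletSol A F 0 u →
      (∀ l : W12 Ω →L[ℝ] ℝ, Tendsto (fun n => l (un n)) atTop (𝓝 (l u))) ∧
      ∀ G : L2Vec Ω,
        Tendsto (fun n => ∫ x in Ω, (An n x *ᵥ ((un n).grad x).ofLp) ⬝ᵥ (G x).ofLp) atTop
          (𝓝 (∫ x in Ω, (A x *ᵥ (u.grad x).ofLp) ⬝ᵥ (G x).ofLp))

/-! ### The forward operators -/

/-- `Λ` is the Dirichlet-to-Neumann map of `A`. -/
def IsDN {Ω : Set (Eu N)} (A : Eu N → Mat N) (Λ : W12half Ω →L[ℝ] W12minusStar Ω) : Prop :=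
  ∀ φ : W12half Ω, ∃ u : W12 Ω, IsDirichletSolBdry A φ u ∧
    ∀ (ψ : W12half Ω) (ψ' : W12 Ω), IsTrace ψ' ψ → (Λ φ).1 ψ = form A u ψ'

/-- `Λ` is the Neumann-to-Dirichlet map of `A`. -/
def IsND {Ω : Set (Eu N)} (A : Eu N → Mat N) (Λ : W12minusStar Ω →L[ℝ] W12halfStar Ω) : Prop :=
  ∀ g : W12minusStar Ω, ∃ v : W12 Ω, IsNeumannSol A g v ∧ IsTrace v (Λ g).1

/-- The power `M^{i/2}` of a matrix for `i = 1, 2`: the matrix itself for `i = 2` and the positive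
semidefinite square root (of a symmetric positive semidefinite matrix) for `i = 1`. -/
def halfPow (i : ℕ) (M : Mat N) : Mat N :=
  if i = 1 then cfc Real.sqrt M else M

/-- `K` is the operator `φ ↦ A^{i/2} (∇u(A, 0, φ) - ∇v(A, Λ φ))`. -/
def IsKD {Ω : Set (Eu N)} (Λ : W12half Ω →L[ℝ] W12minusStar Ω) (i : ℕ) (A : Eu N → Mat N)
    (K : W12half Ω →L[ℝ] L2Vec Ω) : Prop :=
  ∀ φ : W12half Ω, ∃ u v : W12 Ω, IsDirichletSolBdry A φ u ∧ IsNeumannSol A (Λ φ) v ∧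
    ∀ᵐ x ∂(volume.restrict Ω),
      (K φ x).ofLp = halfPow i (A x) *ᵥ ((u.grad x).ofLp - (v.grad x).ofLp)

/-- `K` is the operator `g ↦ A^{i/2} (∇u(A, 0, Λ g) - ∇v(A, g))`. -/
def IsKN {Ω : Set (Eu N)} (Λ : W12minusStar Ω →L[ℝ] W12halfStar Ω) (i : ℕ) (A : Eu N → Mat N)
    (K : W12minusStar Ω →L[ℝ] L2Vec Ω) : Prop :=
  ∀ g : W12minusStar Ω, ∃ u v : W12 Ω, IsDirichletSolBdry A (Λ g).1 u ∧ IsNeumannSol A g v ∧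
    ∀ᵐ x ∂(volume.restrict Ω),
      (K g x).ofLp = halfPow i (A x) *ᵥ ((u.grad x).ofLp - (v.grad x).ofLp)

open Classical in
/-- The Dirichlet-to-Neumann map `D-N(A)` (with value `0` if `A` has none). -/
def DN (Ω : Set (Eu N)) (A : Eu N → Mat N) : W12half Ω →L[ℝ] W12minusStar Ω :=
  if h : ∃ Λ, IsDN A Λ then h.choose else 0

open Classical in
/-- The Neumann-to-Dirichlet map `N-D(A)` (with value `0` if `A` has none). -/
def ND (Ω : Set (Eu N)) (A : Eu N → Mat N) : W12minusStar Ω →L[ℝ] W12halfStar Ω :=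
  if h : ∃ Λ, IsND A Λ then h.choose else 0

open Classical in
/-- The operator `KD_i(A)` (with value `0` if it does not exist). -/
def KD {Ω : Set (Eu N)} (Λ : W12half Ω →L[ℝ] W12minusStar Ω) (i : ℕ) (A : Eu N → Mat N) :
    W12half Ω →L[ℝ] L2Vec Ω :=
  if h : ∃ K, IsKD Λ i A K then h.choose else 0

open Classical in
/-- The operator `KN_i(A)` (with value `0` if it does not exist). -/
def KN {Ω : Set (Eu N)} (Λ : W12minusStar Ω →L[ℝ] W12halfStar Ω) (i : ℕ) (A : Eu N → Mat N) :
    W12minusStar Ω →L[ℝ] L2Vec Ω :=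
  if h : ∃ K, IsKN Λ i A K then h.choose else 0

end Conductivity

end

open Conductivity

/-!
The solutions of the boundary value problems and their fluxes depend weakly continuously on the
tensor with respect to `H`-convergence, and all the norms in question are weakly lower
semicontinuous in these quantities, or in their energies.

**The operators exist.** Both problems are solved by the Lax–Milgram theorem. The form is coercive by
the Friedrichs inequality (`exists_friedrichs`) for the Dirichlet problem and by the Poincaré
inequality with the boundary mean (`IsBoundedLipschitzDomain.exists_poincare`) for the Neumann
problem, with constants that depend only on the ellipticity bounds. The traces are treated as a
closed relation between `W^{1,2}(Ω)` and `L²(∂Ω)`, the closure of the smooth functions with their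
restrictions. In Lipschitz graph coordinates the fundamental theorem of calculus gives the trace
inequality, so that this relation is single valued (`IsTrace.unique`), and a bound for the `L²` norm
in a boundary strip. By the latter, cutting off near the boundary shows that the functions with zero
trace are those of `W^{1,2}_0` (`mem_W120S_of_zero_trace`). Hence a Dirichlet problem depends only
on the trace of its datum, the flux of a Dirichlet solution acts on traces, and a bounded
linear relation which is total and single valued is a bounded operator (`exists_unique_clm`).

**Weak continuity.** Solutions are bounded uniformly in the tensor, so subsequences of the solutions
and of their fluxes converge weakly. The limit flux is identified by Tartar's argument
(`HConverges.flux_eq`): the sequence is compared with solutions `wₙ` of Dirichlet problems whose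
`H`-limit `w` is prescribed, the monotonicity of `Aₙ` makes the localized product of the differences
of fluxes and gradients nonnegative, the div-curl lemma (`tendsto_inner_mulS`, a consequence of
Rellich's theorem `tendsto_fn_of_weakTendsto`) passes this to the limit, and varying `w` turns the
inequality into an equality. The limit solves the limit problem, which has one solution, so the whole
sequence converges (`HConverges.weakTendsto_dirichlet`, `HConverges.weakTendsto_neumann`). The
div-curl lemma shows as well that the limit of symmetric tensors is symmetric
(`HConverges.isSymmTensor`).

**Lower semicontinuity.** It suffices to argue for a fixed argument of the operators
(`enorm_le_liminf_of_forall`). For the Dirichlet-to-Neumann operator and for exponent `i = 2` the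
values depend linearly on the weakly convergent fluxes. For the Neumann-to-Dirichlet operator, the
norm of a trace is the norm of the component orthogonal to `W^{1,2}_0` of any extension
(`IsTrace.norm_eq`), and this component converges weakly. For `i = 1` the squared norm is the energy
of the difference of a Dirichlet and a Neumann solution: by the div-curl lemma its localizations by
test functions `0 ≤ η ≤ 1` converge, they bound the energies from below, and they exhaust the
energy of the limit (`HConverges.enorm_misfit_le`).
-/

namespace Conductivity

variable {N : ℕ} {Ω : Set (Eu N)}

/-! ### The Sobolev space -/

/-- The weak gradient as a bounded operator. -/
noncomputable def gradL (Ω : Set (Eu N)) : W12 Ω →L[ℝ] L2Vec Ω :=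
  (WithLp.sndL 2 ℝ (L2 Ω) (L2Vec Ω)).comp (sobolev Ω).subtypeL

/-- The inclusion of `W^{1,2}(Ω)` in `L²(Ω)` as a bounded operator. -/
noncomputable def fnL (Ω : Set (Eu N)) : W12 Ω →L[ℝ] L2 Ω :=
  (WithLp.fstL 2 ℝ (L2 Ω) (L2Vec Ω)).comp (sobolev Ω).subtypeL

theorem gradL_apply (u : W12 Ω) : gradL Ω u = u.grad := rfl
theorem fnL_apply (u : W12 Ω) : fnL Ω u = u.fn := rfl

theorem norm_sq_W12 (u : W12 Ω) : ‖u‖ ^ 2 = ‖u.fn‖ ^ 2 + ‖u.grad‖ ^ 2 :=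
  WithLp.prod_norm_sq_eq_of_L2 u.1

theorem norm_grad_le (u : W12 Ω) : ‖u.grad‖ ≤ ‖u‖ := by
  have := norm_sq_W12 u
  exact abs_le_of_sq_le_sq' (by nlinarith [sq_nonneg ‖u.fn‖]) (norm_nonneg _) |>.2

theorem norm_W12_le (u : W12 Ω) : ‖u‖ ≤ ‖u.fn‖ + ‖u.grad‖ := by
  have := norm_sq_W12 u
  exact abs_le_of_sq_le_sq' (by nlinarith [mul_nonneg (norm_nonneg u.fn) (norm_nonneg u.grad)])
    (by positivity) |>.2

theorem inner_L2_eq (f g : L2 Ω) : inner ℝ f g = ∫ x in Ω, f x * g x := by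
  rw [MeasureTheory.L2.inner_def]
  refine integral_congr_ae (Eventually.of_forall fun x => ?_)
  simp [mul_comm]

theorem inner_Eu_eq (v w : Eu N) : inner ℝ v w = v.ofLp ⬝ᵥ w.ofLp := by
  rw [EuclideanSpace.inner_eq_star_dotProduct, dotProduct_comm]
  simp

/-- The `i`-th component, as a bounded operator on vector fields. -/
noncomputable def coordL (Ω : Set (Eu N)) (i : Fin N) : L2Vec Ω →L[ℝ] L2 Ω :=
  (EuclideanSpace.proj (𝕜 := ℝ) i : Eu N →L[ℝ] ℝ).compLpL 2 (volume.restrict Ω)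

theorem coordL_ae (i : Fin N) (G : L2Vec Ω) :
    coordL Ω i G =ᵐ[volume.restrict Ω] fun x => G x i :=
  (EuclideanSpace.proj (𝕜 := ℝ) i : Eu N →L[ℝ] ℝ).coeFn_compLpL G

theorem isWeakGradient_iff (f : L2 Ω) (G : L2Vec Ω) : IsWeakGradient Ω f G ↔
    ∀ (φ : Eu N → ℝ) (h : IsTest Ω φ) (i : Fin N),
      inner ℝ f ((h.memLp_partialD i).toLp) + inner ℝ (coordL Ω i G) (h.memLp.toLp) = 0 := by
  refine forall_congr' fun φ => forall_congr' fun h => forall_congr' fun i => ?_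
  have e1 : inner ℝ f ((h.memLp_partialD i).toLp) = ∫ x in Ω, f x * partialD i φ x := by
    rw [inner_L2_eq]
    refine integral_congr_ae ?_
    filter_upwards [(h.memLp_partialD i).coeFn_toLp] with x hx
    rw [hx]
  have e2 : inner ℝ (coordL Ω i G) (h.memLp.toLp) = ∫ x in Ω, G x i * φ x := by
    rw [inner_L2_eq]
    refine integral_congr_ae ?_
    filter_upwards [h.memLp.coeFn_toLp, coordL_ae i G] with x hx hy
    rw [hx, hy]
  rw [e1, e2, eq_neg_iff_add_eq_zero]

theorem isClosed_sobolev : IsClosed (sobolev Ω : Set (WithLp 2 (L2 Ω × L2Vec Ω))) := by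
  have : (sobolev Ω : Set (WithLp 2 (L2 Ω × L2Vec Ω))) =
      ⋂ (φ : Eu N → ℝ) (h : IsTest Ω φ) (i : Fin N),
        {w | inner ℝ w.fst ((h.memLp_partialD i).toLp) +
          inner ℝ (coordL Ω i w.snd) (h.memLp.toLp) = 0} := by
    ext w
    simp only [Set.mem_iInter]
    exact isWeakGradient_iff w.fst w.snd
  rw [this]
  refine isClosed_iInter fun φ => isClosed_iInter fun h => isClosed_iInter fun i => ?_
  refine isClosed_eq ?_ continuous_const
  have c1 : Continuous fun w : WithLp 2 (L2 Ω × L2Vec Ω) => w.fst :=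
    (WithLp.fstL 2 ℝ (L2 Ω) (L2Vec Ω)).continuous
  have c2 : Continuous fun w : WithLp 2 (L2 Ω × L2Vec Ω) => w.snd :=
    (WithLp.sndL 2 ℝ (L2 Ω) (L2Vec Ω)).continuous
  exact (c1.inner continuous_const).add (((coordL Ω i).continuous.comp c2).inner continuous_const)

instance : CompleteSpace (W12 Ω) := isClosed_sobolev.completeSpace_coe

instance : TopologicalSpace.SeparableSpace (L2Vec Ω) := by
  have : Fact ((2 : ℝ≥0∞) ≠ ⊤) := ⟨ENNReal.ofNat_ne_top⟩
  infer_instance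

instance : SecondCountableTopology (W12 Ω) := by
  have : Fact ((2 : ℝ≥0∞) ≠ ⊤) := ⟨ENNReal.ofNat_ne_top⟩
  have : SecondCountableTopology (L2Vec Ω) := inferInstance
  have : SecondCountableTopology (L2 Ω) := inferInstance
  infer_instance

/-- Two elements of `W^{1,2}(Ω)` with the same underlying function coincide, because a weak
gradient is unique. -/
theorem W12.ext_fn (hΩ : IsOpen Ω) {u v : W12 Ω} (h : u.fn = v.fn) : u = v := by
  suffices hw : ∀ w : W12 Ω, w.fn = 0 → w.grad = 0 by
    have h1 : (u - v).fn = 0 := by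
      rw [← fnL_apply, map_sub, fnL_apply, fnL_apply, h, sub_self]
    have h2 := hw _ h1
    have h3 := norm_sq_W12 (u - v)
    rw [h1, h2] at h3
    have : ‖u - v‖ = 0 := by simpa using h3
    exact sub_eq_zero.1 (norm_eq_zero.1 this)
  intro w hw
  have key : ∀ i, ∀ᵐ x, x ∈ Ω → w.grad x i = 0 := by
    intro i
    refine hΩ.ae_eq_zero_of_integral_contDiff_smul_eq_zero ?_ ?_
    · have := memLp_coord (Lp.memLp w.grad) i
      exact locallyIntegrableOn_of_locallyIntegrable_restrict
        (this.locallyIntegrable one_le_two)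
    · intro g hg hgc hgs
      have ht : IsTest Ω g := ⟨hg, hgc, hgs⟩
      have := w.2 g ht i
      have e1 : ∫ x in Ω, w.1.fst x * partialD i g x = 0 := by
        refine integral_eq_zero_of_ae ?_
        have h0 : (w.fn : Eu N → ℝ) =ᵐ[volume.restrict Ω] 0 := by
          rw [hw]
          exact Lp.coeFn_zero ℝ 2 (volume.restrict Ω)
        filter_upwards [h0] with x hx
        exact mul_eq_zero_of_left hx _
      rw [e1, eq_comm, neg_eq_zero] at this
      rw [← this, ← setIntegral_eq_integral_of_forall_compl_eq_zero (s := Ω)]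
      · refine integral_congr_ae (Eventually.of_forall fun x => ?_)
        simp [mul_comm, W12.grad]
      · intro x hx
        rw [image_eq_zero_of_notMem_tsupport fun h => hx (hgs h), zero_smul]
  refine (Lp.eq_zero_iff_ae_eq_zero).2 ?_
  rw [EventuallyEq, ae_restrict_iff' hΩ.measurableSet]
  filter_upwards [ae_all_iff.2 key] with x hx hxΩ
  ext i
  simpa using hx i hxΩ

/-! ### Multiplication by smooth functions -/

/-- The operator `G ↦ B · G` on square integrable functions, for an essentially bounded
coefficient `B` with values in the bounded linear maps. -/
noncomputable def mulCoef {E F : Type*} [NormedAddCommGroup E] [NormedSpace ℝ E]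
    [NormedAddCommGroup F] [NormedSpace ℝ F] {μ : Measure (Eu N)} {B : Eu N → E →L[ℝ] F}
    (hB : MemLp B ⊤ μ) : Lp E 2 μ →L[ℝ] Lp F 2 μ :=
  (ContinuousLinearMap.id ℝ (E →L[ℝ] F)).holderL μ ⊤ 2 2 hB.toLp

theorem mulCoef_ae {E F : Type*} [NormedAddCommGroup E] [NormedSpace ℝ E]
    [NormedAddCommGroup F] [NormedSpace ℝ F] {μ : Measure (Eu N)} {B : Eu N → E →L[ℝ] F}
    (hB : MemLp B ⊤ μ) (G : Lp E 2 μ) : mulCoef hB G =ᵐ[μ] fun x => B x (G x) := by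
  filter_upwards [(ContinuousLinearMap.id ℝ (E →L[ℝ] F)).coeFn_holder (r := 2) hB.toLp G,
    hB.coeFn_toLp] with x hx hx'
  rw [hx'] at hx
  exact hx

/-- A continuous function lies in every Lebesgue space over a bounded set. -/
theorem memLp_of_continuous {E : Type*} [NormedAddCommGroup E] [SecondCountableTopology E]
    (hb : Bornology.IsBounded Ω) {f : Eu N → E} (hf : Continuous f) (p : ℝ≥0∞) :
    MemLp f p (volume.restrict Ω) := by
  have : Fact (volume Ω < ⊤) := ⟨hb.measure_lt_top⟩
  have hf' : AEStronglyMeasurable f (volume.restrict Ω) := hf.aestronglyMeasurable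
  obtain ⟨C, hC⟩ := hb.isCompact_closure.exists_bound_of_continuousOn hf.continuousOn
  refine MemLp.of_bound hf' C ?_
  rw [ae_iff]
  refine measure_mono_null (t := (closure Ω)ᶜ) (fun x hx hx' => hx (hC x hx')) ?_
  rw [Measure.restrict_apply isClosed_closure.measurableSet.compl]
  convert measure_empty (μ := (volume : Measure (Eu N)))
  exact Set.disjoint_iff_inter_eq_empty.1 (Set.disjoint_left.2 fun x hx hx' => hx (subset_closure hx'))

theorem gradient_apply (f : Eu N → ℝ) (x : Eu N) (i : Fin N) : gradient f x i = partialD i f x := by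
  unfold partialD
  rw [← toDual_gradient, InnerProductSpace.toDual_apply_apply, EuclideanSpace.inner_single_right]
  simp

theorem norm_gradient (f : Eu N → ℝ) (x : Eu N) : ‖gradient f x‖ = ‖fderiv ℝ f x‖ := by
  rw [← toDual_gradient, LinearIsometryEquiv.norm_map]

theorem continuous_gradient {f : Eu N → ℝ} (hf : ContDiff ℝ ∞ f) : Continuous (gradient f) := by
  unfold gradient
  exact (LinearIsometryEquiv.continuous _).comp (hf.continuous_fderiv (by simp))

theorem memLp_smul_id {E : Type*} [NormedAddCommGroup E] [NormedSpace ℝ E] [FiniteDimensional ℝ E]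
    (hb : Bornology.IsBounded Ω) {θ : Eu N → ℝ} (hθ : ContDiff ℝ ∞ θ) :
    MemLp (fun x => θ x • ContinuousLinearMap.id ℝ E) ⊤ (volume.restrict Ω) := by
  have := FiniteDimensional.proper_real E
  have := FiniteDimensional.proper_real (E →L[ℝ] E)
  exact memLp_of_continuous hb (hθ.continuous.smul continuous_const) _

theorem memLp_gradient_smul (hb : Bornology.IsBounded Ω) {θ : Eu N → ℝ} (hθ : ContDiff ℝ ∞ θ) :
    MemLp (fun x => ContinuousLinearMap.toSpanSingleton ℝ (gradient θ x)) ⊤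
      (volume.restrict Ω) := by
  refine memLp_of_continuous hb ?_ _
  exact (ContinuousLinearMap.toSpanSingletonCLE (𝕜 := ℝ) (E := Eu N)).continuous.comp
    (continuous_gradient hθ)

theorem IsTest.mul {φ θ : Eu N → ℝ} (hφ : IsTest Ω φ) (hθ : ContDiff ℝ ∞ θ) :
    IsTest Ω fun x => θ x * φ x :=
  ⟨hθ.mul hφ.smooth, hφ.compact.mul_left, (tsupport_mul_subset_right).trans hφ.support⟩

theorem partialD_mul {θ φ : Eu N → ℝ} {x : Eu N} (i : Fin N) (hθ : DifferentiableAt ℝ θ x)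
    (hφ : DifferentiableAt ℝ φ x) :
    partialD i (fun x => θ x * φ x) x = θ x * partialD i φ x + φ x * partialD i θ x := by
  unfold partialD
  rw [fderiv_fun_mul hθ hφ]
  simp

/-- Multiplication of a Sobolev function by a function smooth up to the boundary. -/
noncomputable def smulW (hb : Bornology.IsBounded Ω) {θ : Eu N → ℝ} (hθ : ContDiff ℝ ∞ θ) :
    W12 Ω →L[ℝ] W12 Ω :=
  ContinuousLinearMap.codRestrict
    ((WithLp.prodContinuousLinearEquiv 2 ℝ (L2 Ω) (L2Vec Ω)).symm.toContinuousLinearMap.comp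
      (((mulCoef (memLp_smul_id hb hθ)).comp (fnL Ω)).prod
        ((mulCoef (memLp_smul_id hb hθ)).comp (gradL Ω) +
          (mulCoef (memLp_gradient_smul hb hθ)).comp (fnL Ω))))
    (sobolev Ω) (by
      intro u φ hφ i
      have e1 := mulCoef_ae (memLp_smul_id (E := ℝ) hb hθ) u.fn
      have e2 := mulCoef_ae (memLp_smul_id (E := Eu N) hb hθ) u.grad
      have e3 := mulCoef_ae (memLp_gradient_smul hb hθ) u.fn
      have e4 := Lp.coeFn_add (mulCoef (memLp_smul_id (E := Eu N) hb hθ) u.grad)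
        (mulCoef (memLp_gradient_smul hb hθ) u.fn)
      have h1 : ∫ x in Ω, (mulCoef (memLp_smul_id (E := ℝ) hb hθ) u.fn) x * partialD i φ x =
          ∫ x in Ω, (u.fn x * partialD i (fun x => θ x * φ x) x
            - u.fn x * (φ x * partialD i θ x)) := by
        refine integral_congr_ae ?_
        filter_upwards [e1] with x hx
        rw [hx, partialD_mul i (hθ.differentiable (by simp) x)
          (hφ.smooth.differentiable (by simp) x)]
        simp
        ring
      have h2 : ∫ x in Ω, (mulCoef (memLp_smul_id (E := Eu N) hb hθ) u.grad +
            mulCoef (memLp_gradient_smul hb hθ) u.fn : L2Vec Ω) x i * φ x =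
          ∫ x in Ω, (u.grad x i * (θ x * φ x) + u.fn x * (φ x * partialD i θ x)) := by
        refine integral_congr_ae ?_
        filter_upwards [e2, e3, e4] with x hx hx' hx''
        rw [hx'', Pi.add_apply, hx, hx']
        simp [gradient_apply]
        ring
      have hc : IsTest Ω fun x => φ x * partialD i θ x := by
        have hd : ContDiff ℝ ∞ (partialD i θ) :=
          (hθ.fderiv_right (m := ∞) (by simp)).clm_apply contDiff_const
        have := hφ.mul hd
        simpa only [mul_comm] using this
      have i1 := (Lp.memLp u.fn).integrable_mul ((hφ.mul hθ).memLp_partialD i)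
      have i2 := (Lp.memLp u.fn).integrable_mul hc.memLp
      have i3 := (memLp_coord (Lp.memLp u.grad) i).integrable_mul (hφ.mul hθ).memLp
      refine h1.trans (Eq.trans ?_ (congrArg Neg.neg h2.symm))
      refine (integral_sub i1 i2).trans ?_
      refine Eq.trans ?_ (congrArg Neg.neg (integral_add i3 i2).symm)
      have := u.2 _ (hφ.mul hθ) i
      rw [neg_add, ← sub_eq_add_neg]
      exact congrArg (· - _) this)

theorem smulW_fn (hb : Bornology.IsBounded Ω) {θ : Eu N → ℝ} (hθ : ContDiff ℝ ∞ θ) (u : W12 Ω) :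
    (smulW hb hθ u).fn =ᵐ[volume.restrict Ω] fun x => θ x * u.fn x := by
  filter_upwards [mulCoef_ae (memLp_smul_id (E := ℝ) hb hθ) u.fn] with x hx
  exact hx

theorem smulW_grad (hb : Bornology.IsBounded Ω) {θ : Eu N → ℝ} (hθ : ContDiff ℝ ∞ θ) (u : W12 Ω) :
    (smulW hb hθ u).grad =ᵐ[volume.restrict Ω]
      fun x => θ x • u.grad x + u.fn x • gradient θ x := by
  filter_upwards [mulCoef_ae (memLp_smul_id (E := Eu N) hb hθ) u.grad,
    mulCoef_ae (memLp_gradient_smul hb hθ) u.fn,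
    Lp.coeFn_add (mulCoef (memLp_smul_id (E := Eu N) hb hθ) u.grad)
        (mulCoef (memLp_gradient_smul hb hθ) u.fn)] with x hx hx' hx''
  rw [Pi.add_apply, hx, hx'] at hx''
  exact hx''

/-- The constant function `1` as a Sobolev function. -/
noncomputable def oneW (hb : Bornology.IsBounded Ω) : W12 Ω :=
  ⟨WithLp.toLp 2 ((memLp_of_continuous hb (continuous_const (y := (1 : ℝ))) 2).toLp, 0), by
    intro φ hφ i
    have e1 : ∫ x in Ω, ((memLp_of_continuous hb (continuous_const (y := (1 : ℝ))) 2).toLp) x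
        * partialD i φ x = 0 := by
      have h1 : ∫ x in Ω, ((memLp_of_continuous hb (continuous_const (y := (1 : ℝ))) 2).toLp) x
        * partialD i φ x = ∫ x in Ω, partialD i φ x := by
        refine integral_congr_ae ?_
        filter_upwards [(memLp_of_continuous hb (continuous_const (y := (1 : ℝ))) 2).coeFn_toLp]
          with x hx
        rw [hx, one_mul]
      have hs : HasCompactSupport (partialD i φ) := hφ.compact.fderiv_apply (𝕜 := ℝ) _
      have hc : Continuous (partialD i φ) := by
        have := hφ.smooth.continuous_fderiv (by simp)
        unfold partialD
        fun_prop
      rw [h1, setIntegral_eq_integral_of_forall_compl_eq_zero]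
      · have := integral_mul_fderiv_eq_neg_fderiv_mul_of_integrable
          (μ := (volume : Measure (Eu N))) (f := fun _ => (1 : ℝ)) (g := φ)
          (v := EuclideanSpace.single i 1) (by simp)
          (by simpa [partialD] using! hc.integrable_of_hasCompactSupport (μ := volume) hs)
          (by simpa using hφ.smooth.continuous.integrable_of_hasCompactSupport hφ.compact)
          (by simp) (fun x _ => hφ.smooth.differentiable (by simp) x)
        simpa [partialD] using this
      · intro x hx
        have : x ∉ tsupport (partialD i φ) := fun h =>
          hx (hφ.support ((tsupport_fderiv_apply_subset ℝ _) h))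
        exact image_eq_zero_of_notMem_tsupport this
    refine e1.trans ?_
    rw [eq_comm, neg_eq_zero]
    refine integral_eq_zero_of_ae ?_
    filter_upwards [Lp.coeFn_zero (Eu N) 2 (volume.restrict Ω)] with x hx
    change ((0 : L2Vec Ω) x) i * φ x = 0
    rw [hx]
    simp⟩

theorem oneW_fn (hb : Bornology.IsBounded Ω) :
    (oneW hb).fn =ᵐ[volume.restrict Ω] fun _ => 1 :=
  (memLp_of_continuous hb (continuous_const (y := (1 : ℝ))) 2).coeFn_toLp

theorem oneW_grad (hb : Bornology.IsBounded Ω) : (oneW hb).grad = 0 := rfl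

/-- A function smooth up to the boundary as a Sobolev function. -/
noncomputable def ofSmooth (hb : Bornology.IsBounded Ω) {f : Eu N → ℝ} (hf : ContDiff ℝ ∞ f) :
    W12 Ω :=
  smulW hb hf (oneW hb)

theorem ofSmooth_fn (hb : Bornology.IsBounded Ω) {f : Eu N → ℝ} (hf : ContDiff ℝ ∞ f) :
    (ofSmooth hb hf).fn =ᵐ[volume.restrict Ω] f := by
  filter_upwards [smulW_fn hb hf (oneW hb), oneW_fn hb] with x h1 h2
  rw [ofSmooth, h1, h2, mul_one]

theorem ofSmooth_grad (hb : Bornology.IsBounded Ω) {f : Eu N → ℝ} (hf : ContDiff ℝ ∞ f) :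
    (ofSmooth hb hf).grad =ᵐ[volume.restrict Ω] gradient f := by
  filter_upwards [smulW_grad hb hf (oneW hb), oneW_fn hb,
    Lp.coeFn_zero (Eu N) 2 (volume.restrict Ω)] with x h1 h2 h3
  rw [ofSmooth, h1, h2, oneW_grad, h3]
  simp

theorem eq_ofSmooth (ho : IsOpen Ω) (hb : Bornology.IsBounded Ω) {f : Eu N → ℝ}
    (hf : ContDiff ℝ ∞ f) {u : W12 Ω} (hu : u.fn =ᵐ[volume.restrict Ω] f) : u = ofSmooth hb hf :=
  W12.ext_fn ho (Lp.ext (hu.trans (ofSmooth_fn hb hf).symm))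

theorem smulW_ofSmooth (ho : IsOpen Ω) (hb : Bornology.IsBounded Ω) {f θ : Eu N → ℝ}
    (hf : ContDiff ℝ ∞ f) (hθ : ContDiff ℝ ∞ θ) :
    smulW hb hθ (ofSmooth hb hf) = ofSmooth hb (hθ.mul hf) := by
  refine eq_ofSmooth ho hb _ ?_
  filter_upwards [smulW_fn hb hθ (ofSmooth hb hf), ofSmooth_fn hb hf] with x h1 h2
  rw [h1, h2]

/-- The test functions, as a subspace of `W^{1,2}(Ω)`. -/
def testSub (Ω : Set (Eu N)) : Submodule ℝ (W12 Ω) where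
  carrier := {u | ∃ φ : Eu N → ℝ, IsTest Ω φ ∧ u.fn =ᵐ[volume.restrict Ω] φ}
  zero_mem' := ⟨fun _ => 0, ⟨contDiff_const, HasCompactSupport.zero, by
    rw [(tsupport_eq_empty_iff (f := fun _ : Eu N => (0 : ℝ))).2 rfl]; exact Set.empty_subset _⟩, Lp.coeFn_zero _ _ _⟩
  add_mem' := by
    rintro a b ⟨f, hf, hf1⟩ ⟨g, hg, hg1⟩
    refine ⟨fun x => f x + g x, ⟨hf.smooth.add hg.smooth, hf.compact.add hg.compact, ?_⟩,
      (Lp.coeFn_add a.fn b.fn).trans (hf1.add hg1)⟩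
    exact (tsupport_add f g).trans (Set.union_subset hf.support hg.support)
  smul_mem' := by
    rintro c a ⟨f, hf, hf1⟩
    exact ⟨fun x => c * f x, hf.mul contDiff_const, (Lp.coeFn_smul c a.fn).trans (hf1.const_smul c)⟩

/-- `W^{1,2}_0(Ω)` as a closed subspace. -/
noncomputable def W120S (Ω : Set (Eu N)) : Submodule ℝ (W12 Ω) := (testSub Ω).topologicalClosure

theorem isClosed_W120S : IsClosed (W120S Ω : Set (W12 Ω)) := isClosed_closure

theorem IsTest.ofSmooth_mem (hb : Bornology.IsBounded Ω) {φ : Eu N → ℝ} (h : IsTest Ω φ) :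
    ofSmooth hb h.smooth ∈ W120S Ω :=
  subset_closure ⟨φ, h, ofSmooth_fn hb h.smooth⟩

/-! ### Translation estimates and the Friedrichs inequality -/

theorem enorm_add_sq_le {E : Type*} [SeminormedAddCommGroup E] (a b : E) :
    ‖a + b‖ₑ ^ 2 ≤ 2 * (‖a‖ₑ ^ 2 + ‖b‖ₑ ^ 2) := by
  have h : ‖a + b‖ ^ 2 ≤ 2 * (‖a‖ ^ 2 + ‖b‖ ^ 2) := by
    nlinarith [norm_add_le a b, sq_nonneg (‖a‖ - ‖b‖), norm_nonneg (a + b)]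
  simp only [← ofReal_norm]
  rw [← ENNReal.ofReal_pow (norm_nonneg _), ← ENNReal.ofReal_pow (norm_nonneg _),
    ← ENNReal.ofReal_pow (norm_nonneg _), ← ENNReal.ofReal_add (by positivity) (by positivity),
    ← ENNReal.ofReal_ofNat 2, ← ENNReal.ofReal_mul (by norm_num)]
  exact ENNReal.ofReal_le_ofReal h

theorem enorm_sq_le_sub_add {E : Type*} [SeminormedAddCommGroup E] (a b : E) :
    ‖a‖ₑ ^ 2 ≤ 2 * (‖a - b‖ₑ ^ 2 + ‖b‖ₑ ^ 2) := by
  simpa using enorm_add_sq_le (a - b) b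

/-- Cauchy–Schwarz: the square of an integral over a set of finite measure. -/
theorem sq_lintegral_le {α : Type*} [MeasurableSpace α] {μ : Measure α} {g : α → ℝ≥0∞}
    (hg : AEMeasurable g μ) : (∫⁻ x, g x ∂μ) ^ 2 ≤ μ Set.univ * ∫⁻ x, g x ^ 2 ∂μ := by
  have h := ENNReal.lintegral_mul_le_Lp_mul_Lq μ (p := 2) (q := 2)
    (by rw [Real.holderConjugate_iff]; norm_num) (f := fun _ => (1 : ℝ≥0∞)) aemeasurable_const hg
  simp only [Pi.mul_apply, one_mul, ENNReal.one_rpow, lintegral_const] at h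
  calc (∫⁻ x, g x ∂μ) ^ 2
      ≤ (μ Set.univ ^ (1 / 2 : ℝ) * (∫⁻ x, g x ^ (2 : ℝ) ∂μ) ^ (1 / 2 : ℝ)) ^ 2 := by
        gcongr
    _ = _ := by
        rw [mul_pow, ← ENNReal.rpow_natCast, ← ENNReal.rpow_mul, ← ENNReal.rpow_natCast,
          ← ENNReal.rpow_mul]
        norm_num

/-- The fundamental theorem of calculus with the Cauchy–Schwarz inequality: the one-dimensional
estimate behind the Friedrichs, trace, strip and Poincaré inequalities. -/
theorem enorm_sub_sq_le {g g' : ℝ → ℝ} (hg : ∀ t, HasDerivAt g (g' t) t) (hg' : Continuous g')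
    {a b : ℝ} (hab : a ≤ b) :
    ‖g b - g a‖ₑ ^ 2 ≤ ENNReal.ofReal (b - a) * ∫⁻ t in Set.Ioc a b, ‖g' t‖ₑ ^ 2 := by
  have h1 : ∫ t in a..b, g' t = g b - g a :=
    intervalIntegral.integral_eq_sub_of_hasDerivAt (fun t _ => hg t) (hg'.intervalIntegrable a b)
  rw [← h1, intervalIntegral.integral_of_le hab]
  calc ‖∫ t in Set.Ioc a b, g' t‖ₑ ^ 2 ≤ (∫⁻ t in Set.Ioc a b, ‖g' t‖ₑ) ^ 2 := by
        gcongr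
        exact enorm_integral_le_lintegral_enorm _
    _ ≤ _ := by
        refine (sq_lintegral_le hg'.enorm.measurable.aemeasurable).trans_eq ?_
        simp

theorem hasDerivAt_line {f : Eu N → ℝ} (hf : ContDiff ℝ ∞ f) (x w : Eu N) (t : ℝ) :
    HasDerivAt (fun t : ℝ => f (x + t • w)) (fderiv ℝ f (x + t • w) w) t := by
  have h1 : HasDerivAt (fun t : ℝ => x + t • w) w t := by
    simpa using ((hasDerivAt_id t).smul_const w).const_add x
  exact ((hf.differentiable (by simp) (x + t • w)).hasFDerivAt).comp_hasDerivAt t h1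

/-- The increment of a smooth function along a segment. -/
theorem enorm_line_sub_sq_le {f : Eu N → ℝ} (hf : ContDiff ℝ ∞ f) (x w : Eu N) {a b : ℝ}
    (hab : a ≤ b) :
    ‖f (x + b • w) - f (x + a • w)‖ₑ ^ 2 ≤
      ENNReal.ofReal (b - a) * (‖w‖ₑ ^ 2 * ∫⁻ t in Set.Ioc a b, ‖gradient f (x + t • w)‖ₑ ^ 2) := by
  have hc : Continuous fun t : ℝ => fderiv ℝ f (x + t • w) w :=
    ((hf.continuous_fderiv (by simp)).comp (by fun_prop)).clm_apply continuous_const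
  refine (enorm_sub_sq_le (hasDerivAt_line hf x w) hc hab).trans ?_
  gcongr
  rw [← lintegral_const_mul']
  · refine lintegral_mono fun t => ?_
    rw [← mul_pow]
    gcongr
    rw [mul_comm, ← ofReal_norm (gradient f _), norm_gradient, ofReal_norm]
    exact (fderiv ℝ f (x + t • w)).le_opENorm w
  · finiteness

/-- The translation estimate `∫_S |f(x + w) - f(x)|² ≤ |w|² ∫_T |∇f|²`, when the segments from `x`
to `x + w`, `x ∈ S`, are contained in `T`. -/
theorem lintegral_translation_sq_le {f : Eu N → ℝ} (hf : ContDiff ℝ ∞ f) {S T : Set (Eu N)}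
    (hS : MeasurableSet S) (hT : MeasurableSet T) (w : Eu N)
    (hST : ∀ x ∈ S, ∀ t ∈ Set.Ioc (0 : ℝ) 1, x + t • w ∈ T) :
    ∫⁻ x in S, ‖f (x + w) - f x‖ₑ ^ 2 ≤ ‖w‖ₑ ^ 2 * ∫⁻ x in T, ‖gradient f x‖ₑ ^ 2 := by
  have hG : Measurable fun x => ‖gradient f x‖ₑ ^ 2 :=
    ((continuous_gradient hf).enorm.measurable).pow_const 2
  calc ∫⁻ x in S, ‖f (x + w) - f x‖ₑ ^ 2
      ≤ ∫⁻ x in S, ‖w‖ₑ ^ 2 * ∫⁻ t in Set.Ioc (0 : ℝ) 1, ‖gradient f (x + t • w)‖ₑ ^ 2 := by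
        refine lintegral_mono fun x => ?_
        simpa using enorm_line_sub_sq_le hf x w (zero_le_one' ℝ)
    _ = ‖w‖ₑ ^ 2 * ∫⁻ x in S, ∫⁻ t in Set.Ioc (0 : ℝ) 1, ‖gradient f (x + t • w)‖ₑ ^ 2 := by
        rw [lintegral_const_mul']
        finiteness
    _ = ‖w‖ₑ ^ 2 * ∫⁻ t in Set.Ioc (0 : ℝ) 1, ∫⁻ x in S, ‖gradient f (x + t • w)‖ₑ ^ 2 := by
        rw [lintegral_lintegral_swap]
        refine Measurable.aemeasurable ?_
        exact hG.comp (by fun_prop)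
    _ ≤ ‖w‖ₑ ^ 2 * ∫⁻ _ in Set.Ioc (0 : ℝ) 1, ∫⁻ x in T, ‖gradient f x‖ₑ ^ 2 := by
        refine mul_le_mul' le_rfl (setLIntegral_mono' measurableSet_Ioc fun t ht => ?_)
        rw [← lintegral_indicator hS, ← lintegral_indicator hT]
        rw [← lintegral_add_right_eq_self (T.indicator fun x => ‖gradient f x‖ₑ ^ 2) (t • w)]
        refine lintegral_mono fun x => ?_
        by_cases hx : x ∈ S
        · rw [Set.indicator_of_mem hx, Set.indicator_of_mem (hST x hx t ht)]
        · rw [Set.indicator_of_notMem hx]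
          exact zero_le
    _ = _ := by simp

theorem enorm_sq_Lp {E : Type*} [NormedAddCommGroup E] {μ : Measure (Eu N)} (f : Lp E 2 μ) :
    ‖f‖ₑ ^ 2 = ∫⁻ x, ‖f x‖ₑ ^ 2 ∂μ := by
  rw [Lp.enorm_def, eLpNorm_eq_lintegral_rpow_enorm_toReal (by simp) (by simp),
    ← ENNReal.rpow_natCast, ← ENNReal.rpow_mul]
  norm_num

theorem enorm_sq_Lp_of_ae {E : Type*} [NormedAddCommGroup E] {μ : Measure (Eu N)} {f : Lp E 2 μ}
    {g : Eu N → E} (h : f =ᵐ[μ] g) : ‖f‖ₑ ^ 2 = ∫⁻ x, ‖g x‖ₑ ^ 2 ∂μ := by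
  rw [enorm_sq_Lp]
  refine lintegral_congr_ae ?_
  filter_upwards [h] with x hx
  rw [hx]

theorem IsTest.eq_zero {φ : Eu N → ℝ} (h : IsTest Ω φ) {x : Eu N} (hx : x ∉ Ω) : φ x = 0 :=
  image_eq_zero_of_notMem_tsupport fun h' => hx (h.support h')

theorem IsTest.gradient_eq_zero {φ : Eu N → ℝ} (h : IsTest Ω φ) {x : Eu N} (hx : x ∉ Ω) :
    gradient φ x = 0 := by
  rw [← norm_eq_zero, norm_gradient, norm_eq_zero]
  exact image_eq_zero_of_notMem_tsupport fun h' => hx (h.support (tsupport_fderiv_subset ℝ h'))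

theorem IsTest.lintegral_gradient (ho : IsOpen Ω) {φ : Eu N → ℝ} (h : IsTest Ω φ) :
    ∫⁻ x in Set.univ, ‖gradient φ x‖ₑ ^ 2 = ∫⁻ x in Ω, ‖gradient φ x‖ₑ ^ 2 := by
  rw [Measure.restrict_univ, ← lintegral_indicator ho.measurableSet]
  refine lintegral_congr fun x => ?_
  by_cases hx : x ∈ Ω
  · rw [Set.indicator_of_mem hx]
  · rw [Set.indicator_of_notMem hx, h.gradient_eq_zero hx]
    simp

theorem norm_le_of_enorm_sq_le {E F : Type*} [SeminormedAddCommGroup E] [SeminormedAddCommGroup F]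
    {a : E} {b : F} {C : ℝ≥0} (h : ‖a‖ₑ ^ 2 ≤ (C : ℝ≥0∞) ^ 2 * ‖b‖ₑ ^ 2) : ‖a‖ ≤ C * ‖b‖ := by
  rw [← mul_pow] at h
  have := (ENNReal.pow_le_pow_left_iff two_ne_zero).1 h
  simpa using ENNReal.toReal_mono (by finiteness) this

/-- The Friedrichs inequality, by translating a function with support in `Ω` out of `Ω`. -/
theorem exists_friedrichs (hN : 1 ≤ N) (ho : IsOpen Ω) (hb : Bornology.IsBounded Ω) :
    ∃ C : ℝ, 0 ≤ C ∧ ∀ u ∈ W120S Ω, ‖u.fn‖ ≤ C * ‖u.grad‖ := by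
  obtain ⟨R, hR⟩ := hb.exists_norm_le
  have hN' : Nonempty (Fin N) := ⟨⟨0, hN⟩⟩
  let i : Fin N := ⟨0, hN⟩
  -- `Ω` lies in a ball of radius `|R|`, so that `Ω + w` does not meet `Ω`
  set w : Eu N := EuclideanSpace.single i (2 * |R| + 1) with hw
  have hwn : ‖w‖ = 2 * |R| + 1 := by
    rw [hw, PiLp.norm_single, Real.norm_of_nonneg (by positivity)]
  refine ⟨‖w‖₊, by positivity, fun u hu => ?_⟩
  have hcl : IsClosed {u : W12 Ω | ‖u.fn‖ ≤ ‖w‖₊ * ‖u.grad‖} :=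
    isClosed_le (fnL Ω).continuous.norm (continuous_const.mul (gradL Ω).continuous.norm)
  refine closure_minimal ?_ hcl hu
  rintro u ⟨φ, hφ, hu⟩
  have hu' := eq_ofSmooth ho hb hφ.smooth hu
  refine norm_le_of_enorm_sq_le ?_
  rw [enorm_sq_Lp_of_ae hu, hu', enorm_sq_Lp_of_ae (ofSmooth_grad hb hφ.smooth)]
  have h := lintegral_translation_sq_le hφ.smooth ho.measurableSet MeasurableSet.univ w
    (fun x _ t _ => Set.mem_univ _)
  have h1 : ∫⁻ x in Ω, ‖φ x‖ₑ ^ 2 = ∫⁻ x in Ω, ‖φ (x + w) - φ x‖ₑ ^ 2 := by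
    refine setLIntegral_congr_fun ho.measurableSet fun x hx => ?_
    have : x + w ∉ Ω := fun hx' => by
      have h1 := hR _ hx'
      have h2 := hR _ hx
      have h3 : ‖w‖ ≤ ‖x + w‖ + ‖x‖ := by simpa using norm_sub_le (x + w) x
      have := le_abs_self R
      linarith
    simp only [hφ.eq_zero this, zero_sub, enorm_neg]
  rw [h1, ← hφ.lintegral_gradient ho]
  exact h

/-! ### Weak convergence in Hilbert spaces -/

/-- Weak convergence of a sequence in a Hilbert space. -/
def WeakTendsto {H : Type*} [NormedAddCommGroup H] [InnerProductSpace ℝ H] (u : ℕ → H) (a : H) :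
    Prop :=
  ∀ v : H, Tendsto (fun n => inner ℝ v (u n)) atTop (𝓝 (inner ℝ v a))

section WeakTendsto

variable {H : Type*} [NormedAddCommGroup H] [InnerProductSpace ℝ H]
  {K : Type*} [NormedAddCommGroup K] [InnerProductSpace ℝ K] {u v : ℕ → H} {a b : H}

theorem WeakTendsto.of_tendsto (h : Tendsto u atTop (𝓝 a)) : WeakTendsto u a :=
  fun _ => tendsto_const_nhds.inner h

theorem WeakTendsto.sub (hu : WeakTendsto u a) (hv : WeakTendsto v b) :
    WeakTendsto (fun n => u n - v n) (a - b) := fun w => by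
  simpa only [inner_sub_right] using (hu w).sub (hv w)

theorem WeakTendsto.const (a : H) : WeakTendsto (fun _ => a) a := fun _ => tendsto_const_nhds

theorem WeakTendsto.subseq (hu : WeakTendsto u a) {k : ℕ → ℕ} (hk : Tendsto k atTop atTop) :
    WeakTendsto (fun n => u (k n)) a := fun w => (hu w).comp hk

theorem WeakTendsto.dual [CompleteSpace H] (hu : WeakTendsto u a) (l : H →L[ℝ] ℝ) :
    Tendsto (fun n => l (u n)) atTop (𝓝 (l a)) := by
  simpa using hu ((InnerProductSpace.toDual ℝ H).symm l)

theorem WeakTendsto.of_dual (h : ∀ l : H →L[ℝ] ℝ, Tendsto (fun n => l (u n)) atTop (𝓝 (l a))) :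
    WeakTendsto u a := fun v => by
  simpa using h (innerSL ℝ v)

theorem WeakTendsto.map [CompleteSpace H] (hu : WeakTendsto u a) (T : H →L[ℝ] K) :
    WeakTendsto (fun n => T (u n)) (T a) := fun v => by
  simpa using hu.dual ((innerSL ℝ v).comp T)

theorem WeakTendsto.exists_bound [CompleteSpace H] (hu : WeakTendsto u a) :
    ∃ M, 0 ≤ M ∧ ∀ n, ‖u n‖ ≤ M := by
  obtain ⟨C, hC⟩ := banach_steinhaus (g := fun n => innerSL ℝ (u n)) fun v => by
    obtain ⟨C, hC⟩ := (Metric.isBounded_range_of_tendsto _ (hu v)).exists_norm_le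
    exact ⟨C, fun n => by
      simpa [real_inner_comm] using hC _ ⟨n, rfl⟩⟩
  exact ⟨C, (norm_nonneg _).trans (hC 0), fun n => by simpa using hC n⟩

theorem WeakTendsto.mem [CompleteSpace H] (hu : WeakTendsto u a) {S : Submodule ℝ H}
    (hS : IsClosed (S : Set H)) (hmem : ∀ n, u n ∈ S) : a ∈ S := by
  have : CompleteSpace S := hS.completeSpace_coe
  rw [← Submodule.orthogonal_orthogonal S, Submodule.mem_orthogonal]
  intro v hv
  refine tendsto_nhds_unique (hu v) ?_
  have : (fun n => inner ℝ v (u n)) = fun _ => 0 := by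
    ext n
    exact Submodule.inner_left_of_mem_orthogonal (hmem n) hv
  rw [this]
  exact tendsto_const_nhds

theorem WeakTendsto.enorm_le_liminf (hu : WeakTendsto u a) :
    ‖a‖ₑ ≤ liminf (fun n => ‖u n‖ₑ) atTop := by
  rcases eq_or_ne a 0 with rfl | ha
  · simp
  have h1 : Tendsto (fun n => ‖inner ℝ a (u n)‖ₑ) atTop (𝓝 ‖inner ℝ a a‖ₑ) :=
    (hu a).enorm
  have h2 : ‖inner ℝ a a‖ₑ = ‖a‖ₑ * ‖a‖ₑ := by
    rw [real_inner_self_eq_norm_mul_norm]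
    simp
  have hne : ‖a‖ₑ ≠ 0 := by simpa using ha
  have h3 : ‖a‖ₑ * ‖a‖ₑ ≤ ‖a‖ₑ * liminf (fun n => ‖u n‖ₑ) atTop := by
    rw [← h2, ← h1.liminf_eq, ← ENNReal.liminf_const_mul_of_ne_top (by finiteness)]
    refine liminf_le_liminf (Eventually.of_forall fun n => ?_)
    have := norm_inner_le_norm (𝕜 := ℝ) a (u n)
    rw [← ofReal_norm, ← ofReal_norm, ← ofReal_norm, ← ENNReal.ofReal_mul (norm_nonneg _)]
    exact ENNReal.ofReal_le_ofReal this
  exact (ENNReal.mul_le_mul_iff_right hne (by finiteness)).1 h3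

/-- The pairing of a weakly convergent sequence with a strongly convergent one. -/
theorem WeakTendsto.inner_tendsto [CompleteSpace H] (hu : WeakTendsto u a)
    (hv : Tendsto v atTop (𝓝 b)) :
    Tendsto (fun n => inner ℝ (u n) (v n)) atTop (𝓝 (inner ℝ a b)) := by
  obtain ⟨M, -, hM⟩ := hu.exists_bound
  have h1 : Tendsto (fun n => inner ℝ (u n) (v n - b)) atTop (𝓝 0) := by
    have h0 : Tendsto (fun n => M * ‖v n - b‖) atTop (𝓝 0) := by
      simpa using ((tendsto_iff_norm_sub_tendsto_zero.1 hv).const_mul M)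
    refine squeeze_zero_norm (fun n => ?_) h0
    exact (norm_inner_le_norm (u n) (v n - b)).trans (by gcongr; exact hM n)
  have h2 : Tendsto (fun n => inner ℝ (u n) b) atTop (𝓝 (inner ℝ a b)) := by
    simpa only [real_inner_comm] using hu b
  simpa [inner_sub_right] using h1.add h2

/-- Bounded sequences in a separable Hilbert space have weakly convergent subsequences. -/
theorem exists_weakTendsto_subseq [CompleteSpace H] [TopologicalSpace.SeparableSpace H] {M : ℝ}
    (hM : ∀ n, ‖u n‖ ≤ M) :
    ∃ (a : H) (k : ℕ → ℕ), StrictMono k ∧ WeakTendsto (fun n => u (k n)) a := by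
  have hs := WeakDual.isSeqCompact_closedBall ℝ H 0 M
  let x : ℕ → WeakDual ℝ H := fun n => StrongDual.toWeakDual (InnerProductSpace.toDual ℝ H (u n))
  have hx : ∀ n, x n ∈ WeakDual.toStrongDual ⁻¹' Metric.closedBall (0 : StrongDual ℝ H) M := by
    intro n
    rw [Set.mem_preimage, mem_closedBall_zero_iff]
    change ‖InnerProductSpace.toDual ℝ H (u n)‖ ≤ M
    rw [LinearIsometryEquiv.norm_map]
    exact hM n
  obtain ⟨a, -, k, hk, hka⟩ := hs hx
  refine ⟨(InnerProductSpace.toDual ℝ H).symm (WeakDual.toStrongDual a), k, hk, fun v => ?_⟩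
  have h1 := ((WeakDual.eval_continuous v).tendsto a).comp hka
  have h2 : inner ℝ v ((InnerProductSpace.toDual ℝ H).symm (WeakDual.toStrongDual a)) = a v := by
    rw [real_inner_comm, InnerProductSpace.toDual_symm_apply]
    rfl
  rw [h2]
  refine h1.congr fun n => ?_
  change inner ℝ (u (k n)) v = _
  rw [real_inner_comm]

/-- A bounded sequence converges weakly to `a` as soon as `a` is the limit of each of its weakly
convergent subsequences. -/
theorem WeakTendsto.of_subseq [CompleteSpace H] [TopologicalSpace.SeparableSpace H] {M : ℝ}
    (hM : ∀ n, ‖u n‖ ≤ M)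
    (h : ∀ (k : ℕ → ℕ) (b : H), StrictMono k → WeakTendsto (fun n => u (k n)) b → b = a) :
    WeakTendsto u a := by
  intro v
  refine tendsto_of_subseq_tendsto fun ns hns => ?_
  obtain ⟨k, hk, hk'⟩ := strictMono_subseq_of_tendsto_atTop hns
  obtain ⟨b, j, hj, hb⟩ := exists_weakTendsto_subseq (u := fun n => u (ns (k n))) fun n => hM _
  have := h (fun n => ns (k (j n))) b (hk'.comp hj) hb
  subst this
  exact ⟨fun n => k (j n), hb v⟩

end WeakTendsto

/-! ### Compactness of the embedding of `W^{1,2}_0` in `L²` -/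


/-- The squared `L²(Ω)` norm of the unnormalized means of `f` over the balls of radius `ε`. -/
noncomputable def meanSq (Ω : Set (Eu N)) (ε : ℝ) (f : Eu N → ℝ) : ℝ≥0∞ :=
  ∫⁻ x in Ω, ‖∫ y in Ω, (Metric.ball x ε).indicator f y‖ₑ ^ 2

theorem meanSq_congr (ε : ℝ) {f g : Eu N → ℝ} (h : f =ᵐ[volume.restrict Ω] g) :
    meanSq Ω ε f = meanSq Ω ε g := by
  refine lintegral_congr fun x => ?_
  congr 2
  refine integral_congr_ae ?_
  filter_upwards [h] with y hy
  simp only [Set.indicator, hy]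

/-- The means depend on `f` through a compact operator: pointwise they are inner products with
indicator functions, which are uniformly bounded. -/
theorem tendsto_meanSq (hb : Bornology.IsBounded Ω) (ε : ℝ) {f : ℕ → L2 Ω} {g : L2 Ω}
    (h : WeakTendsto f g) :
    Tendsto (fun n => meanSq Ω ε (f n)) atTop (𝓝 (meanSq Ω ε g)) := by
  have : IsFiniteMeasure (volume.restrict Ω) := ⟨by simpa using hb.measure_lt_top⟩
  obtain ⟨M, hM0, hM⟩ := h.exists_bound
  have hind : ∀ x : Eu N, MemLp ((Metric.ball x ε).indicator fun _ => (1 : ℝ)) 2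
      (volume.restrict Ω) := fun x =>
    (memLp_const 1).indicator measurableSet_ball
  have hinner : ∀ (x : Eu N) (f : L2 Ω),
      ∫ y in Ω, (Metric.ball x ε).indicator f y = inner ℝ (hind x).toLp f := by
    intro x f
    rw [inner_L2_eq]
    refine integral_congr_ae ?_
    filter_upwards [(hind x).coeFn_toLp] with y hy
    rw [hy]
    by_cases hxy : y ∈ Metric.ball x ε <;> simp [hxy]
  have hbd : ∀ (x : Eu N), ‖(hind x).toLp‖ ≤ ‖(memLp_const (μ := volume.restrict Ω) (p := 2)
      (1 : ℝ)).toLp‖ := by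
    intro x
    refine Lp.norm_le_norm_of_ae_le ?_
    filter_upwards [(hind x).coeFn_toLp, (memLp_const (μ := volume.restrict Ω) (p := 2)
      (1 : ℝ)).coeFn_toLp] with y hy hy'
    rw [hy, hy']
    exact norm_indicator_le_norm_self _ _
  set C := ‖(memLp_const (μ := volume.restrict Ω) (p := 2) (1 : ℝ)).toLp‖
  refine tendsto_lintegral_of_dominated_convergence (fun _ => ENNReal.ofReal (C * M) ^ 2)
    (fun n => ?_) (fun n => ?_) ?_ ?_
  · have hm : StronglyMeasurable fun p : Eu N × Eu N => (Metric.ball p.1 ε).indicator (f n) p.2 := by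
      have h1 : StronglyMeasurable fun p : Eu N × Eu N => (f n) p.2 :=
        (Lp.stronglyMeasurable (f n)).comp_measurable measurable_snd
      have h2 : MeasurableSet {p : Eu N × Eu N | dist p.2 p.1 < ε} :=
        measurableSet_lt (measurable_snd.dist measurable_fst) measurable_const
      exact h1.indicator h2
    exact (hm.integral_prod_right' (ν := volume.restrict Ω)).enorm.pow_const 2
  · refine Eventually.of_forall fun x => ?_
    simp only
    gcongr
    rw [hinner, ← ofReal_norm]
    refine ENNReal.ofReal_le_ofReal ((norm_inner_le_norm _ _).trans ?_)
    gcongr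
    exacts [hbd x, hM n]
  · rw [lintegral_const]
    exact ENNReal.mul_ne_top (by finiteness) (by simpa using hb.measure_lt_top.ne)
  · refine Eventually.of_forall fun x => ?_
    simp only [hinner]
    exact (ENNReal.continuous_pow 2).tendsto _ |>.comp (h _).enorm

/-- The norm in `L²` is controlled by the gradient and the means over small balls: `f` differs from
its mean over the ball of radius `ε` by translations of length at most `ε`. -/
theorem IsTest.enorm_sq_le (ho : IsOpen Ω) {φ : Eu N → ℝ} (hφ : IsTest Ω φ) (ε : ℝ) :
    volume (Metric.ball (0 : Eu N) ε) ^ 2 * ∫⁻ x in Ω, ‖φ x‖ₑ ^ 2 ≤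
      2 * (volume (Metric.ball (0 : Eu N) ε) ^ 2 *
        (ENNReal.ofReal ε ^ 2 * ∫⁻ x in Ω, ‖gradient φ x‖ₑ ^ 2) + meanSq Ω ε φ) := by
  set B := Metric.ball (0 : Eu N) ε with hB
  set V := volume B with hV
  have hVtop : V ≠ ⊤ := measure_ball_lt_top.ne
  have hc := hφ.smooth.continuous
  have hfin : IsFiniteMeasure (volume.restrict B) := ⟨by simpa using measure_ball_lt_top⟩
  have hpt : ∀ x, V ^ 2 * ‖φ x‖ₑ ^ 2 ≤ 2 * (V * (∫⁻ w in B, ‖φ (x + w) - φ x‖ₑ ^ 2) +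
      ‖∫ y in Ω, (Metric.ball x ε).indicator φ y‖ₑ ^ 2) := by
    intro x
    have hi1 : Integrable (fun w => φ (x + w)) (volume.restrict B) :=
      ((hc.integrable_of_hasCompactSupport hφ.compact).comp_add_left x).restrict
    have e1 : ∫ y in Ω, (Metric.ball x ε).indicator φ y = ∫ w in B, φ (x + w) := by
      rw [setIntegral_eq_integral_of_forall_compl_eq_zero, ← integral_indicator measurableSet_ball,
        ← integral_add_left_eq_self _ x]
      · refine integral_congr_ae (Eventually.of_forall fun w => ?_)
        simp [Set.indicator]
      · intro y hy
        simp [Set.indicator, hφ.eq_zero hy]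
    have e2 : ∫ _ in B, φ x = V.toReal * φ x := by simp [hV, Measure.real]
    have e3 : V.toReal * φ x = (∫ w in B, φ (x + w)) - ∫ w in B, (φ (x + w) - φ x) := by
      rw [integral_sub hi1 (integrable_const _), e2]
      ring
    have e4 : V * ‖φ x‖ₑ = ‖V.toReal * φ x‖ₑ := by
      rw [enorm_mul, Real.enorm_of_nonneg ENNReal.toReal_nonneg, ENNReal.ofReal_toReal hVtop]
    rw [← mul_pow, e4, e3, sub_eq_add_neg, e1, add_comm]
    refine (enorm_add_sq_le _ _).trans ?_
    gcongr
    rw [enorm_neg]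
    calc ‖∫ w in B, (φ (x + w) - φ x)‖ₑ ^ 2 ≤ (∫⁻ w in B, ‖φ (x + w) - φ x‖ₑ) ^ 2 := by
          gcongr
          exact enorm_integral_le_lintegral_enorm _
      _ ≤ _ := by
          refine (sq_lintegral_le ?_).trans_eq ?_
          · exact (((hc.comp (continuous_const.add continuous_id)).sub
              continuous_const).enorm.measurable).aemeasurable
          · simp [hV]
  have hT : ∀ w ∈ B, ∫⁻ x in Ω, ‖φ (x + w) - φ x‖ₑ ^ 2 ≤
      ENNReal.ofReal ε ^ 2 * ∫⁻ x in Ω, ‖gradient φ x‖ₑ ^ 2 := by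
    intro w hw
    refine (lintegral_translation_sq_le hφ.smooth ho.measurableSet MeasurableSet.univ w
      (fun x _ t _ => Set.mem_univ _)).trans ?_
    rw [hφ.lintegral_gradient ho]
    gcongr
    rw [← ofReal_norm]
    exact ENNReal.ofReal_le_ofReal (mem_ball_zero_iff.1 hw).le
  have hm2 : Measurable fun p : Eu N × Eu N => ‖φ (p.1 + p.2) - φ p.1‖ₑ ^ 2 := by fun_prop
  have hm1 : Measurable fun x => V * ∫⁻ w in B, ‖φ (x + w) - φ x‖ₑ ^ 2 :=
    (hm2.lintegral_prod_right' (ν := volume.restrict B)).const_mul V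
  rw [← lintegral_const_mul' _ _ (by finiteness)]
  refine (lintegral_mono hpt).trans ?_
  rw [lintegral_const_mul' _ _ (by finiteness), lintegral_add_left hm1]
  gcongr
  · rw [lintegral_const_mul' _ _ hVtop, lintegral_lintegral_swap hm2.aemeasurable, sq V, mul_assoc]
    gcongr
    refine (setLIntegral_mono' measurableSet_ball hT).trans_eq ?_
    rw [lintegral_const]
    simp [hV, hB, mul_comm]
  · exact le_rfl

theorem enorm_sq_fn_le (ho : IsOpen Ω) (hb : Bornology.IsBounded Ω) (ε : ℝ) {u : W12 Ω}
    (hu : u ∈ W120S Ω) :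
    volume (Metric.ball (0 : Eu N) ε) ^ 2 * ‖u.fn‖ₑ ^ 2 ≤
      2 * (volume (Metric.ball (0 : Eu N) ε) ^ 2 * (ENNReal.ofReal ε ^ 2 * ‖u.grad‖ₑ ^ 2) +
        meanSq Ω ε u.fn) := by
  have hVtop : volume (Metric.ball (0 : Eu N) ε) ≠ ⊤ := measure_ball_lt_top.ne
  obtain ⟨v, hv, hvu⟩ := mem_closure_iff_seq_limit.1 (show u ∈ closure (testSub Ω : Set _) from hu)
  have h1 : Tendsto (fun n => (v n).fn) atTop (𝓝 u.fn) := ((fnL Ω).continuous.tendsto u).comp hvu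
  have h2 : Tendsto (fun n => (v n).grad) atTop (𝓝 u.grad) :=
    ((gradL Ω).continuous.tendsto u).comp hvu
  have h3 := tendsto_meanSq hb ε (WeakTendsto.of_tendsto h1)
  have t1 := ENNReal.Tendsto.const_mul ((ENNReal.continuous_pow 2).tendsto _ |>.comp h1.enorm)
    (Or.inr (show volume (Metric.ball (0 : Eu N) ε) ^ 2 ≠ ⊤ by finiteness))
  have t2 := ENNReal.Tendsto.const_mul (ENNReal.Tendsto.const_mul
    ((ENNReal.continuous_pow 2).tendsto _ |>.comp h2.enorm)
    (Or.inr (show ENNReal.ofReal ε ^ 2 ≠ ⊤ by finiteness)))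
    (Or.inr (show volume (Metric.ball (0 : Eu N) ε) ^ 2 ≠ ⊤ by finiteness))
  have t3 := ENNReal.Tendsto.const_mul (t2.add h3) (Or.inr (show (2 : ℝ≥0∞) ≠ ⊤ by simp))
  refine le_of_tendsto_of_tendsto' t1 t3 fun n => ?_
  obtain ⟨φ, hφ, hv'⟩ := hv n
  have hv'' := eq_ofSmooth ho hb hφ.smooth hv'
  have := hφ.enorm_sq_le ho ε
  simp only [Function.comp_apply]
  rw [enorm_sq_Lp_of_ae hv', meanSq_congr ε hv',
    enorm_sq_Lp_of_ae (f := (v n).grad) (g := gradient φ)]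
  · exact this
  · rw [hv'']
    exact ofSmooth_grad hb hφ.smooth

/-- **Rellich's theorem** for `W^{1,2}_0(Ω)`. For each `ε` the means over balls of radius `ε` of a
sequence converging weakly to zero tend to zero, and what remains of the norm is of order `ε`. -/
theorem tendsto_fn_of_weakTendsto (ho : IsOpen Ω) (hb : Bornology.IsBounded Ω) {u : ℕ → W12 Ω}
    {a : W12 Ω} (hu : ∀ n, u n ∈ W120S Ω) (h : WeakTendsto u a) :
    Tendsto (fun n => (u n).fn) atTop (𝓝 a.fn) := by
  have ha : a ∈ W120S Ω := h.mem isClosed_W120S hu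
  set z : ℕ → W12 Ω := fun n => u n - a with hz
  have hz0 : WeakTendsto z 0 := by simpa using h.sub (WeakTendsto.const a)
  have hzm : ∀ n, z n ∈ W120S Ω := fun n => sub_mem (hu n) ha
  have hzf : WeakTendsto (fun n => (z n).fn) 0 := by
    have := hz0.map (fnL Ω)
    rwa [map_zero] at this
  obtain ⟨M, hM0, hM⟩ := hz0.exists_bound
  have key : ∀ ε : ℝ, 0 < ε → ∀ᶠ n in atTop, ‖(z n).fn‖ ^ 2 ≤ 2 * (ε ^ 2 * (M ^ 2 + 1)) := by
    intro ε hε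
    set V := volume (Metric.ball (0 : Eu N) ε)
    have hVtop : V ≠ ⊤ := measure_ball_lt_top.ne
    have hV0 : V ≠ 0 := (Metric.measure_ball_pos _ _ hε).ne'
    have hlim := tendsto_meanSq hb ε hzf
    have h0 : meanSq Ω ε ((0 : L2 Ω) : Eu N → ℝ) = 0 := by
      rw [meanSq_congr ε (Lp.coeFn_zero ℝ 2 (volume.restrict Ω))]
      simp [meanSq]
    rw [h0] at hlim
    have hpos : 0 < V ^ 2 * ENNReal.ofReal ε ^ 2 := by
      refine ENNReal.mul_pos (pow_ne_zero 2 hV0) (pow_ne_zero 2 (by simpa using hε))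
    filter_upwards [hlim.eventually_le_const hpos] with n hn
    have h1 := enorm_sq_fn_le ho hb ε (hzm n)
    have h2 : V ^ 2 * ‖(z n).fn‖ₑ ^ 2 ≤
        V ^ 2 * (2 * (ENNReal.ofReal ε ^ 2 * (ENNReal.ofReal M ^ 2 + 1))) := by
      refine h1.trans ?_
      have h3 : ‖(z n).grad‖ₑ ≤ ENNReal.ofReal M := by
        rw [← ofReal_norm]
        exact ENNReal.ofReal_le_ofReal ((norm_grad_le _).trans (hM n))
      calc _ ≤ 2 * (V ^ 2 * (ENNReal.ofReal ε ^ 2 * ENNReal.ofReal M ^ 2) +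
            V ^ 2 * ENNReal.ofReal ε ^ 2) := by gcongr
        _ = _ := by ring
    rw [ENNReal.mul_le_mul_iff_right (pow_ne_zero 2 hV0) (by finiteness)] at h2
    have h4 := ENNReal.toReal_mono (by finiteness) h2
    rw [ENNReal.toReal_mul, ENNReal.toReal_mul, ENNReal.toReal_add (by finiteness) (by finiteness)]
      at h4
    simpa [ENNReal.toReal_ofReal hM0, ENNReal.toReal_ofReal hε.le] using h4
  rw [tendsto_iff_norm_sub_tendsto_zero]
  have hcongr : ∀ n, ‖(u n).fn - a.fn‖ = ‖(z n).fn‖ := fun n => by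
    rw [hz, ← fnL_apply, ← fnL_apply, ← fnL_apply, map_sub]
  simp only [hcongr]
  rw [Metric.tendsto_atTop]
  intro δ hδ
  set ε := δ / (2 * (M + 1)) with hε
  have hε0 : 0 < ε := by positivity
  obtain ⟨n₀, hn₀⟩ := eventually_atTop.1 (key ε hε0)
  refine ⟨n₀, fun n hn => ?_⟩
  rw [dist_zero_right, norm_norm]
  have h1 := hn₀ n hn
  have h2 : 2 * (ε ^ 2 * (M ^ 2 + 1)) < δ ^ 2 := by
    rw [hε, div_pow, mul_pow]
    rw [show 2 * (δ ^ 2 / (2 ^ 2 * (M + 1) ^ 2) * (M ^ 2 + 1)) =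
      δ ^ 2 * ((M ^ 2 + 1) / (2 * (M + 1) ^ 2)) by field_simp]
    have : (M ^ 2 + 1) / (2 * (M + 1) ^ 2) < 1 := by
      rw [div_lt_one (by positivity)]
      nlinarith
    have : 0 < δ ^ 2 := by positivity
    nlinarith
  exact lt_of_pow_lt_pow_left₀ 2 hδ.le (h1.trans_lt h2)

/-! ### Lipschitz graphs -/

/-- The hyperplane orthogonal to `e`. -/
noncomputable abbrev hyp (e : Eu N) : Submodule ℝ (Eu N) := (ℝ ∙ e)ᗮ

theorem finrank_hyp (hN : 1 ≤ N) {e : Eu N} (he : ‖e‖ = 1) :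
    (Module.finrank ℝ (hyp e) : ℝ) = (N : ℝ) - 1 := by
  obtain ⟨n, rfl⟩ := Nat.exists_eq_add_of_le' hN
  have : Fact (Module.finrank ℝ (Eu (n + 1)) = n + 1) := ⟨by simp⟩
  rw [Submodule.finrank_orthogonal_span_singleton (n := n) (by rintro rfl; simp at he)]
  simp

/-- The `(N-1)`-dimensional Hausdorff measure on the hyperplane orthogonal to `e`. -/
noncomputable abbrev hypMeasure (e : Eu N) : Measure (hyp e) :=
  Measure.hausdorffMeasure ((N : ℝ) - 1)

theorem isAddHaarMeasure_hypMeasure (hN : 1 ≤ N) {e : Eu N} (he : ‖e‖ = 1) :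
    (hypMeasure e).IsAddHaarMeasure := by
  unfold hypMeasure
  rw [← finrank_hyp hN he]
  infer_instance

theorem inner_hyp {e : Eu N} (y : hyp e) : inner ℝ e (y : Eu N) = 0 :=
  Submodule.mem_orthogonal_singleton_iff_inner_right.1 y.2

/-- The orthogonal projection to the hyperplane orthogonal to the unit vector `e`. -/
noncomputable def hypProj {e : Eu N} (he : ‖e‖ = 1) (x : Eu N) : hyp e :=
  ⟨x - inner ℝ e x • e, by
    rw [Submodule.mem_orthogonal_singleton_iff_inner_right, inner_sub_right, inner_smul_right,
      real_inner_self_eq_norm_sq, he]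
    ring⟩

theorem coe_hypProj {e : Eu N} (he : ‖e‖ = 1) (x : Eu N) :
    (hypProj he x : Eu N) = x - inner ℝ e x • e := rfl

theorem lipschitzWith_hypProj {e : Eu N} (he : ‖e‖ = 1) : LipschitzWith 1 (hypProj he) := by
  refine LipschitzWith.of_dist_le_mul fun x y => ?_
  have h1 : dist (hypProj he x) (hypProj he y) = ‖(x - y) - inner ℝ e (x - y) • e‖ := by
    rw [Subtype.dist_eq, dist_eq_norm, coe_hypProj, coe_hypProj, inner_sub_right]
    congr 1
    module
  have h2 : ‖(x - y) - inner ℝ e (x - y) • e‖ ^ 2 = ‖x - y‖ ^ 2 - inner ℝ e (x - y) ^ 2 := by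
    rw [norm_sub_sq_real, inner_smul_right, norm_smul, he, real_inner_comm, Real.norm_eq_abs, mul_one,
      sq_abs]
    ring
  rw [h1, dist_eq_norm, NNReal.coe_one, one_mul]
  exact abs_le_of_sq_le_sq' (by nlinarith [sq_nonneg (inner ℝ e (x - y))]) (norm_nonneg _) |>.2

/-- The point of the graph of `γ` over `y`, in the direction `e`. -/
noncomputable def graphPt (e : Eu N) (γ : Eu N → ℝ) (y : hyp e) : Eu N := y + γ y • e

theorem hypProj_graphPt {e : Eu N} (he : ‖e‖ = 1) (γ : Eu N → ℝ) (y : hyp e) :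
    hypProj he (graphPt e γ y) = y := by
  ext1
  rw [coe_hypProj, graphPt, inner_add_right, inner_smul_right, inner_hyp,
    real_inner_self_eq_norm_sq, he]
  module

theorem lipschitzWith_graphPt {e : Eu N} (he : ‖e‖ = 1) {γ : Eu N → ℝ} {K : ℝ≥0}
    (hγ : LipschitzWith K γ) : LipschitzWith (1 + K) (graphPt e γ) := by
  refine LipschitzWith.of_dist_le_mul fun x y => ?_
  have h := hγ.dist_le_mul x y
  rw [dist_eq_norm, graphPt, graphPt, add_sub_add_comm, ← sub_smul]
  refine (norm_add_le _ _).trans ?_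
  rw [norm_smul, he, mul_one, Subtype.dist_eq, ← dist_eq_norm, ← dist_eq_norm]
  push_cast
  linarith

/-- Fubini's theorem in the coordinates adapted to a graph in the direction `e`. -/
theorem exists_lintegral_eq_graph (hN : 1 ≤ N) {e : Eu N} (he : ‖e‖ = 1) :
    ∃ c : ℝ≥0∞, c ≠ 0 ∧ c ≠ ⊤ ∧ ∀ (γ : Eu N → ℝ) (g : Eu N → ℝ≥0∞), Measurable g →
      ∫⁻ x, g x = c * ∫⁻ y, (∫⁻ t : ℝ, g (graphPt e γ y + t • e)) ∂(hypMeasure e) := by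
  have := isAddHaarMeasure_hypMeasure hN he
  have he0 : e ≠ 0 := by rintro rfl; simp at he
  let L : (hyp e × ℝ) →L[ℝ] Eu N := ((hyp e).subtypeL.comp (ContinuousLinearMap.fst ℝ _ _)) +
    (ContinuousLinearMap.snd ℝ (hyp e) ℝ).smulRight e
  have hLa : ∀ p, L p = p.1 + p.2 • e := fun p => rfl
  let R : Eu N →ₗ[ℝ] hyp e × ℝ :=
    { toFun := fun x => (hypProj he x, inner ℝ e x)
      map_add' := fun x y => by
        ext1
        · ext1
          simp only [coe_hypProj, inner_add_right, Prod.fst_add, Submodule.coe_add]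
          module
        · simp [inner_add_right]
      map_smul' := fun c x => by
        ext1
        · ext1
          simp only [coe_hypProj, inner_smul_right, Prod.smul_fst, Submodule.coe_smul,
            RingHom.id_apply]
          module
        · simp [inner_smul_right] }
  let E : (hyp e × ℝ) ≃ₗ[ℝ] Eu N := LinearEquiv.ofLinearMap L.toLinearMap R
    (by
      ext1 x
      change ((hypProj he x : Eu N) + inner ℝ e x • e) = x
      rw [coe_hypProj]
      module)
    (by
      refine LinearMap.ext fun p => ?_
      change (hypProj he (p.1 + p.2 • e), inner ℝ e (p.1 + p.2 • e)) = p
      have h1 : inner ℝ e ((p.1 : Eu N) + p.2 • e) = p.2 := by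
        rw [inner_add_right, inner_smul_right, inner_hyp, real_inner_self_eq_norm_sq, he]
        ring
      ext1
      · ext1
        rw [coe_hypProj, h1]
        simp
      · exact h1)
  let E' : (hyp e × ℝ) ≃L[ℝ] Eu N := E.toContinuousLinearEquiv
  have hE : ∀ p, E' p = p.1 + p.2 • e := fun p => rfl
  have hHaar : (((hypMeasure e).prod (volume : Measure ℝ)).map E').IsAddHaarMeasure :=
    E'.isAddHaarMeasure_map _
  have hc := Measure.isAddLeftInvariant_eq_smul (volume : Measure (Eu N))
    (((hypMeasure e).prod (volume : Measure ℝ)).map E')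
  refine ⟨_, ENNReal.coe_ne_zero.2 (Measure.addHaarScalarFactor_pos_of_isAddHaarMeasure
    (volume : Measure (Eu N)) (((hypMeasure e).prod (volume : Measure ℝ)).map E')).ne',
    ENNReal.coe_ne_top, fun γ g hg => ?_⟩
  conv_lhs => rw [hc]
  rw [lintegral_smul_measure, lintegral_map hg E'.continuous.measurable, lintegral_prod]
  · rw [ENNReal.smul_def, smul_eq_mul]
    congr 1
    refine lintegral_congr fun y => ?_
    rw [← lintegral_add_left_eq_self _ (γ y)]
    refine lintegral_congr fun t => ?_
    rw [hE, graphPt, add_smul, add_assoc]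
  · exact (hg.comp E'.continuous.measurable).aemeasurable

/-- A ball in which `Ω` is the part lying strictly above the graph of a Lipschitz function. -/
structure GraphChart (Ω : Set (Eu N)) (p e : Eu N) (γ : Eu N → ℝ) (K : ℝ≥0) (r : ℝ) : Prop where
  norm_e : ‖e‖ = 1
  lip : LipschitzWith K γ
  pos : 0 < r
  mem_iff : ∀ x ∈ Metric.ball p r, (x ∈ Ω ↔ γ (x - inner ℝ e x • e) < inner ℝ e x)

namespace GraphChart

variable {p e : Eu N} {γ : Eu N → ℝ} {K : ℝ≥0} {r : ℝ}

theorem inner_graphPt_add (h : GraphChart Ω p e γ K r) (y : hyp e) (t : ℝ) :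
    inner ℝ e (graphPt e γ y + t • e) = γ y + t := by
  rw [graphPt, inner_add_right, inner_add_right, inner_smul_right, inner_smul_right, inner_hyp,
    real_inner_self_eq_norm_sq, h.norm_e]
  ring

theorem eq_graphPt_add (h : GraphChart Ω p e γ K r) (x : Eu N) :
    x = graphPt e γ (hypProj h.norm_e x) +
      (inner ℝ e x - γ (x - inner ℝ e x • e)) • e := by
  rw [graphPt, coe_hypProj]
  module

theorem graphPt_add_mem_iff (h : GraphChart Ω p e γ K r) {y : hyp e} {t : ℝ}
    (hy : graphPt e γ y + t • e ∈ Metric.ball p r) : graphPt e γ y + t • e ∈ Ω ↔ 0 < t := by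
  rw [h.mem_iff _ hy, h.inner_graphPt_add]
  have : graphPt e γ y + t • e - (γ y + t) • e = y := by
    rw [graphPt]
    module
  rw [this]
  constructor <;> intro h <;> linarith

theorem graphPt_add_mem_frontier_iff (h : GraphChart Ω p e γ K r) (ho : IsOpen Ω) {y : hyp e}
    {t : ℝ} (hy : graphPt e γ y + t • e ∈ Metric.ball p r) :
    graphPt e γ y + t • e ∈ frontier Ω ↔ t = 0 := by
  have hlim : Tendsto (fun s : ℝ => graphPt e γ y + s • e) (𝓝 t) (𝓝 (graphPt e γ y + t • e)) :=
    Continuous.tendsto (by fun_prop) t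
  have hball : ∀ᶠ s in 𝓝 t, graphPt e γ y + s • e ∈ Metric.ball p r :=
    hlim.eventually (Metric.isOpen_ball.mem_nhds hy)
  rw [ho.frontier_eq]
  constructor
  · rintro ⟨h1, h2⟩
    rw [h.graphPt_add_mem_iff hy] at h2
    by_contra hne
    have ht : t < 0 := lt_of_le_of_ne (not_lt.1 h2) hne
    -- the height above the graph is a continuous function, nonnegative on the closure
    have hcont : Continuous fun x : Eu N => inner ℝ e x - γ (x - inner ℝ e x • e) :=
      (continuous_const.inner continuous_id).sub (h.lip.continuous.comp (by fun_prop))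
    have hval : inner ℝ e (graphPt e γ y + t • e) -
        γ (graphPt e γ y + t • e - inner ℝ e (graphPt e γ y + t • e) • e) = t := by
      rw [h.inner_graphPt_add]
      have : graphPt e γ y + t • e - (γ y + t) • e = y := by
        rw [graphPt]
        module
      rw [this]
      ring
    have hev : ∀ᶠ x in 𝓝 (graphPt e γ y + t • e),
        inner ℝ e x - γ (x - inner ℝ e x • e) < 0 :=
      hcont.continuousAt.eventually_lt continuousAt_const (by rw [hval]; exact ht)
    obtain ⟨x, hx1, hx2, hx3⟩ := (mem_closure_iff_frequently.1 h1).and_eventually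
      (hev.and (Metric.isOpen_ball.mem_nhds hy)) |>.exists
    have := (h.mem_iff x hx3).1 hx1
    linarith
  · rintro rfl
    refine ⟨?_, fun h2 => lt_irrefl _ ((h.graphPt_add_mem_iff hy).1 h2)⟩
    refine mem_closure_of_tendsto (hlim.mono_left (nhdsWithin_le_nhds (s := Set.Ioi 0))) ?_
    filter_upwards [hball.filter_mono nhdsWithin_le_nhds, self_mem_nhdsWithin] with s hs hs'
    exact (h.graphPt_add_mem_iff hs).2 hs'

theorem graphPt_mem_frontier (h : GraphChart Ω p e γ K r) (ho : IsOpen Ω) {y : hyp e}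
    (hy : graphPt e γ y ∈ Metric.ball p r) : graphPt e γ y ∈ frontier Ω := by
  have := h.graphPt_add_mem_frontier_iff ho (y := y) (t := 0)
  simp only [zero_smul, add_zero] at this
  exact (this hy).2 trivial

theorem eq_graphPt (h : GraphChart Ω p e γ K r) (ho : IsOpen Ω) {x : Eu N}
    (hx : x ∈ frontier Ω) (hxb : x ∈ Metric.ball p r) :
    graphPt e γ (hypProj h.norm_e x) = x := by
  have h1 := h.eq_graphPt_add x
  have h2 := (h.graphPt_add_mem_frontier_iff ho (h1 ▸ hxb)).1 (h1 ▸ hx)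
  rw [h2, zero_smul, add_zero] at h1
  exact h1.symm

/-- The surface measure is at most a multiple of the measure of the projection to the hyperplane:
the boundary is the image of the hyperplane under the Lipschitz map `graphPt e γ`. -/
theorem lintegral_frontier_le (h : GraphChart Ω p e γ K r) (hN : 1 ≤ N) (ho : IsOpen Ω) {ρ : ℝ}
    (hρ : ρ ≤ r) {g : hyp e → ℝ≥0∞} (hg : Measurable g) :
    ∫⁻ x in Metric.ball p ρ, g (hypProj h.norm_e x) ∂(surface Ω) ≤
      ((1 + K : ℝ≥0) : ℝ≥0∞) ^ ((N : ℝ) - 1) *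
        ∫⁻ y in graphPt e γ ⁻¹' Metric.ball p ρ, g y ∂(hypMeasure e) := by
  have hP : Measurable (hypProj h.norm_e) := (lipschitzWith_hypProj h.norm_e).continuous.measurable
  have hΦ := lipschitzWith_graphPt h.norm_e h.lip
  have hd : (0 : ℝ) ≤ (N : ℝ) - 1 := by
    have : (1 : ℝ) ≤ N := by exact_mod_cast hN
    linarith
  rw [← lintegral_map hg hP, ← smul_eq_mul, ← lintegral_smul_measure]
  refine lintegral_mono' ?_ le_rfl
  refine Measure.le_iff.2 fun E hE => ?_
  rw [Measure.map_apply hP hE, surface, Measure.restrict_apply (hP hE),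
    Measure.restrict_apply ((hP hE).inter measurableSet_ball), Measure.smul_apply,
    Measure.restrict_apply hE, smul_eq_mul]
  refine le_trans (measure_mono ?_) (hΦ.hausdorffMeasure_image_le hd _)
  rintro x ⟨⟨hx1, hx2⟩, hx3⟩
  have := h.eq_graphPt ho hx3 (Metric.ball_subset_ball hρ hx2)
  exact ⟨hypProj h.norm_e x, ⟨hx1, by rwa [Set.mem_preimage, this]⟩, this⟩

/-- The surface measure is at least the measure of the projection to the hyperplane, because the
projection does not increase distances. -/
theorem le_lintegral_frontier (h : GraphChart Ω p e γ K r) (hN : 1 ≤ N) (ho : IsOpen Ω) {ρ : ℝ}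
    (hρ : ρ ≤ r) {g : hyp e → ℝ≥0∞} (hg : Measurable g) :
    ∫⁻ y in graphPt e γ ⁻¹' Metric.ball p ρ, g y ∂(hypMeasure e) ≤
      ∫⁻ x in Metric.ball p ρ, g (hypProj h.norm_e x) ∂(surface Ω) := by
  have hP : Measurable (hypProj h.norm_e) := (lipschitzWith_hypProj h.norm_e).continuous.measurable
  have hd : (0 : ℝ) ≤ (N : ℝ) - 1 := by
    have : (1 : ℝ) ≤ N := by exact_mod_cast hN
    linarith
  rw [← lintegral_map hg hP]
  refine lintegral_mono' ?_ le_rfl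
  refine Measure.le_iff.2 fun E hE => ?_
  rw [Measure.map_apply hP hE, surface, Measure.restrict_apply (hP hE),
    Measure.restrict_apply ((hP hE).inter measurableSet_ball), Measure.restrict_apply hE]
  have h1 := (lipschitzWith_hypProj h.norm_e).hausdorffMeasure_image_le hd
    (hypProj h.norm_e ⁻¹' E ∩ Metric.ball p ρ ∩ frontier Ω)
  simp only [ENNReal.coe_one, ENNReal.one_rpow, one_mul] at h1
  refine le_trans (measure_mono ?_) h1
  rintro y ⟨hy1, hy2⟩
  refine ⟨graphPt e γ y, ⟨⟨?_, hy2⟩, ?_⟩, hypProj_graphPt h.norm_e γ y⟩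
  · rwa [Set.mem_preimage, hypProj_graphPt]
  · exact h.graphPt_mem_frontier ho (Metric.ball_subset_ball hρ hy2)

theorem surface_ball_lt_top (h : GraphChart Ω p e γ K r) (hN : 1 ≤ N) (ho : IsOpen Ω) :
    surface Ω (Metric.ball p r) < ⊤ := by
  have := isAddHaarMeasure_hypMeasure hN h.norm_e
  have h1 := h.lintegral_frontier_le hN ho le_rfl (g := fun _ => 1) measurable_const
  simp only [lintegral_const, Measure.restrict_apply, MeasurableSet.univ, Set.univ_inter,
    one_mul] at h1
  refine h1.trans_lt (ENNReal.mul_lt_top (by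
    refine ENNReal.rpow_lt_top_of_nonneg ?_ ENNReal.coe_ne_top
    have : (1 : ℝ) ≤ N := by exact_mod_cast hN
    linarith) ?_)
  refine Bornology.IsBounded.measure_lt_top ?_
  refine ((lipschitzWith_hypProj h.norm_e).isBounded_image
    (Metric.isBounded_ball (x := p) (r := r))).subset ?_
  intro y hy
  exact ⟨_, hy, hypProj_graphPt h.norm_e γ y⟩

theorem surface_ball_pos (h : GraphChart Ω p e γ K r) (hN : 1 ≤ N) (ho : IsOpen Ω)
    (hp : p ∈ frontier Ω) : 0 < surface Ω (Metric.ball p r) := by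
  have := isAddHaarMeasure_hypMeasure hN h.norm_e
  have h1 := h.le_lintegral_frontier hN ho le_rfl (g := fun _ => 1) measurable_const
  simp only [lintegral_const, Measure.restrict_apply, MeasurableSet.univ, Set.univ_inter,
    one_mul] at h1
  refine lt_of_lt_of_le ?_ h1
  refine IsOpen.measure_pos _ (Metric.isOpen_ball.preimage
    (lipschitzWith_graphPt h.norm_e h.lip).continuous) ⟨hypProj h.norm_e p, ?_⟩
  rw [Set.mem_preimage, h.eq_graphPt ho hp (Metric.mem_ball_self h.pos)]
  exact Metric.mem_ball_self h.pos

end GraphChart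

theorem IsBoundedLipschitzDomain.exists_chart (hΩ : IsBoundedLipschitzDomain Ω) {p : Eu N}
    (hp : p ∈ frontier Ω) : ∃ e γ K r, GraphChart Ω p e γ K r := by
  obtain ⟨e, γ, K, r, h1, h2, h3, h4⟩ := hΩ.lipschitz p hp
  exact ⟨e, γ, K, r, h1, h2, h3, h4⟩

theorem IsBoundedLipschitzDomain.isCompact_frontier (hΩ : IsBoundedLipschitzDomain Ω) :
    IsCompact (frontier Ω) :=
  hΩ.isBounded.isCompact_closure.of_isClosed_subset isClosed_frontier frontier_subset_closure

theorem IsBoundedLipschitzDomain.isFiniteMeasure_surface (hN : 1 ≤ N)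
    (hΩ : IsBoundedLipschitzDomain Ω) : IsFiniteMeasure (surface Ω) := by
  refine ⟨?_⟩
  have h1 : surface Ω Set.univ = surface Ω (frontier Ω) := by
    rw [surface, Measure.restrict_apply_univ, Measure.restrict_apply_self]
  rw [h1]
  refine hΩ.isCompact_frontier.measure_lt_top_of_nhdsWithin fun p hp => ?_
  obtain ⟨e, γ, K, r, h⟩ := hΩ.exists_chart hp
  exact ⟨Metric.ball p r, mem_nhdsWithin_of_mem_nhds (Metric.ball_mem_nhds p h.pos),
    h.surface_ball_lt_top hN hΩ.isOpen⟩

/-- A bounded domain is not the whole space, which is where `1 ≤ N` enters. -/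
theorem IsBoundedLipschitzDomain.frontier_nonempty (hN : 1 ≤ N)
    (hΩ : IsBoundedLipschitzDomain Ω) : (frontier Ω).Nonempty := by
  have : Nonempty (Fin N) := ⟨⟨0, hN⟩⟩
  rw [nonempty_frontier_iff]
  refine ⟨hΩ.isConnected.nonempty, fun h => ?_⟩
  exact NormedSpace.unbounded_univ ℝ (Eu N) (h ▸ hΩ.isBounded)

theorem IsBoundedLipschitzDomain.surface_pos (hN : 1 ≤ N) (hΩ : IsBoundedLipschitzDomain Ω) :
    0 < surface Ω Set.univ := by
  obtain ⟨p, hp⟩ := hΩ.frontier_nonempty hN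
  obtain ⟨e, γ, K, r, h⟩ := hΩ.exists_chart hp
  exact (h.surface_ball_pos hN hΩ.isOpen hp).trans_le (measure_mono (Set.subset_univ _))

/-! ### Trace and boundary strip inequalities -/

theorem enorm_sub_sq_le_line {f : Eu N → ℝ} (hf : ContDiff ℝ ∞ f) (x : Eu N) {e : Eu N}
    (he : ‖e‖ = 1) {s t : ℝ} (ht : t ∈ Set.Ioc 0 s) :
    ‖f (x + t • e) - f x‖ₑ ^ 2 ≤
      ENNReal.ofReal s * ∫⁻ t in Set.Ioc 0 s, ‖gradient f (x + t • e)‖ₑ ^ 2 := by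
  have h := enorm_line_sub_sq_le hf x e ht.1.le
  have he' : ‖e‖ₑ = 1 := by rw [← ofReal_norm, he, ENNReal.ofReal_one]
  rw [zero_smul, add_zero, sub_zero, he', one_pow, one_mul] at h
  refine h.trans ?_
  gcongr
  exacts [ht.2, ht.2]

/-- The value at the end point of a segment is controlled by the mean over the segment. -/
theorem enorm_sq_le_line {f : Eu N → ℝ} (hf : ContDiff ℝ ∞ f) (x : Eu N) {e : Eu N}
    (he : ‖e‖ = 1) (s : ℝ) :
    ENNReal.ofReal s * ‖f x‖ₑ ^ 2 ≤ 2 * (ENNReal.ofReal s ^ 2 *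
      (∫⁻ t in Set.Ioc 0 s, ‖gradient f (x + t • e)‖ₑ ^ 2) +
        ∫⁻ t in Set.Ioc 0 s, ‖f (x + t • e)‖ₑ ^ 2) := by
  calc ENNReal.ofReal s * ‖f x‖ₑ ^ 2 = ∫⁻ _ in Set.Ioc 0 s, ‖f x‖ₑ ^ 2 := by
        rw [lintegral_const, Measure.restrict_apply_univ, Real.volume_Ioc, sub_zero, mul_comm]
    _ ≤ ∫⁻ t in Set.Ioc 0 s, 2 * (ENNReal.ofReal s *
          (∫⁻ t in Set.Ioc 0 s, ‖gradient f (x + t • e)‖ₑ ^ 2) + ‖f (x + t • e)‖ₑ ^ 2) := by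
        refine setLIntegral_mono' measurableSet_Ioc fun t ht => ?_
        refine (enorm_sq_le_sub_add (f x) (f (x + t • e))).trans ?_
        gcongr
        rw [enorm_sub_rev]
        exact enorm_sub_sq_le_line hf x he ht
    _ = _ := by
        rw [lintegral_const_mul' _ _ (by simp), lintegral_add_left measurable_const,
          lintegral_const, Measure.restrict_apply_univ, Real.volume_Ioc, sub_zero]
        ring

/-- The integral over a segment is controlled by the value at its end point. -/
theorem lintegral_line_le {f : Eu N → ℝ} (hf : ContDiff ℝ ∞ f) (x : Eu N) {e : Eu N}
    (he : ‖e‖ = 1) (s : ℝ) :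
    ∫⁻ t in Set.Ioc 0 s, ‖f (x + t • e)‖ₑ ^ 2 ≤ 2 * (ENNReal.ofReal s ^ 2 *
      (∫⁻ t in Set.Ioc 0 s, ‖gradient f (x + t • e)‖ₑ ^ 2) + ENNReal.ofReal s * ‖f x‖ₑ ^ 2) := by
  calc ∫⁻ t in Set.Ioc 0 s, ‖f (x + t • e)‖ₑ ^ 2
      ≤ ∫⁻ _ in Set.Ioc 0 s, 2 * (ENNReal.ofReal s *
          (∫⁻ t in Set.Ioc 0 s, ‖gradient f (x + t • e)‖ₑ ^ 2) + ‖f x‖ₑ ^ 2) := by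
        refine setLIntegral_mono' measurableSet_Ioc fun t ht => ?_
        refine (enorm_sq_le_sub_add (f (x + t • e)) (f x)).trans ?_
        gcongr
        exact enorm_sub_sq_le_line hf x he ht
    _ = _ := by
        rw [lintegral_const, Measure.restrict_apply_univ, Real.volume_Ioc, sub_zero]
        ring

theorem measurable_lintegral_line {g : Eu N → ℝ≥0∞} (hg : Measurable g) (e : Eu N) (s : ℝ) :
    Measurable fun x => ∫⁻ t in Set.Ioc 0 s, g (x + t • e) := by
  have : Measurable fun p : Eu N × ℝ => g (p.1 + p.2 • e) := hg.comp (by fun_prop)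
  exact this.lintegral_prod_right' (ν := volume.restrict (Set.Ioc 0 s))

namespace GraphChart

variable {p e : Eu N} {γ : Eu N → ℝ} {K : ℝ≥0} {r : ℝ}

theorem lintegral_surface_eq (h : GraphChart Ω p e γ K r) (ho : IsOpen Ω) {ρ : ℝ} (hρ : ρ ≤ r)
    (g : Eu N → ℝ≥0∞) :
    ∫⁻ x in Metric.ball p ρ, g x ∂(surface Ω) =
      ∫⁻ x in Metric.ball p ρ, g (graphPt e γ (hypProj h.norm_e x)) ∂(surface Ω) := by
  rw [surface, Measure.restrict_restrict measurableSet_ball]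
  refine setLIntegral_congr_fun (measurableSet_ball.inter isClosed_frontier.measurableSet)
    fun x hx => ?_
  simp only [h.eq_graphPt ho hx.2 (Metric.ball_subset_ball hρ hx.1)]

/-- Integrating over the segments issued from the boundary is dominated by the Lebesgue integral. -/
theorem exists_lintegral_segments_le (h : GraphChart Ω p e γ K r) (hN : 1 ≤ N) (ho : IsOpen Ω) :
    ∃ C : ℝ≥0∞, C ≠ ⊤ ∧ ∀ (ρ s : ℝ) (T : Set (Eu N)) (g : Eu N → ℝ≥0∞), ρ ≤ r → MeasurableSet T →
      Measurable g → (∀ x ∈ frontier Ω ∩ Metric.ball p ρ, ∀ t ∈ Set.Ioc 0 s, x + t • e ∈ T) →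
      ∫⁻ x in Metric.ball p ρ, (∫⁻ t in Set.Ioc 0 s, g (x + t • e)) ∂(surface Ω) ≤
        C * ∫⁻ x in T, g x := by
  obtain ⟨c, hc0, hct, hc⟩ := exists_lintegral_eq_graph hN h.norm_e
  set C' : ℝ≥0∞ := ((1 + K : ℝ≥0) : ℝ≥0∞) ^ ((N : ℝ) - 1) with hC'
  have hC't : C' ≠ ⊤ := by
    refine ENNReal.rpow_ne_top_of_nonneg ?_ ENNReal.coe_ne_top
    have : (1 : ℝ) ≤ N := by exact_mod_cast hN
    linarith
  have hΦ : Continuous (graphPt e γ) := (lipschitzWith_graphPt h.norm_e h.lip).continuous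
  refine ⟨C' * c⁻¹, ENNReal.mul_ne_top hC't (ENNReal.inv_ne_top.2 hc0),
    fun ρ s T g hρ hT hg hseg => ?_⟩
  rw [h.lintegral_surface_eq ho hρ]
  refine (h.lintegral_frontier_le hN ho hρ
    (g := fun y => ∫⁻ t in Set.Ioc 0 s, g (graphPt e γ y + t • e))
    ((measurable_lintegral_line hg e s).comp hΦ.measurable)).trans ?_
  rw [mul_assoc]
  gcongr
  rw [← lintegral_indicator hT, hc γ _ (hg.indicator hT), ← mul_assoc,
    ENNReal.inv_mul_cancel hc0 hct, one_mul, ← lintegral_indicator (hΦ.measurable measurableSet_ball)]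
  refine lintegral_mono fun y => ?_
  by_cases hy : y ∈ graphPt e γ ⁻¹' Metric.ball p ρ
  · rw [Set.indicator_of_mem hy, ← lintegral_indicator measurableSet_Ioc]
    refine lintegral_mono fun t => ?_
    by_cases ht : t ∈ Set.Ioc 0 s
    · rw [Set.indicator_of_mem ht, Set.indicator_of_mem]
      exact hseg _ ⟨h.graphPt_mem_frontier ho (Metric.ball_subset_ball hρ hy), hy⟩ t ht
    · rw [Set.indicator_of_notMem ht]
      exact zero_le
  · rw [Set.indicator_of_notMem hy]
    exact zero_le

/-- The Lebesgue integral over a boundary strip is dominated by the integral over the segments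
issued from the boundary. -/
theorem exists_lintegral_le_segments (h : GraphChart Ω p e γ K r) (hN : 1 ≤ N) (ho : IsOpen Ω) :
    ∃ C : ℝ≥0∞, C ≠ ⊤ ∧ ∀ (ρ s : ℝ) (S : Set (Eu N)) (g : Eu N → ℝ≥0∞), ρ ≤ r → MeasurableSet S →
      Measurable g →
      (∀ (y : hyp e) (t : ℝ), graphPt e γ y + t • e ∈ S →
        graphPt e γ y ∈ Metric.ball p ρ ∧ t ∈ Set.Ioc 0 s) →
      ∫⁻ x in S, g x ≤
        C * ∫⁻ x in Metric.ball p ρ, (∫⁻ t in Set.Ioc 0 s, g (x + t • e)) ∂(surface Ω) := by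
  obtain ⟨c, hc0, hct, hc⟩ := exists_lintegral_eq_graph hN h.norm_e
  have hΦ : Continuous (graphPt e γ) := (lipschitzWith_graphPt h.norm_e h.lip).continuous
  refine ⟨c, hct, fun ρ s S g hρ hS hg hseg => ?_⟩
  rw [h.lintegral_surface_eq ho hρ]
  refine le_trans ?_ (mul_le_mul' le_rfl (h.le_lintegral_frontier hN ho hρ
    (g := fun y => ∫⁻ t in Set.Ioc 0 s, g (graphPt e γ y + t • e))
    ((measurable_lintegral_line hg e s).comp hΦ.measurable)))
  rw [← lintegral_indicator hS, hc γ _ (hg.indicator hS),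
    ← lintegral_indicator (hΦ.measurable measurableSet_ball)]
  gcongr with y
  by_cases hy : y ∈ graphPt e γ ⁻¹' Metric.ball p ρ
  · rw [Set.indicator_of_mem hy, ← lintegral_indicator measurableSet_Ioc]
    refine lintegral_mono fun t => ?_
    by_cases ht : graphPt e γ y + t • e ∈ S
    · rw [Set.indicator_of_mem ht, Set.indicator_of_mem (hseg y t ht).2]
    · rw [Set.indicator_of_notMem ht]
      exact zero_le
  · rw [Set.indicator_of_notMem hy]
    refine (lintegral_eq_zero_of_ae_eq_zero (Eventually.of_forall fun t => ?_)).le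
    rw [Set.indicator_of_notMem fun ht => hy (hseg y t ht).1]
    rfl

theorem add_smul_mem (h : GraphChart Ω p e γ K r) (ho : IsOpen Ω) {x : Eu N} {a t : ℝ}
    (hx : x ∈ frontier Ω) (hxa : x ∈ Metric.ball p a) (ht : 0 < t) (hat : a + t ≤ r) :
    x + t • e ∈ Ω := by
  have h1 : x ∈ Metric.ball p r := Metric.ball_subset_ball (by linarith) hxa
  have h2 := h.eq_graphPt ho hx h1
  rw [← h2]
  refine (h.graphPt_add_mem_iff ?_).2 ht
  rw [h2, Metric.mem_ball, dist_eq_norm, add_sub_right_comm]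
  refine (norm_add_le _ _).trans_lt ?_
  rw [norm_smul, h.norm_e, mul_one, Real.norm_of_nonneg ht.le, ← dist_eq_norm]
  have := Metric.mem_ball.1 hxa
  linarith

/-- The trace inequality near a boundary point: integrate `enorm_sq_le_line` over the segments of
length `r / 2` issued from the boundary. -/
theorem exists_trace_le (h : GraphChart Ω p e γ K r) (hN : 1 ≤ N) (ho : IsOpen Ω) :
    ∃ C : ℝ≥0∞, C ≠ ⊤ ∧ ∀ f : Eu N → ℝ, ContDiff ℝ ∞ f →
      ∫⁻ x in Metric.ball p (r / 2), ‖f x‖ₑ ^ 2 ∂(surface Ω) ≤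
        C * ((∫⁻ x in Ω, ‖f x‖ₑ ^ 2) + ∫⁻ x in Ω, ‖gradient f x‖ₑ ^ 2) := by
  obtain ⟨C, hC, hseg⟩ := h.exists_lintegral_segments_le hN ho
  have hr := h.pos
  set s := ENNReal.ofReal (r / 2) with hs
  have hs0 : s ≠ 0 := by simpa [hs] using hr
  have hst : s ≠ ⊤ := ENNReal.ofReal_ne_top
  refine ⟨s⁻¹ * (2 * (C * (s ^ 2 + 1))), ?_, fun f hf => ?_⟩
  · exact ENNReal.mul_ne_top (ENNReal.inv_ne_top.2 hs0) (by finiteness)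
  have hT : ∀ x ∈ frontier Ω ∩ Metric.ball p (r / 2), ∀ t ∈ Set.Ioc 0 (r / 2), x + t • e ∈ Ω :=
    fun x hx t ht => h.add_smul_mem ho hx.1 hx.2 ht.1 (by linarith [ht.2])
  have hg1 : Measurable fun x => ‖f x‖ₑ ^ 2 := hf.continuous.enorm.measurable.pow_const 2
  have hg2 : Measurable fun x => ‖gradient f x‖ₑ ^ 2 :=
    (continuous_gradient hf).enorm.measurable.pow_const 2
  have k1 := hseg (r / 2) (r / 2) Ω _ (by linarith) ho.measurableSet hg1 hT
  have k2 := hseg (r / 2) (r / 2) Ω _ (by linarith) ho.measurableSet hg2 hT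
  have key : s * ∫⁻ x in Metric.ball p (r / 2), ‖f x‖ₑ ^ 2 ∂(surface Ω) ≤
      2 * (C * (s ^ 2 + 1)) * ((∫⁻ x in Ω, ‖f x‖ₑ ^ 2) + ∫⁻ x in Ω, ‖gradient f x‖ₑ ^ 2) := by
    rw [← lintegral_const_mul' _ _ hst]
    refine (lintegral_mono fun x => enorm_sq_le_line hf x h.norm_e (r / 2)).trans ?_
    rw [lintegral_const_mul' _ _ (by simp),
      lintegral_add_left ((measurable_lintegral_line hg2 e _).const_mul _),
      lintegral_const_mul' _ _ (by finiteness)]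
    calc _ ≤ 2 * (s ^ 2 * (C * ∫⁻ x in Ω, ‖gradient f x‖ₑ ^ 2) + C * ∫⁻ x in Ω, ‖f x‖ₑ ^ 2) := by
          gcongr
      _ = 2 * (C * s ^ 2 * (∫⁻ x in Ω, ‖gradient f x‖ₑ ^ 2) +
          C * 1 * ∫⁻ x in Ω, ‖f x‖ₑ ^ 2) := by ring
      _ ≤ 2 * (C * (s ^ 2 + 1) * (∫⁻ x in Ω, ‖gradient f x‖ₑ ^ 2) +
          C * (s ^ 2 + 1) * ∫⁻ x in Ω, ‖f x‖ₑ ^ 2) := by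
          gcongr
          exacts [le_self_add, le_add_self]
      _ = _ := by ring
  calc ∫⁻ x in Metric.ball p (r / 2), ‖f x‖ₑ ^ 2 ∂(surface Ω)
      = s⁻¹ * (s * ∫⁻ x in Metric.ball p (r / 2), ‖f x‖ₑ ^ 2 ∂(surface Ω)) := by
        rw [← mul_assoc, ENNReal.inv_mul_cancel hs0 hst, one_mul]
    _ ≤ _ := by
        rw [mul_assoc]
        gcongr

/-- The strip inequality near a boundary point: integrate `lintegral_line_le` over the segments of
length `(1 + K) δ` issued from the boundary, which cover the strip of width `δ`. -/
theorem exists_strip_le (h : GraphChart Ω p e γ K r) (hN : 1 ≤ N) (ho : IsOpen Ω)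
    (hne : (Ωᶜ).Nonempty) :
    ∃ C : ℝ≥0∞, C ≠ ⊤ ∧ ∀ δ : ℝ, 0 < δ → (1 + K) * δ ≤ r / 3 → ∀ f : Eu N → ℝ, ContDiff ℝ ∞ f →
      ∫⁻ x in Ω ∩ {x | Metric.infDist x Ωᶜ < δ} ∩ Metric.ball p (r / 3), ‖f x‖ₑ ^ 2 ≤
        C * (ENNReal.ofReal δ * (∫⁻ x, ‖f x‖ₑ ^ 2 ∂(surface Ω)) + ENNReal.ofReal δ ^ 2 *
          ∫⁻ x in Ω ∩ {x | Metric.infDist x Ωᶜ ≤ (1 + K) * δ}, ‖gradient f x‖ₑ ^ 2) := by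
  obtain ⟨C, hC, hseg⟩ := h.exists_lintegral_segments_le hN ho
  obtain ⟨C', hC', hseg'⟩ := h.exists_lintegral_le_segments hN ho
  have hr := h.pos
  have hK : (0 : ℝ) ≤ K := K.2
  set L : ℝ≥0∞ := ENNReal.ofReal (1 + K) with hL
  have hL1 : L ≠ ⊤ := ENNReal.ofReal_ne_top
  refine ⟨C' * (2 * (L + L ^ 2 * C)), by finiteness, fun δ hδ hδr f hf => ?_⟩
  set s : ℝ := (1 + K) * δ with hs
  have hs0 : 0 < s := by positivity
  have hsL : ENNReal.ofReal s = L * ENNReal.ofReal δ := by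
    rw [hs, ENNReal.ofReal_mul (by positivity)]
  have hg1 : Measurable fun x => ‖f x‖ₑ ^ 2 := hf.continuous.enorm.measurable.pow_const 2
  have hg2 : Measurable fun x => ‖gradient f x‖ₑ ^ 2 :=
    (continuous_gradient hf).enorm.measurable.pow_const 2
  have hD : Continuous fun x : Eu N => Metric.infDist x Ωᶜ := Metric.continuous_infDist_pt _
  have hS : MeasurableSet (Ω ∩ {x | Metric.infDist x Ωᶜ < δ} ∩ Metric.ball p (r / 3)) :=
    (ho.measurableSet.inter (isOpen_lt hD continuous_const).measurableSet).inter measurableSet_ball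
  have hT : MeasurableSet (Ω ∩ {x | Metric.infDist x Ωᶜ ≤ s}) :=
    ho.measurableSet.inter (isClosed_le hD continuous_const).measurableSet
  have k1 := hseg' (2 * r / 3) s _ _ (by linarith) hS hg1 (by
    rintro y t ⟨⟨hx1, hx2⟩, hx3⟩
    have hxr : graphPt e γ y + t • e ∈ Metric.ball p r :=
      Metric.ball_subset_ball (by linarith) hx3
    have ht0 : 0 < t := (h.graphPt_add_mem_iff hxr).1 hx1
    obtain ⟨z, hz, hxz⟩ := (Metric.infDist_lt_iff hne).1 hx2
    have hzr : z ∈ Metric.ball p r := by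
      rw [Metric.mem_ball] at hx3 ⊢
      have h1 := dist_triangle_left z p (graphPt e γ y + t • e)
      have h2 : δ ≤ s := by rw [hs]; nlinarith
      linarith
    have hz' : inner ℝ e z ≤ γ (z - inner ℝ e z • e) := by
      by_contra hcon
      exact hz ((h.mem_iff z hzr).2 (not_le.1 hcon))
    -- the height above the graph is a `(1 + K)`-Lipschitz function, nonpositive outside `Ω`
    have hts : t ≤ s := by
      have h1 := h.inner_graphPt_add y t
      have h2 : |γ (z - inner ℝ e z • e) - γ y| ≤ K * dist (z - inner ℝ e z • e) y := by
        simpa [Real.dist_eq] using h.lip.dist_le_mul (z - inner ℝ e z • e) y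
      have h3 : dist (z - inner ℝ e z • e) (y : Eu N) ≤ dist z (graphPt e γ y + t • e) := by
        have h4 := (lipschitzWith_hypProj h.norm_e).dist_le_mul z (graphPt e γ y + t • e)
        rw [Subtype.dist_eq, coe_hypProj, coe_hypProj, h1] at h4
        have h5 : graphPt e γ y + t • e - (γ y + t) • e = y := by
          rw [graphPt]
          module
        rw [h5] at h4
        simpa using h4
      have h6 : inner ℝ e (graphPt e γ y + t • e) - inner ℝ e z ≤
          dist z (graphPt e γ y + t • e) := by
        rw [← inner_sub_right, dist_comm, dist_eq_norm]
        refine (real_inner_le_norm _ _).trans ?_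
        rw [h.norm_e, one_mul]
      have h7 : dist z (graphPt e γ y + t • e) ≤ δ := by
        rw [dist_comm]
        exact hxz.le
      have h8 := (abs_le.1 h2).2
      have h9 : (K : ℝ) * dist (z - inner ℝ e z • e) (y : Eu N) ≤ K * δ := by
        gcongr
        exact h3.trans h7
      rw [hs]
      linarith
    refine ⟨?_, ht0, hts⟩
    have h1 : dist (graphPt e γ y) (graphPt e γ y + t • e) = t := by
      rw [dist_self_add_right, norm_smul, h.norm_e, mul_one, Real.norm_of_nonneg ht0.le]
    rw [Metric.mem_ball] at hx3 ⊢
    have := dist_triangle (graphPt e γ y) (graphPt e γ y + t • e) p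
    linarith)
  have k2 := hseg (2 * r / 3) s _ _ (by linarith) hT hg2 (by
    rintro x ⟨hx1, hx2⟩ t ht
    refine ⟨h.add_smul_mem ho hx1 hx2 ht.1 (by linarith [ht.2]), ?_⟩
    have hxc : x ∈ Ωᶜ := by
      rw [ho.frontier_eq] at hx1
      exact hx1.2
    refine (Metric.infDist_le_dist_of_mem hxc).trans ?_
    rw [dist_self_add_left, norm_smul, h.norm_e, mul_one, Real.norm_of_nonneg ht.1.le]
    exact ht.2)
  refine k1.trans ?_
  rw [mul_assoc]
  gcongr
  refine (lintegral_mono fun x => lintegral_line_le hf x h.norm_e s).trans ?_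
  rw [lintegral_const_mul' _ _ (by simp),
    lintegral_add_left ((measurable_lintegral_line hg2 e _).const_mul _),
    lintegral_const_mul' _ _ (by finiteness), lintegral_const_mul' _ _ (by finiteness), mul_assoc]
  gcongr
  calc _ ≤ ENNReal.ofReal s ^ 2 * (C * ∫⁻ x in Ω ∩ {x | Metric.infDist x Ωᶜ ≤ s},
        ‖gradient f x‖ₑ ^ 2) + ENNReal.ofReal s * ∫⁻ x, ‖f x‖ₑ ^ 2 ∂(surface Ω) := by
        gcongr
        exact Measure.restrict_le_self
    _ = L * (ENNReal.ofReal δ * ∫⁻ x, ‖f x‖ₑ ^ 2 ∂(surface Ω)) + L ^ 2 * C *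
        (ENNReal.ofReal δ ^ 2 * ∫⁻ x in Ω ∩ {x | Metric.infDist x Ωᶜ ≤ s},
          ‖gradient f x‖ₑ ^ 2) := by
        rw [hsL]
        ring
    _ ≤ _ := by
        rw [mul_add]
        gcongr
        · exact le_self_add
        · exact le_add_self

end GraphChart

/-- The trace inequality. -/
theorem IsBoundedLipschitzDomain.exists_trace_le (hN : 1 ≤ N) (hΩ : IsBoundedLipschitzDomain Ω) :
    ∃ C : ℝ≥0∞, C ≠ ⊤ ∧ ∀ f : Eu N → ℝ, ContDiff ℝ ∞ f →
      ∫⁻ x, ‖f x‖ₑ ^ 2 ∂(surface Ω) ≤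
        C * ((∫⁻ x in Ω, ‖f x‖ₑ ^ 2) + ∫⁻ x in Ω, ‖gradient f x‖ₑ ^ 2) := by
  have key : ∃ C : ℝ≥0∞, C ≠ ⊤ ∧ ∀ f : Eu N → ℝ, ContDiff ℝ ∞ f →
      ∫⁻ x in frontier Ω, ‖f x‖ₑ ^ 2 ∂(surface Ω) ≤
        C * ((∫⁻ x in Ω, ‖f x‖ₑ ^ 2) + ∫⁻ x in Ω, ‖gradient f x‖ₑ ^ 2) := by
    refine hΩ.isCompact_frontier.induction_on (p := fun U => ∃ C : ℝ≥0∞, C ≠ ⊤ ∧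
      ∀ f : Eu N → ℝ, ContDiff ℝ ∞ f → ∫⁻ x in U, ‖f x‖ₑ ^ 2 ∂(surface Ω) ≤
        C * ((∫⁻ x in Ω, ‖f x‖ₑ ^ 2) + ∫⁻ x in Ω, ‖gradient f x‖ₑ ^ 2)) ?_ ?_ ?_ ?_
    · exact ⟨0, by simp, fun f _ => by simp⟩
    · rintro s t hst ⟨C, hC, h⟩
      exact ⟨C, hC, fun f hf => (lintegral_mono_set hst).trans (h f hf)⟩
    · rintro s t ⟨C, hC, h⟩ ⟨C', hC', h'⟩
      refine ⟨C + C', by finiteness, fun f hf => (lintegral_union_le _ s t).trans ?_⟩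
      rw [add_mul]
      exact add_le_add (h f hf) (h' f hf)
    · intro p hp
      obtain ⟨e, γ, K, r, h⟩ := hΩ.exists_chart hp
      exact ⟨_, mem_nhdsWithin_of_mem_nhds (Metric.ball_mem_nhds p (half_pos h.pos)),
        h.exists_trace_le hN hΩ.isOpen⟩
  have h1 : (surface Ω).restrict (frontier Ω) = surface Ω := by
    rw [surface, Measure.restrict_restrict isClosed_frontier.measurableSet, Set.inter_self]
  rwa [h1] at key

theorem IsBoundedLipschitzDomain.nonempty_compl (hN : 1 ≤ N) (hΩ : IsBoundedLipschitzDomain Ω) :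
    (Ωᶜ).Nonempty := by
  obtain ⟨p, hp⟩ := hΩ.frontier_nonempty hN
  rw [hΩ.isOpen.frontier_eq] at hp
  exact ⟨p, hp.2⟩

/-- In a boundary strip of width `δ`, the function is controlled by its boundary values and by
the gradient in a slightly wider strip. -/
theorem IsBoundedLipschitzDomain.exists_strip_le (hN : 1 ≤ N) (hΩ : IsBoundedLipschitzDomain Ω) :
    ∃ (C : ℝ≥0∞) (κ δ₀ : ℝ), C ≠ ⊤ ∧ 0 < δ₀ ∧ ∀ δ : ℝ, 0 < δ → δ < δ₀ →
      ∀ f : Eu N → ℝ, ContDiff ℝ ∞ f →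
        ∫⁻ x in Ω ∩ {x | Metric.infDist x Ωᶜ < δ}, ‖f x‖ₑ ^ 2 ≤
          C * (ENNReal.ofReal δ * (∫⁻ x, ‖f x‖ₑ ^ 2 ∂(surface Ω)) + ENNReal.ofReal δ ^ 2 *
            ∫⁻ x in Ω ∩ {x | Metric.infDist x Ωᶜ ≤ κ * δ}, ‖gradient f x‖ₑ ^ 2) := by
  have hne := hΩ.nonempty_compl hN
  have key : ∃ (C : ℝ≥0∞) (κ δ₀ : ℝ), C ≠ ⊤ ∧ 0 < δ₀ ∧ ∀ δ : ℝ, 0 < δ → δ < δ₀ →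
      ∀ f : Eu N → ℝ, ContDiff ℝ ∞ f →
        ∫⁻ x in Ω ∩ {x | Metric.infDist x Ωᶜ < δ} ∩ closure Ω, ‖f x‖ₑ ^ 2 ≤
          C * (ENNReal.ofReal δ * (∫⁻ x, ‖f x‖ₑ ^ 2 ∂(surface Ω)) + ENNReal.ofReal δ ^ 2 *
            ∫⁻ x in Ω ∩ {x | Metric.infDist x Ωᶜ ≤ κ * δ}, ‖gradient f x‖ₑ ^ 2) := by
    refine hΩ.isBounded.isCompact_closure.induction_on (p := fun U => ∃ (C : ℝ≥0∞) (κ δ₀ : ℝ),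
      C ≠ ⊤ ∧ 0 < δ₀ ∧ ∀ δ : ℝ, 0 < δ → δ < δ₀ → ∀ f : Eu N → ℝ, ContDiff ℝ ∞ f →
        ∫⁻ x in Ω ∩ {x | Metric.infDist x Ωᶜ < δ} ∩ U, ‖f x‖ₑ ^ 2 ≤
          C * (ENNReal.ofReal δ * (∫⁻ x, ‖f x‖ₑ ^ 2 ∂(surface Ω)) + ENNReal.ofReal δ ^ 2 *
            ∫⁻ x in Ω ∩ {x | Metric.infDist x Ωᶜ ≤ κ * δ}, ‖gradient f x‖ₑ ^ 2)) ?_ ?_ ?_ ?_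
    · exact ⟨0, 0, 1, by simp, one_pos, fun δ _ _ f _ => by simp⟩
    · rintro s t hst ⟨C, κ, δ₀, hC, hδ₀, h⟩
      exact ⟨C, κ, δ₀, hC, hδ₀, fun δ h1 h2 f hf =>
        (lintegral_mono_set (Set.inter_subset_inter_right _ hst)).trans (h δ h1 h2 f hf)⟩
    · rintro s t ⟨C, κ, δ₀, hC, hδ₀, h⟩ ⟨C', κ', δ₀', hC', hδ₀', h'⟩
      refine ⟨C + C', max κ κ', min δ₀ δ₀', by finiteness, lt_min hδ₀ hδ₀',
        fun δ h1 h2 f hf => ?_⟩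
      rw [Set.inter_union_distrib_left]
      refine (lintegral_union_le _ _ _).trans ?_
      rw [add_mul]
      refine add_le_add ((h δ h1 (h2.trans_le (min_le_left _ _)) f hf).trans ?_)
        ((h' δ h1 (h2.trans_le (min_le_right _ _)) f hf).trans ?_)
      · gcongr with x
        exact le_max_left _ _
      · gcongr with x
        exact le_max_right _ _
    · intro p hp
      by_cases hpΩ : p ∈ Ω
      · have hd : 0 < Metric.infDist p Ωᶜ :=
          (hΩ.isOpen.isClosed_compl.notMem_iff_infDist_pos hne).1 (fun h => h hpΩ)
        refine ⟨{x | Metric.infDist p Ωᶜ / 2 < Metric.infDist x Ωᶜ},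
          mem_nhdsWithin_of_mem_nhds ((isOpen_lt continuous_const
            (Metric.continuous_infDist_pt _)).mem_nhds (by simpa using hd)),
          0, 0, Metric.infDist p Ωᶜ / 2, by simp, half_pos hd, fun δ _ h2 f _ => ?_⟩
        have : Ω ∩ {x | Metric.infDist x Ωᶜ < δ} ∩
            {x | Metric.infDist p Ωᶜ / 2 < Metric.infDist x Ωᶜ} = ∅ := by
          rw [Set.eq_empty_iff_forall_notMem]
          rintro x ⟨⟨-, hx1⟩, hx2⟩
          exact absurd (hx2.trans (hx1.trans h2)) (lt_irrefl _)
        rw [this]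
        simp
      · have hpf : p ∈ frontier Ω := by
          rw [hΩ.isOpen.frontier_eq]
          exact ⟨hp, hpΩ⟩
        obtain ⟨e, γ, K, r, h⟩ := hΩ.exists_chart hpf
        obtain ⟨C, hC, hloc⟩ := h.exists_strip_le hN hΩ.isOpen hne
        have hr := h.pos
        have hK : (0 : ℝ) < 1 + K := by
          have := K.2
          positivity
        refine ⟨_, mem_nhdsWithin_of_mem_nhds (Metric.ball_mem_nhds p (by positivity :
          0 < r / 3)), C, 1 + K, r / 3 / (1 + K), hC, by positivity, fun δ h1 h2 f hf => ?_⟩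
        refine hloc δ h1 ?_ f hf
        rw [lt_div_iff₀' hK] at h2
        exact h2.le
  obtain ⟨C, κ, δ₀, hC, hδ₀, h⟩ := key
  refine ⟨C, κ, δ₀, hC, hδ₀, fun δ h1 h2 f hf => ?_⟩
  have := h δ h1 h2 f hf
  rwa [Set.inter_eq_left.2 (Set.inter_subset_left.trans subset_closure)] at this

/-! ### Cut-off functions -/

/-- The piecewise affine cut-off function which is `0` at distance at most `δ / 4` from the
complement of `Ω` and `1` at distance at least `δ / 2`. -/
noncomputable def rawCutoff (Ω : Set (Eu N)) (δ : ℝ) (x : Eu N) : ℝ :=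
  max 0 (min 1 (4 / δ * Metric.infDist x Ωᶜ - 1))

theorem lipschitzWith_rawCutoff (Ω : Set (Eu N)) {δ : ℝ} (hδ : 0 < δ) :
    LipschitzWith (4 / δ).toNNReal (rawCutoff Ω δ) := by
  have h1 : LipschitzWith (4 / δ).toNNReal fun x : Eu N => 4 / δ * Metric.infDist x Ωᶜ - 1 := by
    refine LipschitzWith.of_dist_le_mul fun x y => ?_
    have h2 := (Metric.lipschitz_infDist_pt (Ωᶜ)).dist_le_mul x y
    rw [Real.dist_eq, sub_sub_sub_cancel_right, ← mul_sub, abs_mul, abs_of_pos (by positivity),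
      Real.coe_toNNReal _ (by positivity)]
    gcongr
    simpa [Real.dist_eq] using h2
  exact (h1.const_min 1).const_max 0

/-- A smooth cut-off function: it is `1` at distance at least `δ` from the complement of `Ω`, and
its gradient is of order `1 / δ`. -/
theorem exists_cutoff (hb : Bornology.IsBounded Ω) {δ : ℝ} (hδ : 0 < δ) :
    ∃ η : Eu N → ℝ, IsTest Ω η ∧ (∀ x, 0 ≤ η x) ∧ (∀ x, η x ≤ 1) ∧
      (∀ x, δ ≤ Metric.infDist x Ωᶜ → η x = 1 ∧ gradient η x = 0) ∧
      ∀ x, ‖gradient η x‖ ≤ 4 / δ := by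
  -- mollification at scale `δ / 8` preserves the Lipschitz constant `4 / δ` and the values `0` and
  -- `1` up to a shift of the distances by `δ / 8`
  set g := rawCutoff Ω δ with hg
  have hlip := lipschitzWith_rawCutoff Ω hδ
  have hgc : Continuous g := hlip.continuous
  let φ : ContDiffBump (0 : Eu N) := ⟨δ / 16, δ / 8, by positivity, by linarith⟩
  set ψ : Eu N → ℝ := φ.normed volume with hψ
  set η : Eu N → ℝ := convolution ψ g (ContinuousLinearMap.lsmul ℝ ℝ) volume with hη
  have hψc : Continuous ψ := φ.continuous_normed
  have hψs : HasCompactSupport ψ := φ.hasCompactSupport_normed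
  have hηx : ∀ x, η x = ∫ t, ψ t * g (x - t) := fun x => rfl
  have hint : ∀ x, Integrable fun t => ψ t * g (x - t) := fun x =>
    (hψc.mul (hgc.comp (by fun_prop))).integrable_of_hasCompactSupport hψs.mul_right
  have hψi : Integrable ψ := hψc.integrable_of_hasCompactSupport hψs
  have hψ1 : ∫ t, ψ t = 1 := φ.integral_normed
  have hψ0 : ∀ t, 0 ≤ ψ t := φ.nonneg_normed
  have hg0 : ∀ x, 0 ≤ g x := fun x => le_max_left _ _
  have hg1 : ∀ x, g x ≤ 1 := fun x => max_le zero_le_one (min_le_left _ _)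
  have hsm : ContDiff ℝ ∞ η :=
    φ.hasCompactSupport_normed.contDiff_convolution_left _ φ.contDiff_normed
      hgc.locallyIntegrable
  have hD : ∀ x y : Eu N, y ∈ Metric.ball x (δ / 8) →
      |Metric.infDist y Ωᶜ - Metric.infDist x Ωᶜ| < δ / 8 := fun x y hy => by
    have h2 := (Metric.lipschitz_infDist_pt (Ωᶜ)).dist_le_mul y x
    rw [Real.dist_eq, NNReal.coe_one, one_mul] at h2
    exact h2.trans_lt hy
  have hout : ∀ x, Metric.infDist x Ωᶜ < δ / 8 → η x = 0 := by
    intro x hx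
    have hz : ∀ y, Metric.infDist y Ωᶜ ≤ δ / 4 → g y = 0 := by
      intro y hy
      refine max_eq_left ((min_le_right _ _).trans ?_)
      have : 4 / δ * Metric.infDist y Ωᶜ ≤ 4 / δ * (δ / 4) := by gcongr
      have h4 : 4 / δ * (δ / 4) = 1 := by field_simp
      linarith
    have h1 := φ.normed_convolution_eq_right (μ := volume) (g := g) (x₀ := x) fun y hy => by
      rw [hz y (by have := (abs_lt.1 (hD x y hy)).2; linarith), hz x (by linarith)]
    rw [hη, hψ, h1, hz x (by linarith)]
  have hin : ∀ x, 3 * δ / 4 < Metric.infDist x Ωᶜ → η x = 1 := by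
    intro x hx
    have hz : ∀ y, δ / 2 ≤ Metric.infDist y Ωᶜ → g y = 1 := by
      intro y hy
      have : 4 / δ * (δ / 2) ≤ 4 / δ * Metric.infDist y Ωᶜ := by gcongr
      have h4 : 4 / δ * (δ / 2) = 2 := by field_simp; norm_num
      rw [hg, rawCutoff, min_eq_left (by linarith)]
      simp
    have h1 := φ.normed_convolution_eq_right (μ := volume) (g := g) (x₀ := x) fun y hy => by
      rw [hz y (by have := (abs_lt.1 (hD x y hy)).1; linarith), hz x (by linarith)]
    rw [hη, hψ, h1, hz x (by linarith)]
  have hDc : Continuous fun x : Eu N => Metric.infDist x Ωᶜ := Metric.continuous_infDist_pt _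
  have hsub : {x : Eu N | δ / 8 ≤ Metric.infDist x Ωᶜ} ⊆ Ω := by
    intro x hx
    by_contra hxΩ
    have : Metric.infDist x Ωᶜ = 0 := Metric.infDist_zero_of_mem hxΩ
    rw [Set.mem_ofPred_eq, this] at hx
    linarith
  have hclosed : IsClosed {x : Eu N | δ / 8 ≤ Metric.infDist x Ωᶜ} :=
    isClosed_le continuous_const hDc
  have hsupp : Function.support η ⊆ {x : Eu N | δ / 8 ≤ Metric.infDist x Ωᶜ} := by
    intro x hx
    by_contra h
    exact hx (hout x (not_le.1 h))
  have hηlip : LipschitzWith (4 / δ).toNNReal η := by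
    refine LipschitzWith.of_dist_le_mul fun x y => ?_
    rw [dist_eq_norm, hηx, hηx, ← integral_sub (hint x) (hint y)]
    have h1 : ∀ t, ‖ψ t * g (x - t) - ψ t * g (y - t)‖ ≤ ψ t * ((4 / δ).toNNReal * dist x y) := by
      intro t
      rw [← mul_sub, norm_mul, Real.norm_of_nonneg (hψ0 t), ← dist_eq_norm]
      gcongr
      · exact hψ0 t
      · simpa using hlip.dist_le_mul (x - t) (y - t)
    refine (norm_integral_le_of_norm_le (hψi.mul_const _) (Eventually.of_forall h1)).trans_eq ?_
    rw [integral_mul_const, hψ1, one_mul]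
  refine ⟨η, ⟨hsm, ?_, ?_⟩, fun x => ?_, fun x => ?_, fun x hx => ?_, fun x => ?_⟩
  · exact HasCompactSupport.of_support_subset_isCompact
      (Metric.isCompact_of_isClosed_isBounded hclosed (hb.subset hsub)) hsupp
  · exact (closure_minimal hsupp hclosed).trans hsub
  · rw [hηx]
    exact integral_nonneg fun t => mul_nonneg (hψ0 t) (hg0 _)
  · rw [hηx, ← hψ1]
    exact integral_mono (hint x) hψi fun t => mul_le_of_le_one_right (hψ0 t) (hg1 _)
  · refine ⟨hin x (by linarith), ?_⟩
    have hev : η =ᶠ[𝓝 x] fun _ => 1 := by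
      filter_upwards [(isOpen_lt continuous_const hDc).mem_nhds
        (show 3 * δ / 4 < Metric.infDist x Ωᶜ by linarith)] with y hy
      exact hin y hy
    rw [← norm_eq_zero, norm_gradient, hev.fderiv_eq]
    simp
  · rw [norm_gradient]
    have := norm_fderiv_le_of_lipschitz ℝ (x₀ := x) hηlip
    rwa [Real.coe_toNNReal _ (by positivity)] at this

/-! ### Traces -/

theorem smoothTraceGraph_exists (hN : 1 ≤ N) (hΩ : IsBoundedLipschitzDomain Ω) {f : Eu N → ℝ}
    (hf : ContDiff ℝ ∞ f) : ∃ h : Lp ℝ 2 (surface Ω), h =ᵐ[surface Ω] f ∧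
      (ofSmooth hΩ.isBounded hf, h) ∈ smoothTraceGraph Ω := by
  have := hΩ.isFiniteMeasure_surface hN
  obtain ⟨C, hC⟩ := hΩ.isCompact_frontier.exists_bound_of_continuousOn hf.continuous.continuousOn
  have hm : MemLp f 2 (surface Ω) := by
    refine MemLp.of_bound hf.continuous.aestronglyMeasurable C ?_
    rw [surface, ae_restrict_iff' isClosed_frontier.measurableSet]
    exact Eventually.of_forall hC
  exact ⟨hm.toLp, hm.coeFn_toLp, f, hf, ofSmooth_fn _ hf, hm.coeFn_toLp⟩

/-- A closed property of pairs of a function and its trace holds if it holds for smooth functions. -/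
theorem traceGraph_induction (hΩ : IsBoundedLipschitzDomain Ω)
    {P : W12 Ω × Lp ℝ 2 (surface Ω) → Prop} (hP : IsClosed {p | P p})
    (h : ∀ (f : Eu N → ℝ) (hf : ContDiff ℝ ∞ f) (k : Lp ℝ 2 (surface Ω)), k =ᵐ[surface Ω] f →
      P (ofSmooth hΩ.isBounded hf, k)) {p : W12 Ω × Lp ℝ 2 (surface Ω)} (hp : p ∈ traceGraph Ω) :
    P p := by
  refine closure_minimal ?_ hP hp
  rintro ⟨u, k⟩ ⟨f, hf, h1, h2⟩
  have := h f hf k h2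
  rwa [← eq_ofSmooth hΩ.isOpen hΩ.isBounded hf h1] at this

/-- The trace inequality for all functions which have a trace. -/
theorem exists_norm_trace_le (hN : 1 ≤ N) (hΩ : IsBoundedLipschitzDomain Ω) :
    ∃ C : ℝ, 0 ≤ C ∧ ∀ p ∈ traceGraph Ω, ‖p.2‖ ≤ C * ‖p.1‖ := by
  obtain ⟨C, hC, h⟩ := hΩ.exists_trace_le hN
  lift C to ℝ≥0 using hC
  refine ⟨NNReal.sqrt C, by positivity, fun p hp => ?_⟩
  refine traceGraph_induction hΩ (P := fun p => ‖p.2‖ ≤ NNReal.sqrt C * ‖p.1‖)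
    (isClosed_le (by fun_prop) (by fun_prop)) (fun f hf k hk => ?_) hp
  refine norm_le_of_enorm_sq_le ?_
  rw [enorm_sq_Lp_of_ae hk, ← ENNReal.coe_pow, NNReal.sq_sqrt]
  refine (h f hf).trans_eq ?_
  rw [← enorm_sq_Lp_of_ae (ofSmooth_fn hΩ.isBounded hf),
    ← enorm_sq_Lp_of_ae (ofSmooth_grad hΩ.isBounded hf)]
  congr 1
  have := norm_sq_W12 (ofSmooth hΩ.isBounded hf)
  simp only [← ofReal_norm]
  rw [← ENNReal.ofReal_pow (norm_nonneg _), ← ENNReal.ofReal_pow (norm_nonneg _),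
    ← ENNReal.ofReal_pow (norm_nonneg _), this, ENNReal.ofReal_add (by positivity) (by positivity)]

theorem continuous_setLIntegral_sq {E : Type*} [NormedAddCommGroup E] [NormedSpace ℝ E]
    {μ : Measure (Eu N)} (S : Set (Eu N)) :
    Continuous fun f : Lp E 2 μ => ∫⁻ x in S, ‖f x‖ₑ ^ 2 ∂μ := by
  have h : ∀ f : Lp E 2 μ, ∫⁻ x in S, ‖f x‖ₑ ^ 2 ∂μ =
      ‖LpToLpRestrictCLM (Eu N) E ℝ μ 2 S f‖ₑ ^ 2 := fun f =>
    (enorm_sq_Lp_of_ae (LpToLpRestrictCLM_coeFn ℝ S f)).symm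
  simp only [h]
  exact (ENNReal.continuous_pow 2).comp (LpToLpRestrictCLM (Eu N) E ℝ μ 2 S).continuous.enorm

/-- The strip inequality for all functions with zero trace. -/
theorem exists_strip_le_of_zero_trace (hN : 1 ≤ N) (hΩ : IsBoundedLipschitzDomain Ω) :
    ∃ (C : ℝ≥0∞) (κ δ₀ : ℝ), C ≠ ⊤ ∧ 0 < δ₀ ∧ ∀ δ : ℝ, 0 < δ → δ < δ₀ →
      ∀ u : W12 Ω, (u, 0) ∈ traceGraph Ω →
        ∫⁻ x in {x | Metric.infDist x Ωᶜ < δ}, ‖u.fn x‖ₑ ^ 2 ∂(volume.restrict Ω) ≤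
          C * (ENNReal.ofReal δ ^ 2 *
            ∫⁻ x in {x | Metric.infDist x Ωᶜ ≤ κ * δ}, ‖u.grad x‖ₑ ^ 2 ∂(volume.restrict Ω)) := by
  obtain ⟨C, κ, δ₀, hC, hδ₀, h⟩ := hΩ.exists_strip_le hN
  refine ⟨C, κ, δ₀, hC, hδ₀, fun δ h1 h2 u hu => ?_⟩
  have hDc : Continuous fun x : Eu N => Metric.infDist x Ωᶜ := Metric.continuous_infDist_pt _
  have hm1 : MeasurableSet {x : Eu N | Metric.infDist x Ωᶜ < δ} :=
    (isOpen_lt hDc continuous_const).measurableSet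
  have hm2 : MeasurableSet {x : Eu N | Metric.infDist x Ωᶜ ≤ κ * δ} :=
    (isClosed_le hDc continuous_const).measurableSet
  have key := traceGraph_induction hΩ (P := fun p =>
      ∫⁻ x in {x | Metric.infDist x Ωᶜ < δ}, ‖p.1.fn x‖ₑ ^ 2 ∂(volume.restrict Ω) ≤
        C * (ENNReal.ofReal δ * ‖p.2‖ₑ ^ 2 + ENNReal.ofReal δ ^ 2 *
          ∫⁻ x in {x | Metric.infDist x Ωᶜ ≤ κ * δ}, ‖p.1.grad x‖ₑ ^ 2 ∂(volume.restrict Ω)))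
    ?_ ?_ hu
  · simpa using key
  · have c1 : Continuous fun p : W12 Ω × Lp ℝ 2 (surface Ω) => p.1.fn :=
      (fnL Ω).continuous.comp continuous_fst
    have c2 : Continuous fun p : W12 Ω × Lp ℝ 2 (surface Ω) => p.1.grad :=
      (gradL Ω).continuous.comp continuous_fst
    refine isClosed_le ((continuous_setLIntegral_sq _).comp c1) ?_
    have c3 := (ENNReal.continuous_const_mul (a := ENNReal.ofReal δ) (by finiteness)).comp
      ((ENNReal.continuous_pow 2).comp
        (continuous_snd (X := W12 Ω) (Y := Lp ℝ 2 (surface Ω))).enorm)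
    have c4 := (ENNReal.continuous_const_mul (a := ENNReal.ofReal δ ^ 2) (by finiteness)).comp
      ((continuous_setLIntegral_sq {x | Metric.infDist x Ωᶜ ≤ κ * δ}).comp c2)
    exact (ENNReal.continuous_const_mul hC).comp (c3.add c4)
  · intro f hf k hk
    have e1 := ofSmooth_fn hΩ.isBounded hf
    have e2 := ofSmooth_grad hΩ.isBounded hf
    have h3 := h δ h1 h2 f hf
    rw [enorm_sq_Lp_of_ae hk]
    rw [lintegral_congr_ae (g := fun x => ‖f x‖ₑ ^ 2)
      (ae_restrict_of_ae (e1.mono fun x hx => by simp only [hx])),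
      lintegral_congr_ae (f := fun x => ‖(ofSmooth hΩ.isBounded hf).grad x‖ₑ ^ 2)
      (g := fun x => ‖gradient f x‖ₑ ^ 2)
      (ae_restrict_of_ae (e2.mono fun x hx => by simp only [hx])),
      Measure.restrict_restrict hm1, Measure.restrict_restrict hm2, Set.inter_comm _ Ω,
      Set.inter_comm _ Ω]
    exact h3

/-- The product of a test function and a function which has a trace belongs to `W^{1,2}_0`. -/
theorem smulW_mem_W120S (hΩ : IsBoundedLipschitzDomain Ω) {θ : Eu N → ℝ} (hθ : IsTest Ω θ)
    {p : W12 Ω × Lp ℝ 2 (surface Ω)} (hp : p ∈ traceGraph Ω) :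
    smulW hΩ.isBounded hθ.smooth p.1 ∈ W120S Ω := by
  refine traceGraph_induction hΩ
    (P := fun p => smulW hΩ.isBounded hθ.smooth p.1 ∈ W120S Ω) ?_ ?_ hp
  · exact isClosed_W120S.preimage
      ((smulW hΩ.isBounded hθ.smooth).continuous.comp continuous_fst)
  · intro f hf k _
    rw [smulW_ofSmooth hΩ.isOpen hΩ.isBounded hf hθ.smooth]
    have : IsTest Ω fun x => θ x * f x := by
      simpa only [mul_comm] using hθ.mul hf
    exact this.ofSmooth_mem hΩ.isBounded

/-- A Sobolev function with zero trace belongs to `W^{1,2}_0`: by the strip inequality, the product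
of the gradient of the cut-off function, of order `1 / δ`, with `u` tends to zero in `L²`. -/
theorem mem_W120S_of_zero_trace (hN : 1 ≤ N) (hΩ : IsBoundedLipschitzDomain Ω) {u : W12 Ω}
    (hu : (u, 0) ∈ traceGraph Ω) : u ∈ W120S Ω := by
  obtain ⟨C, κ, δ₀, hC, hδ₀, hstrip⟩ := exists_strip_le_of_zero_trace hN hΩ
  have hDc : Continuous fun x : Eu N => Metric.infDist x Ωᶜ := Metric.continuous_infDist_pt _
  set μ := volume.restrict Ω with hμ
  have hfin : IsFiniteMeasure μ := ⟨by simpa [hμ] using hΩ.isBounded.measure_lt_top⟩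
  set D : ℝ → Set (Eu N) := fun δ => {x | Metric.infDist x Ωᶜ ≤ δ} with hDdef
  have hDm : ∀ δ, MeasurableSet (D δ) := fun δ => (isClosed_le hDc continuous_const).measurableSet
  choose η ηt η0 η1 ηin ηgrad using fun δ : {δ : ℝ // 0 < δ} => exists_cutoff hΩ.isBounded δ.2
  -- the truncation error is controlled by the gradient in a thin strip
  have hest : ∀ δ : {δ : ℝ // 0 < δ}, δ.1 < δ₀ →
      ‖u - smulW hΩ.isBounded (ηt δ).smooth u‖ₑ ^ 2 ≤
        C * (ENNReal.ofReal δ ^ 2 * ∫⁻ x in D (κ * δ), ‖u.grad x‖ₑ ^ 2 ∂μ) +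
        2 * (∫⁻ x in D δ, ‖u.grad x‖ₑ ^ 2 ∂μ +
          16 * (C * ∫⁻ x in D (κ * δ), ‖u.grad x‖ₑ ^ 2 ∂μ)) := by
    intro δ hδ
    have hs := hstrip δ δ.2 hδ u hu
    have hδ0 : ENNReal.ofReal δ ≠ 0 := by simpa using δ.2
    have hm1 : MeasurableSet {x : Eu N | Metric.infDist x Ωᶜ < δ} :=
      (isOpen_lt hDc continuous_const).measurableSet
    set w := u - smulW hΩ.isBounded (ηt δ).smooth u with hw
    have hwfn : w.fn =ᵐ[μ] fun x => (1 - η δ x) * u.fn x := by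
      have e0 : w.fn = u.fn - (smulW hΩ.isBounded (ηt δ).smooth u).fn := by
        rw [hw, ← fnL_apply, map_sub]
        rfl
      rw [e0]
      filter_upwards [Lp.coeFn_sub u.fn (smulW hΩ.isBounded (ηt δ).smooth u).fn,
        smulW_fn hΩ.isBounded (ηt δ).smooth u] with x h1 h2
      rw [h1, Pi.sub_apply, h2]
      ring
    have hwgr : w.grad =ᵐ[μ] fun x => (1 - η δ x) • u.grad x + -(u.fn x • gradient (η δ) x) := by
      have e0 : w.grad = u.grad - (smulW hΩ.isBounded (ηt δ).smooth u).grad := by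
        rw [hw, ← gradL_apply, map_sub]
        rfl
      rw [e0]
      filter_upwards [Lp.coeFn_sub u.grad (smulW hΩ.isBounded (ηt δ).smooth u).grad,
        smulW_grad hΩ.isBounded (ηt δ).smooth u] with x h1 h2
      rw [h1, Pi.sub_apply, h2]
      module
    have habs : ∀ x, ‖1 - η δ x‖ₑ ≤ 1 := fun x => by
      rw [← ofReal_norm, ← ENNReal.ofReal_one]
      refine ENNReal.ofReal_le_ofReal ?_
      rw [Real.norm_of_nonneg (by linarith [η1 δ x])]
      linarith [η0 δ x]
    have hS : ∀ x, x ∉ {x : Eu N | Metric.infDist x Ωᶜ < δ} → η δ x = 1 ∧ gradient (η δ) x = 0 :=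
      fun x hx => ηin δ x (not_lt.1 hx)
    have b1 : ‖w.fn‖ₑ ^ 2 ≤ ∫⁻ x in {x | Metric.infDist x Ωᶜ < δ}, ‖u.fn x‖ₑ ^ 2 ∂μ := by
      rw [enorm_sq_Lp_of_ae hwfn, ← lintegral_indicator hm1]
      refine lintegral_mono fun x => ?_
      by_cases hx : x ∈ {x : Eu N | Metric.infDist x Ωᶜ < δ}
      · rw [Set.indicator_of_mem hx, enorm_mul]
        gcongr
        exact mul_le_of_le_one_left' (habs x)
      · rw [Set.indicator_of_notMem hx, (hS x hx).1]
        simp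
    have b2 : ‖w.grad‖ₑ ^ 2 ≤ 2 * (∫⁻ x in D δ, ‖u.grad x‖ₑ ^ 2 ∂μ +
        ENNReal.ofReal (4 / δ) ^ 2 *
          ∫⁻ x in {x | Metric.infDist x Ωᶜ < δ}, ‖u.fn x‖ₑ ^ 2 ∂μ) := by
      rw [enorm_sq_Lp_of_ae hwgr, ← lintegral_indicator hm1, ← lintegral_indicator (hDm _),
        ← lintegral_const_mul' _ _ (by finiteness), ← lintegral_add_left',
        ← lintegral_const_mul' _ _ (by finiteness)]
      · refine lintegral_mono fun x => (enorm_add_sq_le _ _).trans ?_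
        by_cases hx : x ∈ {x : Eu N | Metric.infDist x Ωᶜ < δ}
        · have hx' : x ∈ D δ := le_of_lt (show Metric.infDist x Ωᶜ < δ from hx)
          simp only [Set.indicator_of_mem hx, Set.indicator_of_mem hx']
          rw [enorm_neg, enorm_smul, enorm_smul, ← mul_pow, mul_comm ‖u.fn x‖ₑ]
          gcongr
          · exact mul_le_of_le_one_left' (habs x)
          · rw [← ofReal_norm]
            exact ENNReal.ofReal_le_ofReal (ηgrad δ x)
        · rw [(hS x hx).1, (hS x hx).2]
          simp
      · exact ((Lp.aestronglyMeasurable u.grad).enorm.pow_const 2).indicator (hDm _)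
    have hnorm : ‖w‖ₑ ^ 2 = ‖w.fn‖ₑ ^ 2 + ‖w.grad‖ₑ ^ 2 := by
      have := norm_sq_W12 w
      simp only [← ofReal_norm]
      rw [← ENNReal.ofReal_pow (norm_nonneg _), ← ENNReal.ofReal_pow (norm_nonneg _),
        ← ENNReal.ofReal_pow (norm_nonneg _), this,
        ENNReal.ofReal_add (by positivity) (by positivity)]
    rw [hnorm]
    refine add_le_add (b1.trans hs) (b2.trans ?_)
    refine mul_le_mul' le_rfl (add_le_add le_rfl ?_)
    calc ENNReal.ofReal (4 / δ) ^ 2 * ∫⁻ x in {x | Metric.infDist x Ωᶜ < δ}, ‖u.fn x‖ₑ ^ 2 ∂μ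
        ≤ ENNReal.ofReal (4 / δ) ^ 2 * (C * (ENNReal.ofReal δ ^ 2 *
            ∫⁻ x in D (κ * δ), ‖u.grad x‖ₑ ^ 2 ∂μ)) := by gcongr
      _ = (ENNReal.ofReal (4 / δ) * ENNReal.ofReal δ) ^ 2 *
            (C * ∫⁻ x in D (κ * δ), ‖u.grad x‖ₑ ^ 2 ∂μ) := by ring
      _ = _ := by
        rw [← ENNReal.ofReal_mul (by have := δ.2; positivity), div_mul_cancel₀ _ δ.2.ne']
        norm_num
  -- the measure of the strips tends to zero
  have hne := hΩ.nonempty_compl hN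
  have hmeas : Tendsto (fun δ => μ (D δ)) (𝓝[>] 0) (𝓝 0) := by
    have h0 : μ (⋂ δ > (0 : ℝ), D δ) = 0 := by
      rw [hμ, Measure.restrict_apply' hΩ.isOpen.measurableSet]
      convert measure_empty (μ := (volume : Measure (Eu N)))
      rw [Set.eq_empty_iff_forall_notMem]
      rintro x ⟨hx, hxΩ⟩
      have hpos : 0 < Metric.infDist x Ωᶜ :=
        (hΩ.isOpen.isClosed_compl.notMem_iff_infDist_pos hne).1 (fun h => h hxΩ)
      have := Set.mem_iInter₂.1 hx (Metric.infDist x Ωᶜ / 2) (half_pos hpos)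
      rw [hDdef, Set.mem_ofPred_eq] at this
      linarith
    rw [← h0]
    exact tendsto_measure_biInter_gt (fun δ _ => (hDm δ).nullMeasurableSet)
      (fun i j _ hij x hx => le_trans hx hij) ⟨1, one_pos, measure_ne_top _ _⟩
  have hgfin : ∫⁻ x, ‖u.grad x‖ₑ ^ 2 ∂μ ≠ ⊤ := by
    rw [← enorm_sq_Lp]
    finiteness
  have hI : Tendsto (fun δ => ∫⁻ x in D δ, ‖u.grad x‖ₑ ^ 2 ∂μ) (𝓝[>] 0) (𝓝 0) :=
    tendsto_setLIntegral_zero hgfin hmeas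
  have hκ : Tendsto (fun δ => ∫⁻ x in D (κ * δ), ‖u.grad x‖ₑ ^ 2 ∂μ) (𝓝[>] 0) (𝓝 0) := by
    have h1 : Tendsto (fun δ : ℝ => (|κ| + 1) * δ) (𝓝[>] 0) (𝓝[>] 0) := by
      refine tendsto_nhdsWithin_of_tendsto_nhds_of_eventually_within _ ?_ ?_
      · have : Tendsto (fun δ : ℝ => (|κ| + 1) * δ) (𝓝 0) (𝓝 ((|κ| + 1) * 0)) :=
          Continuous.tendsto (by fun_prop) 0
        rw [mul_zero] at this
        exact this.mono_left nhdsWithin_le_nhds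
      · filter_upwards [self_mem_nhdsWithin] with δ (hδ : 0 < δ)
        exact mul_pos (by positivity) hδ
    refine tendsto_of_tendsto_of_tendsto_of_le_of_le' tendsto_const_nhds (hI.comp h1)
      (Eventually.of_forall fun _ => zero_le) ?_
    filter_upwards [self_mem_nhdsWithin] with δ (hδ : 0 < δ)
    refine lintegral_mono_set fun x (hx : Metric.infDist x Ωᶜ ≤ κ * δ) => ?_
    refine le_trans (b := κ * δ) hx (mul_le_mul_of_nonneg_right ?_ hδ.le)
    linarith [le_abs_self κ]
  have hδ2 : Tendsto (fun δ : ℝ => ENNReal.ofReal δ ^ 2) (𝓝[>] 0) (𝓝 0) := by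
    have : Tendsto (fun δ : ℝ => ENNReal.ofReal δ ^ 2) (𝓝 0) (𝓝 (ENNReal.ofReal 0 ^ 2)) :=
      ((ENNReal.continuous_pow 2).comp ENNReal.continuous_ofReal).tendsto 0
    simp only [ENNReal.ofReal_zero, ne_eq, OfNat.ofNat_ne_zero, not_false_eq_true, zero_pow] at this
    exact this.mono_left nhdsWithin_le_nhds
  have hlim : Tendsto (fun δ : ℝ => C * (ENNReal.ofReal δ ^ 2 *
        ∫⁻ x in D (κ * δ), ‖u.grad x‖ₑ ^ 2 ∂μ) +
        2 * (∫⁻ x in D δ, ‖u.grad x‖ₑ ^ 2 ∂μ +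
          16 * (C * ∫⁻ x in D (κ * δ), ‖u.grad x‖ₑ ^ 2 ∂μ))) (𝓝[>] 0) (𝓝 0) := by
    have t1 := ENNReal.Tendsto.const_mul (a := C) (ENNReal.Tendsto.mul hδ2 (Or.inr (by simp)) hκ
      (Or.inr (by simp))) (Or.inr hC)
    have t2 := ENNReal.Tendsto.const_mul (a := 2) (hI.add (ENNReal.Tendsto.const_mul (a := 16)
      (ENNReal.Tendsto.const_mul hκ (Or.inr hC)) (Or.inr (by simp)))) (Or.inr (by simp))
    simpa using t1.add t2
  rw [← SetLike.mem_coe, ← isClosed_W120S.closure_eq, Metric.mem_closure_iff]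
  intro ε hε
  have hε' : 0 < ENNReal.ofReal ε ^ 2 := ENNReal.pow_pos (by simpa using hε) 2
  obtain ⟨δ, hδ1, hδ2, hδ3⟩ := (hlim.eventually_lt_const hε').and
    ((eventually_lt_nhds hδ₀).filter_mono nhdsWithin_le_nhds |>.and self_mem_nhdsWithin) |>.exists
  refine ⟨_, smulW_mem_W120S hΩ (ηt ⟨δ, hδ3⟩) hu, ?_⟩
  have h1 := (hest ⟨δ, hδ3⟩ hδ2).trans_lt hδ1
  have h2 := lt_of_not_ge fun h => absurd (pow_le_pow_left' h 2) (not_le.2 h1)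
  rw [dist_eq_norm]
  rw [← ofReal_norm] at h2
  exact (ENNReal.ofReal_lt_ofReal_iff hε).1 h2

/-- The functions of `W^{1,2}_0` have zero trace. -/
theorem zero_trace_of_mem_W120S (hΩ : IsBoundedLipschitzDomain Ω) {u : W12 Ω} (hu : u ∈ W120S Ω) :
    (u, 0) ∈ traceGraph Ω := by
  have hcl : IsClosed {u : W12 Ω | (u, (0 : Lp ℝ 2 (surface Ω))) ∈ traceGraph Ω} :=
    (Submodule.isClosed_topologicalClosure _).preimage (by fun_prop)
  refine closure_minimal ?_ hcl hu
  rintro u ⟨φ, hφ, hu⟩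
  refine subset_closure ⟨φ, hφ.smooth, hu, ?_⟩
  have h1 : φ =ᵐ[surface Ω] 0 := by
    rw [surface, EventuallyEq, ae_restrict_iff' isClosed_frontier.measurableSet]
    refine Eventually.of_forall fun x hx => ?_
    rw [hΩ.isOpen.frontier_eq] at hx
    exact hφ.eq_zero hx.2
  exact (Lp.coeFn_zero ℝ 2 (surface Ω)).trans h1.symm

/-! ### The Poincaré inequality -/

/-- On the part of `Ω` in `S` the oscillation of a smooth function is controlled by its gradient in
`Ω` and its oscillation in `B`. -/
def ControlledBy (Ω B S : Set (Eu N)) : Prop :=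
  ∃ C : ℝ≥0∞, C ≠ ⊤ ∧ ∀ f : Eu N → ℝ, ContDiff ℝ ∞ f → ∀ c : ℝ,
    ∫⁻ x in S ∩ Ω, ‖f x - c‖ₑ ^ 2 ≤
      C * ((∫⁻ x in Ω, ‖gradient f x‖ₑ ^ 2) + ∫⁻ x in B, ‖f x - c‖ₑ ^ 2)

namespace ControlledBy

variable {B S T : Set (Eu N)}

theorem mono (h : ControlledBy Ω B T) (hST : S ⊆ T) : ControlledBy Ω B S := by
  obtain ⟨C, hC, h⟩ := h
  refine ⟨C, hC, fun f hf c => (lintegral_mono_set ?_).trans (h f hf c)⟩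
  exact Set.inter_subset_inter_left _ hST

theorem empty : ControlledBy Ω B ∅ := ⟨0, by simp, fun f hf c => by simp⟩

theorem self (h : S ⊆ B) : ControlledBy Ω B S :=
  ⟨1, by simp, fun f hf c => by
    rw [one_mul]
    exact (lintegral_mono_set (Set.inter_subset_left.trans h)).trans le_add_self⟩

theorem union (hS : ControlledBy Ω B S) (hT : ControlledBy Ω B T) : ControlledBy Ω B (S ∪ T) := by
  obtain ⟨C, hC, h⟩ := hS
  obtain ⟨D, hD, k⟩ := hT
  refine ⟨C + D, by finiteness, fun f hf c => ?_⟩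
  rw [Set.union_inter_distrib_right, add_mul]
  exact (lintegral_union_le _ _ _).trans (add_le_add (h f hf c) (k f hf c))

/-- Control propagates along a translation whose segments stay in the domain. -/
theorem of_translation (ho : IsOpen Ω) (hS : MeasurableSet S) (hT : ControlledBy Ω B T) (w : Eu N)
    (h : ∀ x ∈ S ∩ Ω, ∀ t ∈ Set.Ioc (0 : ℝ) 1, x + t • w ∈ Ω) (hw : ∀ x ∈ S ∩ Ω, x + w ∈ T) :
    ControlledBy Ω B S := by
  obtain ⟨C, hC, hT⟩ := hT
  refine ⟨2 * (‖w‖ₑ ^ 2 + C), by finiteness, fun f hf c => ?_⟩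
  have hm := hS.inter ho.measurableSet
  have hfm : Measurable f := hf.continuous.measurable
  have h1 := lintegral_translation_sq_le hf hm ho.measurableSet w h
  have h2 : ∫⁻ x in S ∩ Ω, ‖f (x + w) - c‖ₑ ^ 2 ≤ ∫⁻ x in T ∩ Ω, ‖f x - c‖ₑ ^ 2 := by
    rw [← lintegral_indicator hm]
    calc _ ≤ ∫⁻ x, (T ∩ Ω).indicator (fun x => ‖f x - c‖ₑ ^ 2) (x + w) := by
          refine lintegral_mono fun x => ?_
          by_cases hx : x ∈ S ∩ Ω
          · have := h x hx 1 ⟨one_pos, le_rfl⟩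
            rw [one_smul] at this
            have hx' : x + w ∈ T ∩ Ω := ⟨hw x hx, this⟩
            rw [Set.indicator_of_mem hx, Set.indicator_of_mem hx']
          · rw [Set.indicator_of_notMem hx]
            exact zero_le
      _ = ∫⁻ x, (T ∩ Ω).indicator (fun x => ‖f x - c‖ₑ ^ 2) x :=
          lintegral_add_right_eq_self _ w
      _ ≤ _ := lintegral_indicator_le _ _
  calc ∫⁻ x in S ∩ Ω, ‖f x - c‖ₑ ^ 2
      ≤ ∫⁻ x in S ∩ Ω, 2 * (‖f (x + w) - f x‖ₑ ^ 2 + ‖f (x + w) - c‖ₑ ^ 2) := by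
        refine lintegral_mono fun x => ?_
        have := enorm_add_sq_le (-(f (x + w) - f x)) (f (x + w) - c)
        rw [enorm_neg] at this
        refine le_trans (le_of_eq ?_) this
        congr 2
        ring
    _ = 2 * ((∫⁻ x in S ∩ Ω, ‖f (x + w) - f x‖ₑ ^ 2) + ∫⁻ x in S ∩ Ω, ‖f (x + w) - c‖ₑ ^ 2) := by
        rw [lintegral_const_mul' _ _ (by finiteness), lintegral_add_left]
        fun_prop
    _ ≤ 2 * (‖w‖ₑ ^ 2 * (∫⁻ x in Ω, ‖gradient f x‖ₑ ^ 2) +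
          C * ((∫⁻ x in Ω, ‖gradient f x‖ₑ ^ 2) + ∫⁻ x in B, ‖f x - c‖ₑ ^ 2)) := by
        gcongr
        exact h2.trans (hT f hf c)
    _ ≤ 2 * (‖w‖ₑ ^ 2 * ((∫⁻ x in Ω, ‖gradient f x‖ₑ ^ 2) + ∫⁻ x in B, ‖f x - c‖ₑ ^ 2) +
          C * ((∫⁻ x in Ω, ‖gradient f x‖ₑ ^ 2) + ∫⁻ x in B, ‖f x - c‖ₑ ^ 2)) := by
        gcongr
        exact le_self_add
    _ = _ := by ring

end ControlledBy

/-- In a connected open set every point has a neighbourhood controlled by a given ball: the set of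
these points is open and relatively closed. -/
theorem exists_ball_controlledBy (ho : IsOpen Ω) (hc : IsConnected Ω) {x₀ : Eu N} {ρ₀ : ℝ}
    (hρ₀ : 0 < ρ₀) (hx₀ : x₀ ∈ Ω) {x : Eu N} (hx : x ∈ Ω) :
    ∃ ρ > 0, ControlledBy Ω (Metric.ball x₀ ρ₀) (Metric.ball x ρ) := by
  set G : Set (Eu N) := {x | ∃ ρ > 0, ControlledBy Ω (Metric.ball x₀ ρ₀) (Metric.ball x ρ)} with hG
  have hGo : IsOpen G := by
    rw [Metric.isOpen_iff]
    rintro y ⟨ρ, hρ, hy⟩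
    refine ⟨ρ / 2, by positivity, fun z hz => ⟨ρ / 2, by positivity, hy.mono ?_⟩⟩
    refine Metric.ball_subset_ball' ?_
    rw [Metric.mem_ball] at hz
    linarith
  refine hc.isPreconnected.subset_of_closure_inter_subset hGo
    ⟨x₀, hx₀, ρ₀, hρ₀, ControlledBy.self subset_rfl⟩ ?_ hx
  rintro y ⟨hy, hyΩ⟩
  obtain ⟨r, hr, hrΩ⟩ := Metric.isOpen_iff.1 ho y hyΩ
  obtain ⟨z, ⟨ρ, hρ, hz⟩, hzy⟩ := Metric.mem_closure_iff.1 hy (r / 2) (by positivity)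
  refine ⟨min ρ (r / 2), by positivity, ?_⟩
  refine hz.of_translation ho measurableSet_ball (z - y) (fun a ha t ht => hrΩ ?_) fun a ha => ?_
  · have h1 := ha.1
    rw [Metric.mem_ball, dist_eq_norm] at h1 ⊢
    rw [dist_comm, dist_eq_norm] at hzy
    calc ‖a + t • (z - y) - y‖ = ‖(a - y) + t • (z - y)‖ := by congr 1; abel
      _ ≤ ‖a - y‖ + ‖t • (z - y)‖ := norm_add_le _ _
      _ ≤ ‖a - y‖ + ‖z - y‖ := by
          rw [norm_smul, Real.norm_of_nonneg ht.1.le]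
          gcongr
          exact mul_le_of_le_one_left (norm_nonneg _) ht.2
      _ < r := by linarith [min_le_right ρ (r / 2)]
  · have h1 := ha.1
    rw [Metric.mem_ball, dist_eq_norm] at h1 ⊢
    have : a + (z - y) - z = a - y := by abel
    rw [this]
    exact h1.trans_le (min_le_left _ _)

/-- A boundary point has a neighbourhood controlled by a given ball: the graph structure allows
a translation into the interior. -/
theorem exists_ball_controlledBy_frontier (hΩ : IsBoundedLipschitzDomain Ω) {x₀ : Eu N} {ρ₀ : ℝ}
    (hρ₀ : 0 < ρ₀) (hx₀ : x₀ ∈ Ω) {p : Eu N} (hp : p ∈ frontier Ω) :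
    ∃ ρ > 0, ControlledBy Ω (Metric.ball x₀ ρ₀) (Metric.ball p ρ) := by
  obtain ⟨e, γ, K, r, h⟩ := hΩ.exists_chart hp
  have hr := h.pos
  have hpe : p + (r / 2) • e ∈ Ω :=
    h.add_smul_mem hΩ.isOpen (a := r / 2) hp (Metric.mem_ball_self (by positivity))
      (by positivity) (by linarith)
  obtain ⟨ρ, hρ, hG⟩ := exists_ball_controlledBy hΩ.isOpen hΩ.isConnected hρ₀ hx₀ hpe
  refine ⟨min ρ (r / 2), by positivity, ?_⟩
  refine hG.of_translation hΩ.isOpen measurableSet_ball ((r / 2) • e) (fun a ha t ht => ?_)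
    fun a ha => ?_
  · have h1 := ha.1
    rw [Metric.mem_ball, dist_eq_norm] at h1
    have hball : a + t • (r / 2) • e ∈ Metric.ball p r := by
      rw [Metric.mem_ball, dist_eq_norm]
      calc ‖a + t • (r / 2) • e - p‖ = ‖(a - p) + t • (r / 2) • e‖ := by congr 1; abel
        _ ≤ ‖a - p‖ + ‖t • (r / 2) • e‖ := norm_add_le _ _
        _ ≤ ‖a - p‖ + r / 2 := by
            rw [norm_smul, norm_smul, h.norm_e, Real.norm_of_nonneg ht.1.le,
              Real.norm_of_nonneg (by positivity), mul_one]
            gcongr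
            exact mul_le_of_le_one_left (by positivity) ht.2
        _ < r := by linarith [min_le_right ρ (r / 2)]
    have ha' : a ∈ Metric.ball p r := by
      rw [Metric.mem_ball, dist_eq_norm]
      linarith [min_le_right ρ (r / 2)]
    have h2 := (h.mem_iff a ha').1 ha.2
    rw [h.mem_iff _ hball]
    have h3 : inner ℝ e (a + t • (r / 2) • e) = inner ℝ e a + t * (r / 2) := by
      rw [inner_add_right, inner_smul_right, inner_smul_right, real_inner_self_eq_norm_sq, h.norm_e]
      ring
    have h4 : a + t • (r / 2) • e - (inner ℝ e a + t * (r / 2)) • e = a - inner ℝ e a • e := by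
      module
    rw [h3, h4]
    have := ht.1
    nlinarith
  · have h1 := ha.1
    rw [Metric.mem_ball, dist_eq_norm] at h1 ⊢
    rw [add_sub_add_right_eq_sub]
    exact h1.trans_le (min_le_left _ _)

theorem IsBoundedLipschitzDomain.controlledBy (hΩ : IsBoundedLipschitzDomain Ω) {x₀ : Eu N} {ρ₀ : ℝ}
    (hρ₀ : 0 < ρ₀) (hx₀ : x₀ ∈ Ω) : ControlledBy Ω (Metric.ball x₀ ρ₀) (closure Ω) := by
  refine hΩ.isBounded.isCompact_closure.induction_on ControlledBy.empty
    (fun S T hST hT => hT.mono hST) (fun S T hS hT => hS.union hT) fun x hx => ?_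
  obtain ⟨ρ, hρ, h⟩ : ∃ ρ > 0, ControlledBy Ω (Metric.ball x₀ ρ₀) (Metric.ball x ρ) := by
    by_cases hxΩ : x ∈ Ω
    · exact exists_ball_controlledBy hΩ.isOpen hΩ.isConnected hρ₀ hx₀ hxΩ
    · refine exists_ball_controlledBy_frontier hΩ hρ₀ hx₀ ⟨hx, ?_⟩
      rwa [hΩ.isOpen.interior_eq]
  exact ⟨_, mem_nhdsWithin_of_mem_nhds (Metric.ball_mem_nhds x hρ), h⟩

/-- The double integral of the increments over a ball is controlled by the gradient: substitute
`x = y + w` and apply the translation estimate for each `w`. -/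
theorem lintegral_lintegral_sub_sq_le (ho : IsOpen Ω) {f : Eu N → ℝ} (hf : ContDiff ℝ ∞ f)
    {x₀ : Eu N} {ρ : ℝ} (hB : Metric.ball x₀ ρ ⊆ Ω) :
    ∫⁻ y in Metric.ball x₀ ρ, ∫⁻ x in Metric.ball x₀ ρ, ‖f x - f y‖ₑ ^ 2 ≤
      volume (Metric.ball (0 : Eu N) (2 * ρ)) *
        (ENNReal.ofReal (2 * ρ) ^ 2 * ∫⁻ x in Ω, ‖gradient f x‖ₑ ^ 2) := by
  set B := Metric.ball x₀ ρ with hBdef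
  have hfm : Measurable f := hf.continuous.measurable
  have hBm : MeasurableSet B := measurableSet_ball
  have hS : ∀ w, MeasurableSet {y | y ∈ B ∧ y + w ∈ B} := fun w =>
    hBm.inter (hBm.preimage (measurable_add_const w))
  calc ∫⁻ y in B, ∫⁻ x in B, ‖f x - f y‖ₑ ^ 2
      = ∫⁻ y in B, ∫⁻ w, B.indicator (fun x => ‖f x - f y‖ₑ ^ 2) (y + w) := by
        refine lintegral_congr fun y => ?_
        rw [lintegral_add_left_eq_self, lintegral_indicator hBm]
    _ = ∫⁻ w, ∫⁻ y in B, B.indicator (fun x => ‖f x - f y‖ₑ ^ 2) (y + w) := by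
        rw [lintegral_lintegral_swap]
        refine Measurable.aemeasurable ?_
        have : (Function.uncurry fun y w => B.indicator (fun x => ‖f x - f y‖ₑ ^ 2) (y + w)) =
            {p : Eu N × Eu N | p.1 + p.2 ∈ B}.indicator
              fun p => ‖f (p.1 + p.2) - f p.1‖ₑ ^ 2 := rfl
        rw [this]
        refine Measurable.indicator (by fun_prop) ?_
        exact hBm.preimage (measurable_fst.add measurable_snd)
    _ ≤ ∫⁻ w in Metric.ball (0 : Eu N) (2 * ρ),
          ENNReal.ofReal (2 * ρ) ^ 2 * ∫⁻ x in Ω, ‖gradient f x‖ₑ ^ 2 := by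
        rw [← lintegral_indicator measurableSet_ball]
        refine lintegral_mono fun w => ?_
        have e1 : ∫⁻ y in B, B.indicator (fun x => ‖f x - f y‖ₑ ^ 2) (y + w) =
            ∫⁻ y in {y | y ∈ B ∧ y + w ∈ B}, ‖f (y + w) - f y‖ₑ ^ 2 := by
          rw [← lintegral_indicator hBm, ← lintegral_indicator (hS w)]
          refine lintegral_congr fun y => ?_
          by_cases h1 : y ∈ B <;> by_cases h2 : y + w ∈ B <;> simp [Set.indicator, h1, h2]
        simp only [e1]
        by_cases hw : w ∈ Metric.ball (0 : Eu N) (2 * ρ)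
        · rw [Set.indicator_of_mem hw]
          refine (lintegral_translation_sq_le hf (hS w) ho.measurableSet w
            fun x hx t ht => hB ?_).trans ?_
          · have := (convex_ball x₀ ρ).add_smul_sub_mem hx.1 hx.2 ⟨ht.1.le, ht.2⟩
            rwa [add_sub_cancel_left] at this
          · gcongr
            rw [← ofReal_norm]
            exact ENNReal.ofReal_le_ofReal (mem_ball_zero_iff.1 hw).le
        · have : {y | y ∈ B ∧ y + w ∈ B} = ∅ := by
            rw [Set.eq_empty_iff_forall_notMem]
            rintro y ⟨h1, h2⟩
            apply hw
            rw [mem_ball_zero_iff]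
            rw [hBdef, Metric.mem_ball, dist_eq_norm] at h1 h2
            calc ‖w‖ = ‖(y + w - x₀) - (y - x₀)‖ := by congr 1; abel
              _ ≤ ‖y + w - x₀‖ + ‖y - x₀‖ := norm_sub_le _ _
              _ < 2 * ρ := by linarith
          rw [this]
          simp
    _ = _ := by rw [lintegral_const, Measure.restrict_apply_univ, mul_comm]

/-- The Poincaré inequality for smooth functions. The constant `c` is a value of `f` in a ball inside
the domain, chosen so that the oscillation of `f` about it does not exceed the average. -/
theorem IsBoundedLipschitzDomain.exists_poincare_smooth (hΩ : IsBoundedLipschitzDomain Ω) :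
    ∃ C : ℝ≥0∞, C ≠ ⊤ ∧ ∀ f : Eu N → ℝ, ContDiff ℝ ∞ f → ∃ c : ℝ,
      ∫⁻ x in Ω, ‖f x - c‖ₑ ^ 2 ≤ C * ∫⁻ x in Ω, ‖gradient f x‖ₑ ^ 2 := by
  obtain ⟨x₀, hx₀⟩ := hΩ.isConnected.nonempty
  obtain ⟨ρ, hρ, hB⟩ := Metric.isOpen_iff.1 hΩ.isOpen x₀ hx₀
  obtain ⟨C, hC, h⟩ := hΩ.controlledBy hρ hx₀
  set V := volume (Metric.ball x₀ ρ) with hV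
  have hV0 : V ≠ 0 := (Metric.measure_ball_pos volume x₀ hρ).ne'
  have hVt : V ≠ ⊤ := measure_ball_lt_top.ne
  have hWt : volume (Metric.ball (0 : Eu N) (2 * ρ)) ≠ ⊤ := measure_ball_lt_top.ne
  set D := volume (Metric.ball (0 : Eu N) (2 * ρ)) * ENNReal.ofReal (2 * ρ) ^ 2 with hD
  refine ⟨C * (1 + D / V), ENNReal.mul_ne_top hC (ENNReal.add_ne_top.2 ⟨by simp,
    ENNReal.div_ne_top (by finiteness) hV0⟩), fun f hf => ?_⟩
  have hfm : Measurable f := hf.continuous.measurable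
  have hm2 : Measurable fun p : Eu N × Eu N => ‖f p.2 - f p.1‖ₑ ^ 2 := by fun_prop
  obtain ⟨y, -, hy⟩ := exists_le_setLAverage (μ := volume) hV0 hVt
    (hm2.lintegral_prod_right' (ν := volume.restrict (Metric.ball x₀ ρ))).aemeasurable
  refine ⟨f y, ?_⟩
  have h1 := h f hf (f y)
  rw [Set.inter_eq_self_of_subset_right subset_closure] at h1
  refine h1.trans ?_
  rw [mul_assoc]
  gcongr
  rw [add_mul, one_mul]
  gcongr
  refine hy.trans ?_
  rw [setLAverage_eq, ENNReal.div_eq_inv_mul, ENNReal.div_eq_inv_mul, mul_assoc]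
  gcongr
  refine (lintegral_lintegral_sub_sq_le hΩ.isOpen hf hB).trans_eq ?_
  rw [hD, mul_assoc]

/-- The boundary function `1`. -/
noncomputable def oneS (Ω : Set (Eu N)) [IsFiniteMeasure (surface Ω)] : Lp ℝ 2 (surface Ω) :=
  (memLp_const (1 : ℝ)).toLp

theorem oneS_ae [IsFiniteMeasure (surface Ω)] : oneS Ω =ᵐ[surface Ω] fun _ => (1 : ℝ) :=
  (memLp_const (1 : ℝ)).coeFn_toLp

theorem integral_eq_inner_oneS [IsFiniteMeasure (surface Ω)] (h : Lp ℝ 2 (surface Ω)) :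
    ∫ x, h x ∂(surface Ω) = inner ℝ (oneS Ω) h := by
  rw [L2.inner_def]
  refine integral_congr_ae ?_
  filter_upwards [oneS_ae (Ω := Ω)] with x hx
  rw [hx]
  simp

theorem oneW_oneS_mem [IsFiniteMeasure (surface Ω)] (hb : Bornology.IsBounded Ω) :
    (oneW hb, oneS Ω) ∈ traceGraph Ω :=
  subset_closure ⟨fun _ => 1, contDiff_const, oneW_fn hb, oneS_ae⟩

/-- The Poincaré inequality with the mean over the boundary: by the trace inequality, the boundary
mean determines the constant in `exists_poincare_smooth` up to a multiple of the gradient. -/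
theorem IsBoundedLipschitzDomain.exists_poincare (hN : 1 ≤ N) (hΩ : IsBoundedLipschitzDomain Ω) :
    ∃ C : ℝ, 0 ≤ C ∧ ∀ p ∈ traceGraph Ω,
      ‖p.1‖ ≤ C * (‖p.1.grad‖ + |∫ x, p.2 x ∂(surface Ω)|) := by
  have hfin := hΩ.isFiniteMeasure_surface hN
  obtain ⟨T, hT0, hT⟩ := exists_norm_trace_le hN hΩ
  obtain ⟨C, hC, h⟩ := hΩ.exists_poincare_smooth
  lift C to ℝ≥0 using hC
  set D : ℝ := NNReal.sqrt C + 1 with hD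
  have hD1 : 1 ≤ D := by simp [hD]
  have hS : 0 < inner ℝ (oneS Ω) (oneS Ω) := by
    rw [← integral_eq_inner_oneS, integral_congr_ae oneS_ae, integral_const, smul_eq_mul, mul_one]
    exact ENNReal.toReal_pos (hΩ.surface_pos hN).ne' (by finiteness)
  set s := inner ℝ (oneS Ω) (oneS Ω) with hs
  set b := ‖oneW hΩ.isBounded‖ with hb
  set o := ‖oneS Ω‖ with ho
  have hb0 : 0 ≤ b := norm_nonneg _
  have ho0 : 0 ≤ o := norm_nonneg _
  refine ⟨D + (o * (T * D) + 1) / s * b, by positivity, fun p hp => ?_⟩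
  rw [integral_eq_inner_oneS]
  refine traceGraph_induction hΩ (P := fun p => ‖p.1‖ ≤ (D + (o * (T * D) + 1) / s * b) *
    (‖p.1.grad‖ + |inner ℝ (oneS Ω) p.2|)) ?_ (fun f hf k hk => ?_) hp
  · refine isClosed_le (by fun_prop) ?_
    have := (gradL Ω).continuous
    exact continuous_const.mul (((this.comp continuous_fst).norm).add
      ((continuous_const.inner continuous_snd).abs))
  · dsimp only
    set u := ofSmooth hΩ.isBounded hf with hu
    obtain ⟨c, hc⟩ := h f hf
    have hq : (u - c • oneW hΩ.isBounded, k - c • oneS Ω) ∈ traceGraph Ω := by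
      have h1 : (u, k) ∈ traceGraph Ω :=
        (smoothTraceGraph Ω).le_topologicalClosure ⟨f, hf, ofSmooth_fn _ hf, hk⟩
      have h2 := (traceGraph Ω).sub_mem h1
        ((traceGraph Ω).smul_mem c (oneW_oneS_mem hΩ.isBounded))
      rwa [Prod.smul_mk, Prod.mk_sub_mk] at h2
    set q := u - c • oneW hΩ.isBounded with hqdef
    have hqg : q.grad = u.grad := by
      have : gradL Ω q = gradL Ω u - c • gradL Ω (oneW hΩ.isBounded) := by
        rw [hqdef, map_sub, map_smul]
      simpa [gradL_apply, oneW_grad] using this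
    have hqf : ‖q.fn‖ ≤ NNReal.sqrt C * ‖u.grad‖ := by
      refine norm_le_of_enorm_sq_le ?_
      have : q.fn =ᵐ[volume.restrict Ω] fun x => f x - c := by
        have e1 : q.fn = u.fn - c • (oneW hΩ.isBounded).fn := by
          have : fnL Ω q = fnL Ω u - c • fnL Ω (oneW hΩ.isBounded) := by
            rw [hqdef, map_sub, map_smul]
          simpa [fnL_apply] using this
        rw [e1]
        filter_upwards [Lp.coeFn_sub u.fn (c • (oneW hΩ.isBounded).fn),
          Lp.coeFn_smul c (oneW hΩ.isBounded).fn, ofSmooth_fn hΩ.isBounded hf,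
          oneW_fn hΩ.isBounded] with x h1 h2 h3 h4
        rw [h1, Pi.sub_apply, h2, Pi.smul_apply, h3, h4]
        simp
      rw [enorm_sq_Lp_of_ae this, enorm_sq_Lp_of_ae (ofSmooth_grad hΩ.isBounded hf),
        ← ENNReal.coe_pow, NNReal.sq_sqrt]
      exact hc
    have hqn : ‖q‖ ≤ D * ‖u.grad‖ := by
      refine (norm_W12_le q).trans ?_
      rw [hqg, hD, add_mul, one_mul]
      gcongr
    have hk2 : ‖k - c • oneS Ω‖ ≤ T * (D * ‖u.grad‖) :=
      (hT _ hq).trans (by gcongr)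
    have hcb : |c| * s ≤ o * (T * (D * ‖u.grad‖)) + |inner ℝ (oneS Ω) k| := by
      have e1 : c * s = inner ℝ (oneS Ω) k - inner ℝ (oneS Ω) (k - c • oneS Ω) := by
        rw [inner_sub_right, inner_smul_right]
        ring
      rw [← abs_of_pos hS, ← abs_mul, e1]
      refine (abs_sub _ _).trans ?_
      rw [add_comm]
      gcongr
      exact (abs_real_inner_le_norm _ _).trans (by gcongr)
    have hu2 : ‖u‖ ≤ D * ‖u.grad‖ + |c| * b := by
      have : u = q + c • oneW hΩ.isBounded := by rw [hqdef]; abel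
      calc ‖u‖ ≤ ‖q‖ + ‖c • oneW hΩ.isBounded‖ := by
            conv_lhs => rw [this]
            exact norm_add_le _ _
        _ ≤ _ := by
          rw [norm_smul, Real.norm_eq_abs]
          gcongr
    have hcb2 : |c| ≤ (o * (T * (D * ‖u.grad‖)) + |inner ℝ (oneS Ω) k|) / s := by
      rwa [le_div_iff₀ hS]
    set g := ‖u.grad‖ with hg
    have hg0 : 0 ≤ g := norm_nonneg _
    set m := |inner ℝ (oneS Ω) k| with hm
    have hm0 : 0 ≤ m := abs_nonneg _
    calc ‖u‖ ≤ D * g + (o * (T * (D * g)) + m) / s * b := hu2.trans (by gcongr)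
      _ ≤ D * (g + m) + ((o * (T * D) + 1) * (g + m)) / s * b := by
        have : o * (T * (D * g)) + m ≤ (o * (T * D) + 1) * (g + m) := by
          have : 0 ≤ o * (T * D) := by positivity
          nlinarith
        gcongr
        linarith
      _ = _ := by ring

/-! ### The trace space -/

theorem W12half.toL2_injective : Function.Injective (W12half.toL2 (Ω := Ω)) :=
  Submodule.subtype_injective _

theorem W12half.exists_isTrace (h : W12half Ω) : ∃ u : W12 Ω, IsTrace u h := IsTraceAux.exists h

theorem exists_isTrace_of_mem {p : W12 Ω × Lp ℝ 2 (surface Ω)} (hp : p ∈ traceGraph Ω) :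
    ∃ h : W12half Ω, h.toL2 = p.2 ∧ IsTrace p.1 h :=
  ⟨(⟨p.2, p, hp, rfl⟩ : traceSubmodule Ω), rfl, hp⟩

namespace IsTrace

variable {u v : W12 Ω} {h k : W12half Ω}

theorem add (hu : IsTrace u h) (hv : IsTrace v k) : IsTrace (u + v) (h + k) :=
  (traceGraph Ω).add_mem hu hv

theorem sub (hu : IsTrace u h) (hv : IsTrace v k) : IsTrace (u - v) (h - k) :=
  (traceGraph Ω).sub_mem hu hv

theorem smul (c : ℝ) (hu : IsTrace u h) : IsTrace (c • u) (c • h) :=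
  (traceGraph Ω).smul_mem c hu

theorem norm_le (hu : IsTrace u h) : ‖h‖ ≤ ‖u‖ := traceNorm_le hu

end IsTrace

theorem isTrace_zero_iff (hN : 1 ≤ N) (hΩ : IsBoundedLipschitzDomain Ω) {u : W12 Ω} :
    IsTrace u 0 ↔ u ∈ W120S Ω := by
  rw [IsTrace, map_zero]
  exact ⟨mem_W120S_of_zero_trace hN hΩ, zero_trace_of_mem_W120S hΩ⟩

theorem IsTrace.unique (hN : 1 ≤ N) (hΩ : IsBoundedLipschitzDomain Ω) {u : W12 Ω} {h k : W12half Ω}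
    (hu : IsTrace u h) (hk : IsTrace u k) : h = k := by
  obtain ⟨C, -, hC⟩ := exists_norm_trace_le hN hΩ
  have h1 : IsTrace (u - u) (h - k) := hu.sub hk
  have h2 := hC _ h1
  rw [sub_self, norm_zero, mul_zero, map_sub] at h2
  exact W12half.toL2_injective (sub_eq_zero.1 (norm_le_zero_iff.1 h2))

theorem IsTrace.sub_mem (hN : 1 ≤ N) (hΩ : IsBoundedLipschitzDomain Ω) {u v : W12 Ω} {h : W12half Ω}
    (hu : IsTrace u h) (hv : IsTrace v h) : u - v ∈ W120S Ω := by
  have := hu.sub hv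
  rwa [sub_self, isTrace_zero_iff hN hΩ] at this

theorem IsTrace.of_sub_mem (hΩ : IsBoundedLipschitzDomain Ω) {u v : W12 Ω}
    {h : W12half Ω} (hv : IsTrace v h) (huv : u - v ∈ W120S Ω) : IsTrace u h := by
  have h1 : IsTrace (u - v) 0 := by
    rw [IsTrace, map_zero]
    exact zero_trace_of_mem_W120S hΩ huv
  simpa using h1.add hv

/-- The space of the Sobolev functions which have a trace. -/
noncomputable def traceDomain (Ω : Set (Eu N)) : Submodule ℝ (W12 Ω) :=
  (traceGraph Ω).map (LinearMap.fst ℝ (W12 Ω) (Lp ℝ 2 (surface Ω)))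

theorem mem_traceDomain {u : W12 Ω} : u ∈ traceDomain Ω ↔ ∃ h : W12half Ω, IsTrace u h := by
  constructor
  · rintro ⟨p, hp, rfl⟩
    obtain ⟨h, -, hh⟩ := exists_isTrace_of_mem hp
    exact ⟨h, hh⟩
  · rintro ⟨h, hh⟩
    exact ⟨_, hh, rfl⟩

theorem W120S_le_traceDomain (hΩ : IsBoundedLipschitzDomain Ω) : W120S Ω ≤ traceDomain Ω :=
  fun _ hu => ⟨_, zero_trace_of_mem_W120S hΩ hu, rfl⟩

/-- The trace graph is complete, and by the trace inequality its projection to `W^{1,2}` is bounded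
from below. -/
theorem isClosed_traceDomain (hN : 1 ≤ N) (hΩ : IsBoundedLipschitzDomain Ω) :
    IsClosed (traceDomain Ω : Set (W12 Ω)) := by
  obtain ⟨C, hC0, hC⟩ := exists_norm_trace_le hN hΩ
  have hcomp : CompleteSpace (traceGraph Ω) :=
    (Submodule.isClosed_topologicalClosure _).completeSpace_coe
  let T : traceGraph Ω →ₗ[ℝ] W12 Ω := (LinearMap.fst ℝ _ _).comp (traceGraph Ω).subtype
  have hT : ∀ p, T p = p.1.1 := fun _ => rfl
  have hanti : AntilipschitzWith (max 1 C.toNNReal) T := by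
    refine AddMonoidHomClass.antilipschitz_of_bound T fun p => ?_
    have h1 := hC _ p.2
    rw [hT, NNReal.coe_max, NNReal.coe_one, Real.coe_toNNReal _ hC0]
    change max ‖p.1.1‖ ‖p.1.2‖ ≤ _
    rw [max_mul_of_nonneg _ _ (norm_nonneg _), one_mul]
    exact max_le_max le_rfl h1
  have hcont : UniformContinuous T :=
    uniformContinuous_fst.comp uniformContinuous_subtype_val
  have := hanti.isClosed_range hcont
  have hr : (traceDomain Ω : Set (W12 Ω)) = Set.range T := by
    refine Set.ext fun u => ⟨?_, ?_⟩
    · rintro ⟨p, hp, rfl⟩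
      exact ⟨⟨p, hp⟩, rfl⟩
    · rintro ⟨p, rfl⟩
      exact ⟨p.1, p.2, rfl⟩
  rwa [hr]

/-- The boundary datum which is constant equal to `1` is the trace of the constant function. -/
theorem isTrace_oneW (hN : 1 ≤ N) (hΩ : IsBoundedLipschitzDomain Ω) {h : W12half Ω}
    (hh : h.toL2 =ᵐ[surface Ω] fun _ => (1 : ℝ)) : IsTrace (oneW hΩ.isBounded) h := by
  have := hΩ.isFiniteMeasure_surface hN
  have h1 : h.toL2 = oneS Ω := Lp.ext (hh.trans oneS_ae.symm)
  rw [IsTrace, h1]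
  exact oneW_oneS_mem hΩ.isBounded

/-- The Hilbert space complement of `W^{1,2}_0`: the component of a function which is determined by
its trace. -/
noncomputable def traceProj (Ω : Set (Eu N)) : W12 Ω →L[ℝ] W12 Ω :=
  haveI : CompleteSpace (W120S Ω) := isClosed_W120S.completeSpace_coe
  (W120S Ω)ᗮ.starProjection

theorem traceProj_eq_zero {u : W12 Ω} (hu : u ∈ W120S Ω) : traceProj Ω u = 0 := by
  have : CompleteSpace (W120S Ω) := isClosed_W120S.completeSpace_coe
  rw [traceProj, Submodule.starProjection_apply_eq_zero_iff]
  rwa [Submodule.orthogonal_orthogonal]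

theorem norm_traceProj_le (u : W12 Ω) : ‖traceProj Ω u‖ ≤ ‖u‖ := by
  have : CompleteSpace (W120S Ω) := isClosed_W120S.completeSpace_coe
  exact Submodule.norm_starProjection_apply_le _ _

theorem traceProj_sub_mem (u : W12 Ω) : traceProj Ω u - u ∈ W120S Ω := by
  have : CompleteSpace (W120S Ω) := isClosed_W120S.completeSpace_coe
  have h := Submodule.starProjection_add_starProjection_orthogonal (K := W120S Ω) u
  have : traceProj Ω u - u = - (W120S Ω).starProjection u := by
    rw [traceProj]
    nth_rewrite 2 [← h]
    abel
  rw [this]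
  exact neg_mem (Submodule.starProjection_apply_mem _ _)

theorem IsTrace.traceProj_eq (hN : 1 ≤ N) (hΩ : IsBoundedLipschitzDomain Ω) {u v : W12 Ω}
    {h : W12half Ω} (hu : IsTrace u h) (hv : IsTrace v h) : traceProj Ω u = traceProj Ω v := by
  rw [← sub_eq_zero, ← map_sub]
  exact traceProj_eq_zero (hu.sub_mem hN hΩ hv)

/-- The norm of a trace is the norm of the extension orthogonal to `W^{1,2}_0`. -/
theorem IsTrace.norm_eq (hN : 1 ≤ N) (hΩ : IsBoundedLipschitzDomain Ω) {u : W12 Ω} {h : W12half Ω}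
    (hu : IsTrace u h) : ‖h‖ = ‖traceProj Ω u‖ := by
  refine le_antisymm ((hu.of_sub_mem hΩ (traceProj_sub_mem u)).norm_le) (le_traceNorm fun v hv => ?_)
  rw [hu.traceProj_eq hN hΩ hv]
  exact norm_traceProj_le v

/-- The extension operator of minimal norm. -/
theorem exists_extension (hN : 1 ≤ N) (hΩ : IsBoundedLipschitzDomain Ω) :
    ∃ E : W12half Ω →L[ℝ] W12 Ω, ∀ h, IsTrace (E h) h := by
  choose e he using W12half.exists_isTrace (Ω := Ω)
  let E : W12half Ω →ₗ[ℝ] W12 Ω :=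
    { toFun := fun h => traceProj Ω (e h)
      map_add' := fun h k => by
        rw [← map_add]
        exact (he _).traceProj_eq hN hΩ ((he h).add (he k))
      map_smul' := fun c h => by
        rw [RingHom.id_apply, ← map_smul]
        exact (he _).traceProj_eq hN hΩ ((he h).smul c) }
  refine ⟨E.mkContinuous 1 fun h => ?_, fun h => (he h).of_sub_mem hΩ (traceProj_sub_mem _)⟩
  rw [one_mul]
  exact ((he h).norm_eq hN hΩ).ge

/-- The trace operator, extended by zero to the complement of its domain. -/
theorem exists_trace (hN : 1 ≤ N) (hΩ : IsBoundedLipschitzDomain Ω) :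
    ∃ T : W12 Ω →L[ℝ] W12half Ω, ∀ u h, IsTrace u h → T u = h := by
  have : CompleteSpace (traceDomain Ω) := (isClosed_traceDomain hN hΩ).completeSpace_coe
  set P := (traceDomain Ω).starProjection with hP
  have hex : ∀ u : W12 Ω, ∃ h : W12half Ω, IsTrace (P u) h := fun u =>
    mem_traceDomain.1 (Submodule.starProjection_apply_mem _ _)
  choose t ht using hex
  let T : W12 Ω →ₗ[ℝ] W12half Ω :=
    { toFun := t
      map_add' := fun u v => by
        have := (ht u).add (ht v)
        rw [← map_add] at this
        exact (ht _).unique hN hΩ this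
      map_smul' := fun c u => by
        have := (ht u).smul c
        rw [← map_smul] at this
        exact (ht _).unique hN hΩ this }
  refine ⟨T.mkContinuous 1 fun u => ?_, fun u h hu => ?_⟩
  · rw [one_mul]
    exact (ht u).norm_le.trans (Submodule.norm_starProjection_apply_le _ _)
  · have h1 := ht u
    have h2 : P u = u :=
      Submodule.starProjection_eq_self_iff.2 (mem_traceDomain.2 ⟨h, hu⟩)
    rw [h2] at h1
    exact h1.unique hN hΩ hu

/-- The space of the Sobolev functions with a trace of mean zero. -/
def traceDomainStar (Ω : Set (Eu N)) : Submodule ℝ (W12 Ω) where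
  carrier := {u | ∃ h ∈ W12halfStar Ω, IsTrace u h}
  zero_mem' := ⟨0, zero_mem _, IsTraceAux.zero⟩
  add_mem' := by
    rintro u v ⟨h, hh, hu⟩ ⟨k, hk, hv⟩
    exact ⟨h + k, add_mem hh hk, hu.add hv⟩
  smul_mem' := by
    rintro c u ⟨h, hh, hu⟩
    exact ⟨c • h, Submodule.smul_mem _ c hh, hu.smul c⟩

theorem mem_W12halfStar [IsFiniteMeasure (surface Ω)] {h : W12half Ω} :
    h ∈ W12halfStar Ω ↔ inner ℝ (oneS Ω) h.toL2 = 0 := by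
  rw [← integral_eq_inner_oneS]
  exact ⟨fun h => h.2, fun h' => ⟨(Lp.memLp _).integrable one_le_two, h'⟩⟩

theorem exists_norm_toL2_le (hN : 1 ≤ N) (hΩ : IsBoundedLipschitzDomain Ω) :
    ∃ C : ℝ, 0 ≤ C ∧ ∀ h : W12half Ω, ‖h.toL2‖ ≤ C * ‖h‖ := by
  obtain ⟨C, hC0, hC⟩ := exists_norm_trace_le hN hΩ
  refine ⟨C, hC0, fun h => ?_⟩
  obtain ⟨u, hu⟩ := h.exists_isTrace
  have hv : IsTrace (traceProj Ω u) h := hu.of_sub_mem hΩ (traceProj_sub_mem u)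
  have h1 : ‖h.toL2‖ ≤ C * ‖traceProj Ω u‖ := hC (traceProj Ω u, h.toL2) hv
  have h2 : ‖h‖ = ‖traceProj Ω u‖ := hu.norm_eq hN hΩ
  exact h1.trans_eq (congrArg (C * ·) h2.symm)

theorem isClosed_traceDomainStar (hN : 1 ≤ N) (hΩ : IsBoundedLipschitzDomain Ω) :
    IsClosed (traceDomainStar Ω : Set (W12 Ω)) := by
  have := hΩ.isFiniteMeasure_surface hN
  obtain ⟨T, hT⟩ := exists_trace hN hΩ
  obtain ⟨C, hC0, hC⟩ := exists_norm_toL2_le hN hΩ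
  have hJ : Continuous (W12half.toL2 (Ω := Ω)) :=
    AddMonoidHomClass.continuous_of_bound (W12half.toL2 (Ω := Ω)) C hC
  have h1 : (traceDomainStar Ω : Set (W12 Ω)) =
      (traceDomain Ω : Set (W12 Ω)) ∩ {u | inner ℝ (oneS Ω) (T u).toL2 = 0} := by
    ext u
    constructor
    · rintro ⟨h, hh, hu⟩
      refine ⟨mem_traceDomain.2 ⟨h, hu⟩, ?_⟩
      rw [Set.mem_ofPred_eq, hT u h hu]
      exact mem_W12halfStar.1 hh
    · rintro ⟨h1, h2⟩
      obtain ⟨h, hu⟩ := mem_traceDomain.1 h1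
      rw [Set.mem_ofPred_eq, hT u h hu] at h2
      exact ⟨h, mem_W12halfStar.2 h2, hu⟩
  rw [h1]
  exact (isClosed_traceDomain hN hΩ).inter
    (isClosed_eq (continuous_const.inner (hJ.comp T.continuous)) continuous_const)

/-- The Poincaré inequality for functions with trace of mean zero. -/
theorem exists_poincare_star (hN : 1 ≤ N) (hΩ : IsBoundedLipschitzDomain Ω) :
    ∃ C : ℝ, 0 ≤ C ∧ ∀ u ∈ traceDomainStar Ω, ‖u‖ ≤ C * ‖u.grad‖ := by
  obtain ⟨C, hC0, hC⟩ := hΩ.exists_poincare hN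
  refine ⟨C, hC0, ?_⟩
  rintro u ⟨h, hh, hu⟩
  have := hC _ hu
  dsimp only at this
  rwa [hh.2, abs_zero, add_zero] at this

/-- The Poincaré inequality on `W^{1,2}_0`. -/
theorem exists_poincare_W120S (hN : 1 ≤ N) (hΩ : IsBoundedLipschitzDomain Ω) :
    ∃ C : ℝ, 0 ≤ C ∧ ∀ u ∈ W120S Ω, ‖u‖ ≤ C * ‖u.grad‖ := by
  obtain ⟨C, hC0, hC⟩ := exists_friedrichs hN hΩ.isOpen hΩ.isBounded
  refine ⟨C + 1, by positivity, fun u hu => (norm_W12_le u).trans ?_⟩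
  rw [add_mul, one_mul]
  gcongr
  exact hC u hu

/-- Subtracting a constant gives trace of mean zero. -/
theorem exists_sub_oneW_mem (hN : 1 ≤ N) (hΩ : IsBoundedLipschitzDomain Ω) {u : W12 Ω}
    (hu : u ∈ traceDomain Ω) : ∃ c : ℝ, u - c • oneW hΩ.isBounded ∈ traceDomainStar Ω := by
  have := hΩ.isFiniteMeasure_surface hN
  have hS : inner ℝ (oneS Ω) (oneS Ω) ≠ 0 := by
    rw [← integral_eq_inner_oneS, integral_congr_ae oneS_ae, integral_const, smul_eq_mul, mul_one]
    exact (ENNReal.toReal_pos (hΩ.surface_pos hN).ne' (by finiteness)).ne'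
  obtain ⟨h, hu⟩ := mem_traceDomain.1 hu
  obtain ⟨k, hk, hk1⟩ := exists_isTrace_of_mem (oneW_oneS_mem hΩ.isBounded)
  set c := inner ℝ (oneS Ω) h.toL2 / inner ℝ (oneS Ω) (oneS Ω) with hc
  refine ⟨c, h - c • k, mem_W12halfStar.2 ?_, hu.sub (hk1.smul c)⟩
  rw [map_sub, map_smul, hk, inner_sub_right, inner_smul_right, hc, div_mul_cancel₀ _ hS, sub_self]

/-! ### Matrix fields as multiplication operators -/

/-- The action of a matrix on the Euclidean space. -/
noncomputable def clmM (M : Mat N) : Eu N →L[ℝ] Eu N := Matrix.toEuclideanCLM (𝕜 := ℝ) M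

theorem ofLp_clmM (M : Mat N) (v : Eu N) : (clmM M v).ofLp = M *ᵥ v.ofLp :=
  Matrix.ofLp_toEuclideanCLM M v

theorem inner_clmM (M : Mat N) (v w : Eu N) :
    inner ℝ (clmM M v) w = (M *ᵥ v.ofLp) ⬝ᵥ w.ofLp := by
  rw [inner_Eu_eq, ofLp_clmM]

theorem inner_clmM_symm {M : Mat N} (hM : M.IsSymm) (v w : Eu N) :
    inner ℝ (clmM M v) w = inner ℝ v (clmM M w) := by
  rw [inner_clmM, inner_Eu_eq, ofLp_clmM, Matrix.dotProduct_mulVec, ← Matrix.mulVec_transpose, hM.eq]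

section Elliptic

variable {α β : ℝ} {M : Mat N}

theorem Elliptic.le_inner (h : Elliptic α β M) (v : Eu N) :
    α * ‖v‖ ^ 2 ≤ inner ℝ (clmM M v) v := by
  rw [inner_clmM, ← real_inner_self_eq_norm_sq, inner_Eu_eq]
  exact h.1 v.ofLp

theorem Elliptic.isUnit_det (h : Elliptic α β M) (hα : 0 < α) : IsUnit M.det := by
  rw [← Matrix.isUnit_iff_isUnit_det, ← Matrix.mulVec_injective_iff_isUnit]
  intro v w hvw
  have h1 := h.le_inner (WithLp.toLp 2 (v - w))
  rw [inner_clmM] at h1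
  have h2 : M *ᵥ (v - w) = 0 := by rw [Matrix.mulVec_sub, sub_eq_zero]; exact hvw
  rw [h2, zero_dotProduct] at h1
  have h3 : ‖(WithLp.toLp 2 (v - w) : Eu N)‖ ^ 2 ≤ 0 := by
    by_contra! h'
    nlinarith
  have h4 : (WithLp.toLp 2 (v - w) : Eu N) = 0 := by
    rw [← norm_le_zero_iff]
    nlinarith [norm_nonneg (WithLp.toLp 2 (v - w) : Eu N)]
  have h5 := congrArg WithLp.ofLp h4
  exact sub_eq_zero.1 h5

/-- The bound for the inverse turns into an upper bound for the matrix. -/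
theorem Elliptic.norm_sq_le (h : Elliptic α β M) (hα : 0 < α) (hβ : 0 < β) (v : Eu N) :
    ‖clmM M v‖ ^ 2 ≤ β * inner ℝ (clmM M v) v := by
  have h1 := h.2 (M *ᵥ v.ofLp)
  rw [Matrix.mulVec_mulVec, Matrix.nonsing_inv_mul _ (h.isUnit_det hα), Matrix.one_mulVec,
    ← ofLp_clmM, ← inner_Eu_eq, ← inner_Eu_eq, real_inner_self_eq_norm_sq, real_inner_comm,
    inv_mul_le_iff₀ hβ] at h1
  exact h1

theorem Elliptic.norm_le (h : Elliptic α β M) (hα : 0 < α) (hβ : 0 < β) (v : Eu N) :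
    ‖clmM M v‖ ≤ β * ‖v‖ := by
  have h1 := h.norm_sq_le hα hβ v
  have h2 := real_inner_le_norm (clmM M v) v
  rcases (norm_nonneg (clmM M v)).eq_or_lt with h0 | h0
  · rw [← h0]
    positivity
  · have h3 : ‖clmM M v‖ * ‖clmM M v‖ ≤ ‖clmM M v‖ * (β * ‖v‖) := by nlinarith
    exact le_of_mul_le_mul_left h3 h0

end Elliptic

section HalfPow

variable {α β : ℝ} {M : Mat N}

theorem halfPow_two (M : Mat N) : halfPow 2 M = M := if_neg (by norm_num)

theorem halfPow_one (M : Mat N) : halfPow 1 M = cfc Real.sqrt M := if_pos rfl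

theorem spectrum_subset (h : Elliptic α β M) (hα : 0 < α) (hβ : 0 < β) :
    spectrum ℝ M ⊆ Set.Icc 0 β := by
  intro t ht
  rw [← Matrix.spectrum_toLpLin 2, ← Module.End.hasEigenvalue_iff_mem_spectrum] at ht
  obtain ⟨v, hv⟩ := ht.exists_hasEigenvector
  have h0 : 0 < ‖v‖ := norm_pos_iff.2 hv.2
  have h1 : clmM M v = t • v := hv.apply_eq_smul
  have h2 := h.le_inner v
  have h3 := h.norm_sq_le hα hβ v
  rw [h1, real_inner_smul_left, real_inner_self_eq_norm_sq] at h2 h3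
  rw [norm_smul, mul_pow, Real.norm_eq_abs, sq_abs] at h3
  have h4 : 0 < ‖v‖ ^ 2 := by positivity
  have h5 : α ≤ t := le_of_mul_le_mul_right h2 h4
  have h6 : t ^ 2 ≤ β * t := le_of_mul_le_mul_right (by linarith) h4
  exact ⟨by linarith, by nlinarith⟩

theorem halfPow_one_mul_self (h : Elliptic α β M) (hα : 0 < α) (hβ : 0 < β) (hM : M.IsSymm) :
    halfPow 1 M * halfPow 1 M = M := by
  have hsa : IsSelfAdjoint M := by
    rw [isSelfAdjoint_iff, Matrix.star_eq_conjTranspose,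
      Matrix.conjTranspose_eq_transpose_of_trivial, hM.eq]
  rw [halfPow_one, ← cfc_mul Real.sqrt Real.sqrt M (by fun_prop) (by fun_prop)]
  conv_rhs => rw [← cfc_id ℝ M]
  refine cfc_congr fun t ht => ?_
  exact Real.mul_self_sqrt (spectrum_subset h hα hβ ht).1

theorem halfPow_one_isSymm (M : Mat N) : (halfPow 1 M).IsSymm := by
  have h : IsSelfAdjoint (cfc Real.sqrt M) := cfc_predicate Real.sqrt M
  rw [halfPow_one, Matrix.IsSymm, ← Matrix.conjTranspose_eq_transpose_of_trivial]
  exact h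

/-- The square root turns the quadratic form into a norm. -/
theorem norm_sq_halfPow_one (h : Elliptic α β M) (hα : 0 < α) (hβ : 0 < β) (hM : M.IsSymm)
    (v : Eu N) : ‖clmM (halfPow 1 M) v‖ ^ 2 = inner ℝ (clmM M v) v := by
  rw [← real_inner_self_eq_norm_sq, ← inner_clmM_symm (halfPow_one_isSymm M)]
  congr 1
  conv_rhs => rw [← halfPow_one_mul_self h hα hβ hM]
  rw [clmM, clmM, map_mul]
  rfl

theorem norm_halfPow_one_le (h : Elliptic α β M) (hα : 0 < α) (hβ : 0 < β) (hM : M.IsSymm)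
    (v : Eu N) : ‖clmM (halfPow 1 M) v‖ ≤ √β * ‖v‖ := by
  refine le_of_sq_le_sq ?_ (by positivity)
  rw [norm_sq_halfPow_one h hα hβ hM, mul_pow, Real.sq_sqrt hβ.le]
  have h1 := real_inner_le_norm (clmM M v) v
  have h2 := h.norm_le hα hβ v
  have := norm_nonneg v
  nlinarith

/-- The square root is a limit of polynomials which depend only on the ellipticity constants. -/
theorem exists_polynomial_tendsto_halfPow (hα : 0 < α) (hβ : 0 < β) :
    ∃ q : ℕ → Polynomial ℝ, ∀ M : Mat N, Elliptic α β M → M.IsSymm →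
      Tendsto (fun n => Polynomial.aeval M (q n)) atTop (𝓝 (halfPow 1 M)) := by
  choose q hq using fun n : ℕ => exists_polynomial_near_of_continuousOn 0 β Real.sqrt
    Real.continuous_sqrt.continuousOn (1 / ((n : ℝ) + 1)) (by positivity)
  refine ⟨q, fun M h hM => ?_⟩
  have hsa : IsSelfAdjoint M := by
    rw [isSelfAdjoint_iff, Matrix.star_eq_conjTranspose,
      Matrix.conjTranspose_eq_transpose_of_trivial, hM.eq]
  have h1 : ∀ n, Polynomial.aeval M (q n) = cfc (fun t => (q n).eval t) M := fun n =>
    (cfc_polynomial (q n) M hsa).symm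
  simp only [h1, halfPow_one]
  refine tendsto_cfc_fun ?_ (Eventually.of_forall fun n => (q n).continuous.continuousOn)
  rw [Metric.tendstoUniformlyOn_iff]
  intro ε hε
  filter_upwards [(tendsto_order.1 tendsto_one_div_add_atTop_nhds_zero_nat).2 ε hε] with n hn t ht
  rw [dist_comm, Real.dist_eq]
  exact (hq n t (spectrum_subset h hα hβ ht)).trans hn

end HalfPow

/-- A bounded measurable matrix field. -/
def IsCoef (Ω : Set (Eu N)) (A : Eu N → Mat N) : Prop :=
  MemLp (fun x => clmM (A x)) ⊤ (volume.restrict Ω)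

theorem aestronglyMeasurable_clmM {A : Eu N → Mat N} {μ : Measure (Eu N)}
    (hm : ∀ i j, AEMeasurable (fun x => A x i j) μ) :
    AEStronglyMeasurable (fun x => clmM (A x)) μ := by
  have h1 : (fun x => clmM (A x)) = fun x => ∑ i, ∑ j, A x i j • clmM (Matrix.single i j 1) := by
    ext1 x
    conv_lhs => rw [Matrix.matrix_eq_sum_single (A x)]
    simp only [clmM, map_sum]
    refine Finset.sum_congr rfl fun i _ => Finset.sum_congr rfl fun j _ => ?_
    rw [← map_smul, Matrix.smul_single, smul_eq_mul, mul_one]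
  rw [h1]
  refine Finset.aestronglyMeasurable_fun_sum _ fun i _ =>
    Finset.aestronglyMeasurable_fun_sum _ fun j _ => ?_
  exact (hm i j).aestronglyMeasurable.smul_const _

theorem IsCoef.of_bound {A : Eu N → Mat N} {b : ℝ} (hb0 : 0 ≤ b)
    (hm : AEStronglyMeasurable (fun x => clmM (A x)) (volume.restrict Ω))
    (hb : ∀ᵐ x ∂(volume.restrict Ω), ∀ v, ‖clmM (A x) v‖ ≤ b * ‖v‖) : IsCoef Ω A := by
  refine memLp_top_of_bound hm b ?_
  filter_upwards [hb] with x hx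
  exact ContinuousLinearMap.opNorm_le_bound _ hb0 hx

namespace IsTensor

variable {α β : ℝ} {A : Eu N → Mat N}

theorem isCoef (h : IsTensor Ω α β A) (hα : 0 < α) (hβ : 0 < β) : IsCoef Ω A := by
  refine IsCoef.of_bound hβ.le (aestronglyMeasurable_clmM h.measurable) ?_
  filter_upwards [h.elliptic] with x hx
  exact hx.norm_le hα hβ

theorem aestronglyMeasurable_aeval (h : IsTensor Ω α β A) (q : Polynomial ℝ) (i j : Fin N) :
    AEMeasurable (fun x => Polynomial.aeval (A x) q i j) (volume.restrict Ω) := by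
  have hpow : ∀ (n : ℕ) (i j : Fin N),
      AEMeasurable (fun x => (A x ^ n) i j) (volume.restrict Ω) := by
    intro n
    induction n with
    | zero =>
      intro i j
      simp only [pow_zero]
      exact aemeasurable_const
    | succ n ih =>
      intro i j
      simp only [pow_succ, Matrix.mul_apply]
      exact Finset.aemeasurable_fun_sum _ fun k _ => (ih i k).mul (h.measurable k j)
  simp only [Polynomial.aeval_eq_sum_range, Matrix.sum_apply, Matrix.smul_apply]
  exact Finset.aemeasurable_fun_sum _ fun n _ => (hpow n i j).const_mul (q.coeff n)

theorem isCoef_halfPow (h : IsTensor Ω α β A) (hα : 0 < α) (hβ : 0 < β) {i : ℕ}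
    (hi : i = 2 ∨ (i = 1 ∧ IsSymmTensor Ω A)) : IsCoef Ω fun x => halfPow i (A x) := by
  rcases hi with rfl | ⟨rfl, hs⟩
  · simpa only [halfPow_two] using h.isCoef hα hβ
  · obtain ⟨q, hq⟩ := exists_polynomial_tendsto_halfPow (N := N) hα hβ
    refine IsCoef.of_bound (b := √β) (by positivity) ?_ ?_
    · refine aestronglyMeasurable_of_tendsto_ae atTop
        (f := fun n x => clmM (Polynomial.aeval (A x) (q n)))
        (fun n => aestronglyMeasurable_clmM (h.aestronglyMeasurable_aeval (q n))) ?_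
      filter_upwards [h.elliptic, hs] with x hx hsx
      have hc : Continuous (clmM : Mat N → Eu N →L[ℝ] Eu N) :=
        LinearMap.continuous_of_finiteDimensional
          ((Matrix.toEuclideanCLM (n := Fin N) (𝕜 := ℝ)).toAlgEquiv.toLinearMap)
      exact (hc.tendsto _).comp (hq (A x) hx hsx)
    · filter_upwards [h.elliptic, hs] with x hx hsx
      exact norm_halfPow_one_le hx hα hβ hsx

end IsTensor

/-- Multiplication of a vector field by a bounded measurable matrix field. -/
noncomputable def mulM {A : Eu N → Mat N} (h : IsCoef Ω A) : L2Vec Ω →L[ℝ] L2Vec Ω := mulCoef h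

theorem mulM_ae {A : Eu N → Mat N} (h : IsCoef Ω A) (G : L2Vec Ω) :
    mulM h G =ᵐ[volume.restrict Ω] fun x => clmM (A x) (G x) := mulCoef_ae h G

theorem integral_mulVec_eq {A : Eu N → Mat N} (h : IsCoef Ω A) (F G : L2Vec Ω) :
    ∫ x in Ω, (A x *ᵥ (F x).ofLp) ⬝ᵥ (G x).ofLp = inner ℝ (mulM h F) G := by
  rw [L2.inner_def]
  refine integral_congr_ae ?_
  filter_upwards [mulM_ae h F] with x hx
  rw [hx, inner_clmM]

theorem form_eq {A : Eu N → Mat N} (h : IsCoef Ω A) (u ψ : W12 Ω) :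
    form A u ψ = inner ℝ (mulM h u.grad) ψ.grad := integral_mulVec_eq h _ _

namespace IsTensor

variable {α β : ℝ} {A : Eu N → Mat N}

theorem norm_mulM_le (h : IsTensor Ω α β A) (hα : 0 < α) (hβ : 0 < β) (G : L2Vec Ω) :
    ‖mulM (h.isCoef hα hβ) G‖ ≤ β * ‖G‖ := by
  refine Lp.norm_le_mul_norm_of_ae_le_mul ?_
  filter_upwards [mulM_ae (h.isCoef hα hβ) G, h.elliptic] with x hx he
  rw [hx]
  exact he.norm_le hα hβ _

theorem le_inner_mulM (h : IsTensor Ω α β A) (hα : 0 < α) (hβ : 0 < β) (G : L2Vec Ω) :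
    α * ‖G‖ ^ 2 ≤ inner ℝ (mulM (h.isCoef hα hβ) G) G := by
  rw [← real_inner_self_eq_norm_sq, ← real_inner_smul_left, L2.inner_def, L2.inner_def]
  refine integral_mono_ae (L2.integrable_inner _ _) (L2.integrable_inner _ _) ?_
  filter_upwards [mulM_ae (h.isCoef hα hβ) G, h.elliptic, Lp.coeFn_smul α G] with x hx he hs
  simp only [hx, hs, Pi.smul_apply, real_inner_smul_left, real_inner_self_eq_norm_sq]
  exact he.le_inner _

end IsTensor

/-! ### Boundary value problems -/

/-- A bounded linear relation which is total and single valued is a bounded linear operator. -/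
theorem exists_unique_clm {E F : Type*} [SeminormedAddCommGroup E] [NormedSpace ℝ E]
    [SeminormedAddCommGroup F] [NormedSpace ℝ F] {R : E → F → Prop} {C : ℝ}
    (hex : ∀ x, ∃ y, R x y) (huniq : ∀ x y z, R x y → R x z → y = z)
    (hadd : ∀ x x' y y', R x y → R x' y' → R (x + x') (y + y'))
    (hsmul : ∀ (c : ℝ) x y, R x y → R (c • x) (c • y)) (hC : ∀ x y, R x y → ‖y‖ ≤ C * ‖x‖) :
    ∃! T : E →L[ℝ] F, ∀ x, R x (T x) := by
  choose f hf using hex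
  let T : E →ₗ[ℝ] F :=
    { toFun := f
      map_add' := fun x y => huniq _ _ _ (hf _) (hadd _ _ _ _ (hf x) (hf y))
      map_smul' := fun c x => huniq _ _ _ (hf _) (hsmul c _ _ (hf x)) }
  refine ⟨T.mkContinuous C fun x => hC _ _ (hf x), fun x => hf x, fun T' hT' => ?_⟩
  ext x
  exact huniq _ _ _ (hT' x) (hf x)

/-- The Lax–Milgram theorem on a closed subspace. -/
theorem exists_solution {H : Type*} [NormedAddCommGroup H] [InnerProductSpace ℝ H] [CompleteSpace H]
    {S : Submodule ℝ H} (hS : IsClosed (S : Set H)) (B : H →L[ℝ] H →L[ℝ] ℝ) {c : ℝ} (hc : 0 < c)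
    (hB : ∀ u ∈ S, c * ‖u‖ ^ 2 ≤ B u u) (F : H →L[ℝ] ℝ) : ∃ u ∈ S, ∀ ψ ∈ S, B u ψ = F ψ := by
  have : CompleteSpace S := hS.completeSpace_coe
  set B' : S →L[ℝ] S →L[ℝ] ℝ := B.bilinearComp S.subtypeL S.subtypeL with hB'
  have hco : IsCoercive B' := ⟨c, hc, fun u => by
    have := hB u u.2
    rw [sq, ← mul_assoc] at this
    exact this⟩
  set d := (InnerProductSpace.toDual ℝ S).symm (F.comp S.subtypeL) with hd
  set v := hco.continuousLinearEquivOfBilin.symm d with hv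
  refine ⟨v, v.2, fun ψ hψ => ?_⟩
  have h1 := hco.continuousLinearEquivOfBilin_apply v ⟨ψ, hψ⟩
  rw [hv, ContinuousLinearEquiv.apply_symm_apply, hd, InnerProductSpace.toDual_symm_apply] at h1
  exact h1.symm

/-- The form `∫ A ∇u · ∇ψ` as a bounded bilinear form. -/
noncomputable def formB {A : Eu N → Mat N} (h : IsCoef Ω A) : W12 Ω →L[ℝ] W12 Ω →L[ℝ] ℝ :=
  LinearMap.mkContinuous₂ (LinearMap.mk₂ ℝ (fun u ψ : W12 Ω =>
    (inner ℝ (mulM h (gradL Ω u)) (gradL Ω ψ) : ℝ))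
    (fun u v ψ => by simp only [map_add, inner_add_left])
    (fun c u ψ => by simp only [map_smul, real_inner_smul_left, smul_eq_mul])
    (fun u ψ χ => by simp only [map_add, inner_add_right])
    (fun c u ψ => by simp only [map_smul, real_inner_smul_right, smul_eq_mul])) ‖mulM h‖ fun u ψ => by
      refine (abs_real_inner_le_norm (mulM h (gradL Ω u)) (gradL Ω ψ)).trans ?_
      have h1 : ‖mulM h (gradL Ω u)‖ ≤ ‖mulM h‖ * ‖u‖ :=
        ((mulM h).le_opNorm _).trans (by gcongr; exact norm_grad_le u)
      gcongr
      exact norm_grad_le ψ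

theorem formB_apply {A : Eu N → Mat N} (h : IsCoef Ω A) (u ψ : W12 Ω) :
    formB h u ψ = form A u ψ := (form_eq h u ψ).symm

section Form

variable {A : Eu N → Mat N}

theorem form_add_left (h : IsCoef Ω A) (u v ψ : W12 Ω) :
    form A (u + v) ψ = form A u ψ + form A v ψ := by
  simp only [← formB_apply h, map_add, add_apply]

theorem form_sub_left (h : IsCoef Ω A) (u v ψ : W12 Ω) :
    form A (u - v) ψ = form A u ψ - form A v ψ := by
  simp only [← formB_apply h, map_sub, sub_apply]

theorem form_smul_left (h : IsCoef Ω A) (c : ℝ) (u ψ : W12 Ω) :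
    form A (c • u) ψ = c * form A u ψ := by
  simp only [← formB_apply h, map_smul, smul_apply, smul_eq_mul]

theorem form_sub_right (h : IsCoef Ω A) (u ψ χ : W12 Ω) :
    form A u (ψ - χ) = form A u ψ - form A u χ := by
  simp only [← formB_apply h, map_sub]

theorem form_oneW (h : IsCoef Ω A) (hb : Bornology.IsBounded Ω) (u : W12 Ω) :
    form A u (oneW hb) = 0 := by
  rw [form_eq h, oneW_grad, inner_zero_right]

theorem IsTensor.abs_form_le {α β : ℝ} (h : IsTensor Ω α β A) (hα : 0 < α) (hβ : 0 < β)
    (u ψ : W12 Ω) : |form A u ψ| ≤ β * ‖u‖ * ‖ψ‖ := by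
  rw [form_eq (h.isCoef hα hβ)]
  refine (abs_real_inner_le_norm _ _).trans ?_
  gcongr
  · exact (h.norm_mulM_le hα hβ _).trans (by gcongr; exact norm_grad_le u)
  · exact norm_grad_le ψ

end Form

/-- The form is coercive on the subspaces in which the gradient controls the norm, uniformly with
respect to the tensor. -/
theorem exists_coercive {S : Submodule ℝ (W12 Ω)}
    (hS : ∃ C : ℝ, 0 ≤ C ∧ ∀ u ∈ S, ‖u‖ ≤ C * ‖u.grad‖) {α β : ℝ} (hα : 0 < α) (hβ : 0 < β) :
    ∃ c : ℝ, 0 < c ∧ ∀ A : Eu N → Mat N, IsTensor Ω α β A → ∀ u ∈ S, c * ‖u‖ ^ 2 ≤ form A u u := by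
  obtain ⟨C, hC0, hC⟩ := hS
  refine ⟨α / (C ^ 2 + 1), by positivity, fun A hA u hu => ?_⟩
  rw [form_eq (hA.isCoef hα hβ)]
  refine le_trans ?_ (hA.le_inner_mulM hα hβ _)
  rw [div_mul_eq_mul_div, mul_div_assoc]
  gcongr
  rw [div_le_iff₀ (by positivity)]
  have h1 : ‖u‖ ^ 2 ≤ (C * ‖u.grad‖) ^ 2 := by
    gcongr
    exact hC u hu
  nlinarith [sq_nonneg ‖u.grad‖]

section Solutions

variable {α β : ℝ} {A : Eu N → Mat N}

theorem exists_isDirichletSol (hN : 1 ≤ N) (hΩ : IsBoundedLipschitzDomain Ω) (hα : 0 < α)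
    (hβ : 0 < β) (hA : IsTensor Ω α β A) (F : W12 Ω →L[ℝ] ℝ) (φ : W12 Ω) :
    ∃ u, IsDirichletSol A F φ u := by
  obtain ⟨c, hc, hco⟩ := exists_coercive (exists_poincare_W120S hN hΩ) hα hβ
  have hC := hA.isCoef hα hβ
  obtain ⟨w, hw, h⟩ := exists_solution (isClosed_W120S (Ω := Ω)) (formB hC) hc
    (fun u hu => by rw [formB_apply]; exact hco A hA u hu) (F - formB hC φ)
  refine ⟨w + φ, by rw [add_sub_cancel_right]; exact hw, fun ψ hψ => ?_⟩
  have := h ψ hψ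
  rw [sub_apply, formB_apply, formB_apply] at this
  rw [form_add_left hC, this, sub_add_cancel]

theorem eq_zero_of_form_eq_zero (hα : 0 < α) (hβ : 0 < β) (hA : IsTensor Ω α β A)
    {S : Submodule ℝ (W12 Ω)} (hS : ∃ C : ℝ, 0 ≤ C ∧ ∀ u ∈ S, ‖u‖ ≤ C * ‖u.grad‖) {u : W12 Ω}
    (hu : u ∈ S) (h : form A u u = 0) : u = 0 := by
  obtain ⟨c, hc, hco⟩ := exists_coercive hS hα hβ
  have h1 := hco A hA u hu
  rw [h] at h1
  have h2 : ‖u‖ ^ 2 ≤ 0 := by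
    by_contra! h'
    nlinarith
  rw [← norm_le_zero_iff]
  nlinarith [norm_nonneg u]

theorem IsDirichletSolBdry.isTrace (hΩ : IsBoundedLipschitzDomain Ω) {φ : W12half Ω} {u : W12 Ω}
    (h : IsDirichletSolBdry A φ u) : IsTrace u φ := by
  obtain ⟨φ', hφ, h1, -⟩ := h
  exact hφ.of_sub_mem hΩ h1

theorem IsDirichletSolBdry.form_eq_zero {φ : W12half Ω} {u ψ : W12 Ω}
    (h : IsDirichletSolBdry A φ u) (hψ : ψ ∈ W120S Ω) : form A u ψ = 0 := by
  obtain ⟨φ', hφ, -, h2⟩ := h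
  exact h2 ψ hψ

theorem isDirichletSolBdry_iff (hN : 1 ≤ N) (hΩ : IsBoundedLipschitzDomain Ω) {φ : W12half Ω}
    {u : W12 Ω} : IsDirichletSolBdry A φ u ↔ IsTrace u φ ∧ ∀ ψ ∈ W120S Ω, form A u ψ = 0 := by
  refine ⟨fun h => ⟨h.isTrace hΩ, fun ψ hψ => h.form_eq_zero hψ⟩, fun h => ?_⟩
  obtain ⟨v, hv⟩ := φ.exists_isTrace
  exact ⟨v, hv, h.1.sub_mem hN hΩ hv, h.2⟩

theorem exists_isDirichletSolBdry (hN : 1 ≤ N) (hΩ : IsBoundedLipschitzDomain Ω) (hα : 0 < α)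
    (hβ : 0 < β) (hA : IsTensor Ω α β A) (φ : W12half Ω) : ∃ u, IsDirichletSolBdry A φ u := by
  obtain ⟨v, hv⟩ := φ.exists_isTrace
  obtain ⟨u, hu⟩ := exists_isDirichletSol hN hΩ hα hβ hA 0 v
  exact ⟨u, v, hv, hu⟩

theorem IsDirichletSolBdry.unique (hN : 1 ≤ N) (hΩ : IsBoundedLipschitzDomain Ω) (hα : 0 < α)
    (hβ : 0 < β) (hA : IsTensor Ω α β A) {φ : W12half Ω} {u v : W12 Ω}
    (hu : IsDirichletSolBdry A φ u) (hv : IsDirichletSolBdry A φ v) : u = v := by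
  have h1 : u - v ∈ W120S Ω := (hu.isTrace hΩ).sub_mem hN hΩ (hv.isTrace hΩ)
  rw [← sub_eq_zero]
  refine eq_zero_of_form_eq_zero hα hβ hA (exists_poincare_W120S hN hΩ) h1 ?_
  rw [form_sub_left (hA.isCoef hα hβ), hu.form_eq_zero h1, hv.form_eq_zero h1, sub_zero]

theorem IsDirichletSolBdry.add (hN : 1 ≤ N) (hΩ : IsBoundedLipschitzDomain Ω) (hA : IsCoef Ω A)
    {φ χ : W12half Ω} {u v : W12 Ω} (hu : IsDirichletSolBdry A φ u)
    (hv : IsDirichletSolBdry A χ v) : IsDirichletSolBdry A (φ + χ) (u + v) := by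
  rw [isDirichletSolBdry_iff hN hΩ] at *
  exact ⟨hu.1.add hv.1, fun ψ hψ => by rw [form_add_left hA, hu.2 ψ hψ, hv.2 ψ hψ, add_zero]⟩

theorem IsDirichletSolBdry.smul (hN : 1 ≤ N) (hΩ : IsBoundedLipschitzDomain Ω) (hA : IsCoef Ω A)
    {φ : W12half Ω} {u : W12 Ω} (c : ℝ) (hu : IsDirichletSolBdry A φ u) :
    IsDirichletSolBdry A (c • φ) (c • u) := by
  rw [isDirichletSolBdry_iff hN hΩ] at *
  exact ⟨hu.1.smul c, fun ψ hψ => by rw [form_smul_left hA, hu.2 ψ hψ, mul_zero]⟩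

/-- The bound for the solutions of the Dirichlet problem does not depend on the tensor. -/
theorem exists_dirichlet_bound (hN : 1 ≤ N) (hΩ : IsBoundedLipschitzDomain Ω) (hα : 0 < α)
    (hβ : 0 < β) : ∃ C : ℝ, 0 ≤ C ∧ ∀ A : Eu N → Mat N, IsTensor Ω α β A → ∀ (φ : W12half Ω)
      (u : W12 Ω), IsDirichletSolBdry A φ u → ‖u‖ ≤ C * ‖φ‖ := by
  obtain ⟨c, hc, hco⟩ := exists_coercive (exists_poincare_W120S hN hΩ) hα hβ
  refine ⟨β / c + 1, by positivity, fun A hA φ u hu => ?_⟩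
  have hC := hA.isCoef hα hβ
  set e := traceProj Ω u with he
  have hn : ‖φ‖ = ‖e‖ := (hu.isTrace hΩ).norm_eq hN hΩ
  have hw : u - e ∈ W120S Ω := by
    have := neg_mem (traceProj_sub_mem u)
    rwa [neg_sub] at this
  have h1 := hco A hA _ hw
  have h2 : form A (u - e) (u - e) = - form A e (u - e) := by
    rw [form_sub_left hC, hu.form_eq_zero hw, zero_sub]
  have h3 : - form A e (u - e) ≤ β * ‖e‖ * ‖u - e‖ :=
    (neg_le_abs _).trans (hA.abs_form_le hα hβ _ _)
  have h4 : ‖u - e‖ ≤ β / c * ‖e‖ := by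
    rw [div_mul_eq_mul_div, le_div_iff₀ hc]
    rcases (norm_nonneg (u - e)).eq_or_lt with h0 | h0
    · rw [← h0]
      have := norm_nonneg e
      nlinarith
    · refine le_of_mul_le_mul_right ?_ h0
      nlinarith
  calc ‖u‖ = ‖(u - e) + e‖ := by rw [sub_add_cancel]
    _ ≤ ‖u - e‖ + ‖e‖ := norm_add_le _ _
    _ ≤ _ := by rw [hn]; linarith

theorem exists_isNeumannSol (hN : 1 ≤ N) (hΩ : IsBoundedLipschitzDomain Ω) (hα : 0 < α)
    (hβ : 0 < β) (hA : IsTensor Ω α β A) (g : W12minusStar Ω) : ∃ v, IsNeumannSol A g v := by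
  obtain ⟨c, hc, hco⟩ := exists_coercive (exists_poincare_star hN hΩ) hα hβ
  obtain ⟨T, hT⟩ := exists_trace hN hΩ
  have := hΩ.isFiniteMeasure_surface hN
  have hC := hA.isCoef hα hβ
  obtain ⟨v, hv, h⟩ := exists_solution (isClosed_traceDomainStar hN hΩ) (formB hC) hc
    (fun u hu => by rw [formB_apply]; exact hco A hA u hu) (g.1.comp T)
  refine ⟨v, hv, fun ψ k hψ => ?_⟩
  obtain ⟨m, hm⟩ := exists_sub_oneW_mem hN hΩ (mem_traceDomain.2 ⟨k, hψ⟩)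
  obtain ⟨o, ho, ho1⟩ := exists_isTrace_of_mem (oneW_oneS_mem hΩ.isBounded)
  have h1 := h _ hm
  have hone : form A v (m • oneW hΩ.isBounded) = 0 := by
    rw [← formB_apply hC, map_smul, formB_apply, form_oneW hC, smul_zero]
  have hg : g.1 o = 0 := g.2 o (by rw [ho]; exact oneS_ae)
  have h2 : T (ψ - m • oneW hΩ.isBounded) = k - m • o := hT _ _ (hψ.sub (ho1.smul m))
  rw [formB_apply, form_sub_right hC, hone, sub_zero, ContinuousLinearMap.comp_apply, h2, map_sub,
    map_smul, hg, smul_zero, sub_zero] at h1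
  exact h1

theorem IsNeumannSol.mem_star {g : W12minusStar Ω} {v : W12 Ω} (h : IsNeumannSol A g v) :
    v ∈ traceDomainStar Ω := h.1

theorem IsNeumannSol.form_eq_zero (hΩ : IsBoundedLipschitzDomain Ω) {g : W12minusStar Ω}
    {v ψ : W12 Ω} (h : IsNeumannSol A g v) (hψ : ψ ∈ W120S Ω) : form A v ψ = 0 := by
  have h1 : IsTrace ψ 0 := by
    rw [IsTrace, map_zero]
    exact zero_trace_of_mem_W120S hΩ hψ
  rw [h.2 ψ 0 h1, map_zero]

theorem IsNeumannSol.unique (hN : 1 ≤ N) (hΩ : IsBoundedLipschitzDomain Ω) (hα : 0 < α)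
    (hβ : 0 < β) (hA : IsTensor Ω α β A) {g : W12minusStar Ω} {u v : W12 Ω}
    (hu : IsNeumannSol A g u) (hv : IsNeumannSol A g v) : u = v := by
  have h1 : u - v ∈ traceDomainStar Ω := sub_mem hu.mem_star hv.mem_star
  have ⟨k, _, hk⟩ := h1
  rw [← sub_eq_zero]
  refine eq_zero_of_form_eq_zero hα hβ hA (exists_poincare_star hN hΩ) h1 ?_
  rw [form_sub_left (hA.isCoef hα hβ), hu.2 _ k hk, hv.2 _ k hk, sub_self]

theorem IsNeumannSol.add (hA : IsCoef Ω A) {f g : W12minusStar Ω} {u v : W12 Ω}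
    (hu : IsNeumannSol A f u) (hv : IsNeumannSol A g v) : IsNeumannSol A (f + g) (u + v) :=
  ⟨add_mem hu.mem_star hv.mem_star, fun ψ k hψ => by
    rw [form_add_left hA, hu.2 ψ k hψ, hv.2 ψ k hψ]
    rfl⟩

theorem IsNeumannSol.smul (hA : IsCoef Ω A) {g : W12minusStar Ω} {v : W12 Ω} (c : ℝ)
    (hv : IsNeumannSol A g v) : IsNeumannSol A (c • g) (c • v) :=
  ⟨Submodule.smul_mem _ c hv.mem_star, fun ψ k hψ => by
    rw [form_smul_left hA, hv.2 ψ k hψ]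
    rfl⟩

/-- The bound for the solutions of the Neumann problem does not depend on the tensor. -/
theorem exists_neumann_bound (hN : 1 ≤ N) (hΩ : IsBoundedLipschitzDomain Ω) (hα : 0 < α)
    (hβ : 0 < β) : ∃ C : ℝ, 0 ≤ C ∧ ∀ A : Eu N → Mat N, IsTensor Ω α β A → ∀ (g : W12minusStar Ω)
      (v : W12 Ω), IsNeumannSol A g v → ‖v‖ ≤ C * ‖g‖ := by
  obtain ⟨c, hc, hco⟩ := exists_coercive (exists_poincare_star hN hΩ) hα hβ
  refine ⟨1 / c, by positivity, fun A hA g v hv => ?_⟩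
  have h1 := hco A hA _ hv.mem_star
  obtain ⟨k, -, hk⟩ := hv.mem_star
  have h2 : g.1 k ≤ ‖g‖ * ‖v‖ := by
    refine (le_abs_self _).trans ((g.1.le_opNorm k).trans ?_)
    exact mul_le_mul_of_nonneg_left hk.norm_le (norm_nonneg _)
  rw [hv.2 v k hk] at h1
  rw [div_mul_eq_mul_div, one_mul, le_div_iff₀ hc]
  rcases (norm_nonneg v).eq_or_lt with h0 | h0
  · rw [← h0, zero_mul]
    exact norm_nonneg g
  · refine le_of_mul_le_mul_right ?_ h0
    nlinarith

end Solutions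

/-! ### The forward operators -/

section Forward

variable {α β : ℝ} {A : Eu N → Mat N}

theorem existsUnique_isDN (hN : 1 ≤ N) (hΩ : IsBoundedLipschitzDomain Ω) (hα : 0 < α) (hβ : 0 < β)
    (hA : IsTensor Ω α β A) : ∃! Λ : W12half Ω →L[ℝ] W12minusStar Ω, IsDN A Λ := by
  have hC := hA.isCoef hα hβ
  obtain ⟨C, hC0, hbound⟩ := exists_dirichlet_bound hN hΩ hα hβ
  refine exists_unique_clm (C := β * C) (R := fun (φ : W12half Ω) (g : W12minusStar Ω) =>
    ∃ u : W12 Ω, IsDirichletSolBdry A φ u ∧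
      ∀ (ψ : W12half Ω) (ψ' : W12 Ω), IsTrace ψ' ψ → g.1 ψ = form A u ψ') ?_ ?_ ?_ ?_ ?_
  · intro φ
    obtain ⟨u, hu⟩ := exists_isDirichletSolBdry hN hΩ hα hβ hA φ
    obtain ⟨E, hE⟩ := exists_extension hN hΩ
    have key : ∀ (ψ : W12half Ω) (ψ' : W12 Ω), IsTrace ψ' ψ →
        ((formB hC u).comp E) ψ = form A u ψ' := by
      intro ψ ψ' h
      have h1 := hu.form_eq_zero ((hE ψ).sub_mem hN hΩ h)
      rw [form_sub_right hC, sub_eq_zero] at h1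
      rw [ContinuousLinearMap.comp_apply, formB_apply, h1]
    refine ⟨⟨(formB hC u).comp E, fun h hh => ?_⟩, u, hu, key⟩
    rw [key h _ (isTrace_oneW hN hΩ hh), form_oneW hC]
  · rintro φ g g' ⟨u, hu, h⟩ ⟨u', hu', h'⟩
    ext ψ
    obtain ⟨ψ', hψ⟩ := ψ.exists_isTrace
    rw [h ψ ψ' hψ, h' ψ ψ' hψ, hu.unique hN hΩ hα hβ hA hu']
  · rintro φ φ' g g' ⟨u, hu, h⟩ ⟨u', hu', h'⟩
    refine ⟨u + u', hu.add hN hΩ hC hu', fun ψ ψ' hψ => ?_⟩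
    rw [form_add_left hC, ← h ψ ψ' hψ, ← h' ψ ψ' hψ]
    rfl
  · rintro c φ g ⟨u, hu, h⟩
    refine ⟨c • u, hu.smul hN hΩ hC c, fun ψ ψ' hψ => ?_⟩
    rw [form_smul_left hC, ← h ψ ψ' hψ]
    rfl
  · rintro φ g ⟨u, hu, h⟩
    have h1 := hbound A hA φ u hu
    refine ContinuousLinearMap.opNorm_le_bound g.1 (by positivity) fun ψ => ?_
    obtain ⟨ψ', hψ⟩ := ψ.exists_isTrace
    have hψ2 : IsTrace (traceProj Ω ψ') ψ := hψ.of_sub_mem hΩ (traceProj_sub_mem ψ')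
    rw [h ψ _ hψ2, Real.norm_eq_abs, hψ.norm_eq hN hΩ, mul_assoc β]
    refine (hA.abs_form_le hα hβ _ _).trans ?_
    gcongr

theorem isDN_DN (hN : 1 ≤ N) (hΩ : IsBoundedLipschitzDomain Ω) (hα : 0 < α) (hβ : 0 < β)
    (hA : IsTensor Ω α β A) : IsDN A (DN Ω A) := by
  have h := (existsUnique_isDN hN hΩ hα hβ hA).exists
  rw [DN, dif_pos h]
  exact h.choose_spec

theorem existsUnique_isND (hN : 1 ≤ N) (hΩ : IsBoundedLipschitzDomain Ω) (hα : 0 < α) (hβ : 0 < β)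
    (hA : IsTensor Ω α β A) : ∃! Λ : W12minusStar Ω →L[ℝ] W12halfStar Ω, IsND A Λ := by
  have hC := hA.isCoef hα hβ
  obtain ⟨C, hC0, hbound⟩ := exists_neumann_bound hN hΩ hα hβ
  refine exists_unique_clm (C := C) (R := fun (g : W12minusStar Ω) (h : W12halfStar Ω) =>
    ∃ v : W12 Ω, IsNeumannSol A g v ∧ IsTrace v h.1) ?_ ?_ ?_ ?_ ?_
  · intro g
    obtain ⟨v, hv⟩ := exists_isNeumannSol hN hΩ hα hβ hA g
    obtain ⟨k, hk, hvk⟩ := hv.mem_star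
    exact ⟨⟨k, hk⟩, v, hv, hvk⟩
  · rintro g h h' ⟨v, hv, hh⟩ ⟨v', hv', hh'⟩
    rw [← hv.unique hN hΩ hα hβ hA hv'] at hh'
    exact Subtype.ext (hh.unique hN hΩ hh')
  · rintro g g' h h' ⟨v, hv, hh⟩ ⟨v', hv', hh'⟩
    exact ⟨v + v', hv.add hC hv', hh.add hh'⟩
  · rintro c g h ⟨v, hv, hh⟩
    exact ⟨c • v, hv.smul hC c, hh.smul c⟩
  · rintro g h ⟨v, hv, hh⟩
    exact hh.norm_le.trans (hbound A hA g v hv)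

theorem isND_ND (hN : 1 ≤ N) (hΩ : IsBoundedLipschitzDomain Ω) (hα : 0 < α) (hβ : 0 < β)
    (hA : IsTensor Ω α β A) : IsND A (ND Ω A) := by
  have h := (existsUnique_isND hN hΩ hα hβ hA).exists
  rw [ND, dif_pos h]
  exact h.choose_spec

theorem ae_eq_mulM_iff {H : Eu N → Mat N} (hH : IsCoef Ω H) (G : L2Vec Ω) (u v : W12 Ω) :
    (∀ᵐ x ∂(volume.restrict Ω), (G x).ofLp = H x *ᵥ ((u.grad x).ofLp - (v.grad x).ofLp)) ↔
      G = mulM hH (u.grad - v.grad) := by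
  rw [Lp.ext_iff]
  have h1 : ∀ᵐ x ∂(volume.restrict Ω), (mulM hH (u.grad - v.grad) x).ofLp =
      H x *ᵥ ((u.grad x).ofLp - (v.grad x).ofLp) := by
    filter_upwards [mulM_ae hH (u.grad - v.grad), Lp.coeFn_sub u.grad v.grad] with x h2 h3
    rw [h2, ofLp_clmM, h3]
    rfl
  constructor <;> intro h <;> filter_upwards [h, h1] with x h2 h3
  · exact WithLp.ofLp_injective 2 (h2.trans h3.symm)
  · rw [h2, h3]

theorem isKD_iff {Λ : W12half Ω →L[ℝ] W12minusStar Ω} {i : ℕ}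
    (hH : IsCoef Ω fun x => halfPow i (A x)) {K : W12half Ω →L[ℝ] L2Vec Ω} :
    IsKD Λ i A K ↔ ∀ φ, ∃ u v : W12 Ω, IsDirichletSolBdry A φ u ∧ IsNeumannSol A (Λ φ) v ∧
      K φ = mulM hH (u.grad - v.grad) := by
  simp only [IsKD, ae_eq_mulM_iff hH]

theorem isKN_iff {Λ : W12minusStar Ω →L[ℝ] W12halfStar Ω} {i : ℕ}
    (hH : IsCoef Ω fun x => halfPow i (A x)) {K : W12minusStar Ω →L[ℝ] L2Vec Ω} :
    IsKN Λ i A K ↔ ∀ g, ∃ u v : W12 Ω, IsDirichletSolBdry A (Λ g).1 u ∧ IsNeumannSol A g v ∧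
      K g = mulM hH (u.grad - v.grad) := by
  simp only [IsKN, ae_eq_mulM_iff hH]

/-- The difference of the solutions of a Dirichlet and a Neumann problem whose data depend linearly
on a parameter, mapped by a multiplication operator, is a bounded linear operator. -/
theorem existsUnique_misfit (hN : 1 ≤ N) (hΩ : IsBoundedLipschitzDomain Ω) (hα : 0 < α)
    (hβ : 0 < β) (hA : IsTensor Ω α β A) {H : Eu N → Mat N} (hH : IsCoef Ω H) {E : Type*}
    [SeminormedAddCommGroup E] [NormedSpace ℝ E] (S : E →L[ℝ] W12half Ω)
    (T : E →L[ℝ] W12minusStar Ω) :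
    ∃! K : E →L[ℝ] L2Vec Ω, ∀ x, ∃ u v : W12 Ω, IsDirichletSolBdry A (S x) u ∧
      IsNeumannSol A (T x) v ∧ K x = mulM hH (u.grad - v.grad) := by
  have hC := hA.isCoef hα hβ
  obtain ⟨C, hC0, hCb⟩ := exists_dirichlet_bound hN hΩ hα hβ
  obtain ⟨D, hD0, hDb⟩ := exists_neumann_bound hN hΩ hα hβ
  have hadd : ∀ u v : W12 Ω, (u + v).grad = u.grad + v.grad := (gradL Ω).map_add
  have hsmul : ∀ (c : ℝ) (u : W12 Ω), (c • u).grad = c • u.grad := (gradL Ω).map_smul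
  refine exists_unique_clm (C := ‖mulM hH‖ * (C * ‖S‖ + D * ‖T‖)) (R := fun (x : E) (G : L2Vec Ω) =>
    ∃ u v : W12 Ω, IsDirichletSolBdry A (S x) u ∧ IsNeumannSol A (T x) v ∧
      G = mulM hH (u.grad - v.grad)) ?_ ?_ ?_ ?_ ?_
  · intro x
    obtain ⟨u, hu⟩ := exists_isDirichletSolBdry hN hΩ hα hβ hA (S x)
    obtain ⟨v, hv⟩ := exists_isNeumannSol hN hΩ hα hβ hA (T x)
    exact ⟨_, u, v, hu, hv, rfl⟩
  · rintro x G G' ⟨u, v, hu, hv, rfl⟩ ⟨u', v', hu', hv', rfl⟩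
    rw [hu.unique hN hΩ hα hβ hA hu', hv.unique hN hΩ hα hβ hA hv']
  · rintro x x' G G' ⟨u, v, hu, hv, rfl⟩ ⟨u', v', hu', hv', rfl⟩
    refine ⟨u + u', v + v', ?_, ?_, ?_⟩
    · rw [map_add]
      exact hu.add hN hΩ hC hu'
    · rw [map_add]
      exact hv.add hC hv'
    · rw [hadd, hadd, ← map_add]
      congr 1
      abel
  · rintro c x G ⟨u, v, hu, hv, rfl⟩
    refine ⟨c • u, c • v, ?_, ?_, ?_⟩
    · rw [map_smul]
      exact hu.smul hN hΩ hC c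
    · rw [map_smul]
      exact hv.smul hC c
    · rw [hsmul, hsmul, ← smul_sub, map_smul]
  · rintro x G ⟨u, v, hu, hv, rfl⟩
    have h1 : ‖u.grad‖ ≤ C * (‖S‖ * ‖x‖) :=
      (norm_grad_le u).trans ((hCb A hA _ u hu).trans (by gcongr; exact S.le_opNorm x))
    have h2 : ‖v.grad‖ ≤ D * (‖T‖ * ‖x‖) :=
      (norm_grad_le v).trans ((hDb A hA _ v hv).trans (by gcongr; exact T.le_opNorm x))
    rw [mul_assoc]
    refine ((mulM hH).le_opNorm _).trans ?_
    gcongr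
    refine (norm_sub_le _ _).trans ?_
    linarith

theorem existsUnique_isKD (hN : 1 ≤ N) (hΩ : IsBoundedLipschitzDomain Ω) (hα : 0 < α) (hβ : 0 < β)
    (hA : IsTensor Ω α β A) (Λ : W12half Ω →L[ℝ] W12minusStar Ω) {i : ℕ}
    (hH : IsCoef Ω fun x => halfPow i (A x)) :
    ∃! K : W12half Ω →L[ℝ] L2Vec Ω, IsKD Λ i A K := by
  simp only [isKD_iff hH]
  exact existsUnique_misfit hN hΩ hα hβ hA hH (ContinuousLinearMap.id ℝ _) Λ

theorem isKD_KD (hN : 1 ≤ N) (hΩ : IsBoundedLipschitzDomain Ω) (hα : 0 < α) (hβ : 0 < β)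
    (hA : IsTensor Ω α β A) (Λ : W12half Ω →L[ℝ] W12minusStar Ω) {i : ℕ}
    (hH : IsCoef Ω fun x => halfPow i (A x)) : IsKD Λ i A (KD Λ i A) := by
  have h := (existsUnique_isKD hN hΩ hα hβ hA Λ hH).exists
  rw [KD, dif_pos h]
  exact h.choose_spec

theorem existsUnique_isKN (hN : 1 ≤ N) (hΩ : IsBoundedLipschitzDomain Ω) (hα : 0 < α) (hβ : 0 < β)
    (hA : IsTensor Ω α β A) (Λ : W12minusStar Ω →L[ℝ] W12halfStar Ω) {i : ℕ}
    (hH : IsCoef Ω fun x => halfPow i (A x)) :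
    ∃! K : W12minusStar Ω →L[ℝ] L2Vec Ω, IsKN Λ i A K := by
  simp only [isKN_iff hH]
  exact existsUnique_misfit hN hΩ hα hβ hA hH ((W12halfStar Ω).subtypeL.comp Λ)
    (ContinuousLinearMap.id ℝ _)

theorem isKN_KN (hN : 1 ≤ N) (hΩ : IsBoundedLipschitzDomain Ω) (hα : 0 < α) (hβ : 0 < β)
    (hA : IsTensor Ω α β A) (Λ : W12minusStar Ω →L[ℝ] W12halfStar Ω) {i : ℕ}
    (hH : IsCoef Ω fun x => halfPow i (A x)) : IsKN Λ i A (KN Λ i A) := by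
  have h := (existsUnique_isKN hN hΩ hα hβ hA Λ hH).exists
  rw [KN, dif_pos h]
  exact h.choose_spec

end Forward

/-! ### Localization by test functions -/

/-- A test function which is equal to one near the support of a given test function. -/
theorem IsTest.exists_eq_one (hN : 1 ≤ N) (hΩ : IsBoundedLipschitzDomain Ω) {θ : Eu N → ℝ}
    (hθ : IsTest Ω θ) : ∃ χ : Eu N → ℝ, IsTest Ω χ ∧ (∀ x, 0 ≤ χ x) ∧
      ∀ x ∈ tsupport θ, χ x = 1 ∧ gradient χ x = 0 := by
  have hK : IsCompact (tsupport θ) := hθ.compact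
  obtain ⟨δ, hδ, h⟩ := hK.exists_thickening_subset_open hΩ.isOpen hθ.support
  obtain ⟨χ, h1, h2, -, h4, -⟩ := exists_cutoff hΩ.isBounded hδ
  refine ⟨χ, h1, h2, fun x hx => h4 x ?_⟩
  rw [Metric.le_infDist (hΩ.nonempty_compl hN)]
  intro y hy
  by_contra! hlt
  exact hy (h (Metric.mem_thickening_iff.2 ⟨x, hx, by rwa [dist_comm]⟩))

theorem IsTest.integrable_mul {θ : Eu N → ℝ} (hθ : IsTest Ω θ) {f : Eu N → ℝ}
    (hf : IntegrableOn f Ω) : Integrable (fun x => θ x * f x) (volume.restrict Ω) := by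
  obtain ⟨C, hC⟩ := hθ.smooth.continuous.bounded_above_of_compact_support hθ.compact
  exact Integrable.bdd_mul hf hθ.smooth.continuous.aestronglyMeasurable (Eventually.of_forall hC)

/-- The fundamental lemma of the calculus of variations, with nonnegative test functions. -/
theorem ae_eq_zero_of_forall_test (hN : 1 ≤ N) (hΩ : IsBoundedLipschitzDomain Ω) {f : Eu N → ℝ}
    (hf : IntegrableOn f Ω)
    (h : ∀ θ : Eu N → ℝ, IsTest Ω θ → (∀ x, 0 ≤ θ x) → ∫ x in Ω, θ x * f x = 0) :
    ∀ᵐ x ∂(volume.restrict Ω), f x = 0 := by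
  rw [ae_restrict_iff' hΩ.isOpen.measurableSet]
  refine hΩ.isOpen.ae_eq_zero_of_integral_contDiff_smul_eq_zero hf.locallyIntegrableOn
    fun g hg hgc hgs => ?_
  have hgt : IsTest Ω g := ⟨hg, hgc, hgs⟩
  obtain ⟨χ, hχ, hχ0, hχ1⟩ := hgt.exists_eq_one hN hΩ
  obtain ⟨C, hC⟩ := hg.continuous.bounded_above_of_compact_support hgc
  have hC0 : 0 ≤ C := (norm_nonneg _).trans (hC 0)
  have hsum : IsTest Ω fun x => g x + C * χ x := by
    refine ⟨hg.add (contDiff_const.mul hχ.smooth), hgc.add (hχ.compact.mul_left),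
      (tsupport_add g _).trans (Set.union_subset hgs ?_)⟩
    exact (tsupport_mul_subset_right (f := fun _ => C)).trans hχ.support
  have h1 := h _ hsum fun x => by
    by_cases hx : x ∈ tsupport g
    · have := hC x
      rw [Real.norm_eq_abs, abs_le] at this
      rw [(hχ1 x hx).1]
      linarith
    · rw [image_eq_zero_of_notMem_tsupport hx, zero_add]
      exact mul_nonneg hC0 (hχ0 x)
  have h2 := h χ hχ hχ0
  have h3 : ∫ x in Ω, (g x + C * χ x) * f x = (∫ x in Ω, g x * f x) + C * ∫ x in Ω, χ x * f x := by
    rw [← integral_const_mul, ← integral_add (hgt.integrable_mul hf)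
      ((hχ.integrable_mul hf).const_mul C)]
    refine integral_congr_ae (Eventually.of_forall fun x => ?_)
    ring
  rw [h1, h2, mul_zero, add_zero] at h3
  rw [setIntegral_eq_integral_of_forall_compl_eq_zero] at h3
  · exact h3.symm
  · intro x hx
    rw [hgt.eq_zero hx, zero_mul]

/-- Multiplication of a vector field by a smooth function. -/
noncomputable def mulS (hb : Bornology.IsBounded Ω) {θ : Eu N → ℝ} (hθ : ContDiff ℝ ∞ θ) :
    L2Vec Ω →L[ℝ] L2Vec Ω :=
  mulCoef (memLp_smul_id (E := Eu N) hb hθ)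

/-- Multiplication of the gradient of a smooth function by a square integrable function. -/
noncomputable def mulG (hb : Bornology.IsBounded Ω) {θ : Eu N → ℝ} (hθ : ContDiff ℝ ∞ θ) :
    L2 Ω →L[ℝ] L2Vec Ω :=
  mulCoef (memLp_gradient_smul hb hθ)

theorem grad_smulW (hb : Bornology.IsBounded Ω) {θ : Eu N → ℝ} (hθ : ContDiff ℝ ∞ θ) (u : W12 Ω) :
    (smulW hb hθ u).grad = mulS hb hθ u.grad + mulG hb hθ u.fn := rfl

theorem mulS_ae (hb : Bornology.IsBounded Ω) {θ : Eu N → ℝ} (hθ : ContDiff ℝ ∞ θ) (G : L2Vec Ω) :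
    mulS hb hθ G =ᵐ[volume.restrict Ω] fun x => θ x • G x :=
  mulCoef_ae (memLp_smul_id (E := Eu N) hb hθ) G

theorem mulG_ae (hb : Bornology.IsBounded Ω) {θ : Eu N → ℝ} (hθ : ContDiff ℝ ∞ θ) (f : L2 Ω) :
    mulG hb hθ f =ᵐ[volume.restrict Ω] fun x => f x • gradient θ x :=
  mulCoef_ae (memLp_gradient_smul hb hθ) f

theorem inner_mulS (hb : Bornology.IsBounded Ω) {θ : Eu N → ℝ} (hθ : ContDiff ℝ ∞ θ)
    (F G : L2Vec Ω) : inner ℝ (mulS hb hθ F) G = inner ℝ F (mulS hb hθ G) := by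
  rw [L2.inner_def, L2.inner_def]
  refine integral_congr_ae ?_
  filter_upwards [mulS_ae hb hθ F, mulS_ae hb hθ G] with x h1 h2
  rw [h1, h2, real_inner_smul_left, real_inner_smul_right]

theorem inner_mulS_eq_integral (hb : Bornology.IsBounded Ω) {θ : Eu N → ℝ} (hθ : ContDiff ℝ ∞ θ)
    (F G : L2Vec Ω) : inner ℝ (mulS hb hθ F) G = ∫ x in Ω, θ x * inner ℝ (F x) (G x) := by
  rw [L2.inner_def]
  refine integral_congr_ae ?_
  filter_upwards [mulS_ae hb hθ F] with x h1
  rw [h1, real_inner_smul_left]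

theorem mulS_mulM (hb : Bornology.IsBounded Ω) {θ : Eu N → ℝ} (hθ : ContDiff ℝ ∞ θ)
    {A : Eu N → Mat N} (hA : IsCoef Ω A) (G : L2Vec Ω) :
    mulS hb hθ (mulM hA G) = mulM hA (mulS hb hθ G) := by
  refine Lp.ext ?_
  filter_upwards [mulS_ae hb hθ (mulM hA G), mulM_ae hA G, mulM_ae hA (mulS hb hθ G),
    mulS_ae hb hθ G] with x h1 h2 h3 h4
  rw [h1, h2, h3, h4, map_smul]

/-- Where the cut-off function is equal to one, the cut-off does not change the gradient. -/
theorem mulS_grad_smulW (hb : Bornology.IsBounded Ω) {θ χ : Eu N → ℝ} (hθ : ContDiff ℝ ∞ θ)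
    (hχ : ContDiff ℝ ∞ χ) (h : ∀ x ∈ tsupport θ, χ x = 1 ∧ gradient χ x = 0) (u : W12 Ω) :
    mulS hb hθ (smulW hb hχ u).grad = mulS hb hθ u.grad := by
  refine Lp.ext ?_
  filter_upwards [mulS_ae hb hθ (smulW hb hχ u).grad, mulS_ae hb hθ u.grad, smulW_grad hb hχ u]
    with x h1 h2 h3
  rw [h1, h2]
  by_cases hx : x ∈ tsupport θ
  · rw [h3, (h x hx).1, (h x hx).2, smul_zero, add_zero, one_smul]
  · rw [image_eq_zero_of_notMem_tsupport hx, zero_smul, zero_smul]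

theorem ofSmooth_mem_traceDomain (hN : 1 ≤ N) (hΩ : IsBoundedLipschitzDomain Ω) {f : Eu N → ℝ}
    (hf : ContDiff ℝ ∞ f) : ofSmooth hΩ.isBounded hf ∈ traceDomain Ω := by
  obtain ⟨h, -, hh⟩ := smoothTraceGraph_exists hN hΩ hf
  exact ⟨_, (smoothTraceGraph Ω).le_topologicalClosure hh, rfl⟩

theorem smulW_mem_of_mem_traceDomain (hΩ : IsBoundedLipschitzDomain Ω) {θ : Eu N → ℝ}
    (hθ : IsTest Ω θ) {u : W12 Ω} (hu : u ∈ traceDomain Ω) :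
    smulW hΩ.isBounded hθ.smooth u ∈ W120S Ω := by
  obtain ⟨p, hp, rfl⟩ := hu
  exact smulW_mem_W120S hΩ hθ hp

theorem contDiff_coord (i : Fin N) : ContDiff ℝ ∞ fun x : Eu N => x i :=
  (EuclideanSpace.proj (𝕜 := ℝ) i : Eu N →L[ℝ] ℝ).contDiff

/-- The `i`-th coordinate as a Sobolev function. -/
noncomputable def coordW (hb : Bornology.IsBounded Ω) (i : Fin N) : W12 Ω :=
  ofSmooth hb (contDiff_coord i)

theorem coordW_grad (hb : Bornology.IsBounded Ω) (i : Fin N) :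
    (coordW hb i).grad =ᵐ[volume.restrict Ω] fun _ => EuclideanSpace.single i 1 := by
  filter_upwards [ofSmooth_grad hb (contDiff_coord i)] with x hx
  rw [coordW, hx]
  ext j
  rw [gradient_apply, partialD]
  have h1 : fderiv ℝ (fun x : Eu N => x i) x = EuclideanSpace.proj (𝕜 := ℝ) i :=
    (EuclideanSpace.proj (𝕜 := ℝ) i : Eu N →L[ℝ] ℝ).fderiv
  rw [h1]
  simp [eq_comm]

/-- A vector field vanishes if its product with every nonnegative test function is orthogonal to
every gradient of a function in `W^{1,2}_0`. -/
theorem eq_zero_of_forall_inner (hN : 1 ≤ N) (hΩ : IsBoundedLipschitzDomain Ω) {τ : L2Vec Ω}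
    (h : ∀ (θ : Eu N → ℝ) (hθ : IsTest Ω θ), (∀ x, 0 ≤ θ x) → ∀ v ∈ W120S Ω,
      inner ℝ (mulS hΩ.isBounded hθ.smooth τ) v.grad = 0) : τ = 0 := by
  have hfin : IsFiniteMeasure (volume.restrict Ω) := ⟨by
    simpa using hΩ.isBounded.measure_lt_top⟩
  have h1 : ∀ i : Fin N, ∀ᵐ x ∂(volume.restrict Ω), τ x i = 0 := by
    intro i
    refine ae_eq_zero_of_forall_test hN hΩ ?_ fun θ hθ hθ0 => ?_
    · exact (memLp_coord (Lp.memLp τ) i).integrable one_le_two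
    · obtain ⟨χ, hχ, -, hχ1⟩ := hθ.exists_eq_one hN hΩ
      have h2 := h θ hθ hθ0 (smulW hΩ.isBounded hχ.smooth (coordW hΩ.isBounded i))
        (smulW_mem_of_mem_traceDomain hΩ hχ (ofSmooth_mem_traceDomain hN hΩ _))
      rw [inner_mulS, mulS_grad_smulW hΩ.isBounded hθ.smooth hχ.smooth hχ1, ← inner_mulS,
        inner_mulS_eq_integral] at h2
      rw [← h2]
      refine integral_congr_ae ?_
      filter_upwards [coordW_grad hΩ.isBounded i] with x hx
      rw [hx, EuclideanSpace.inner_single_right]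
      simp
  refine Lp.ext ?_
  filter_upwards [ae_all_iff.2 h1, Lp.coeFn_zero (Eu N) 2 (volume.restrict Ω)] with x hx h0
  rw [h0]
  ext i
  exact hx i

/-! ### Compensated compactness -/

theorem IsTest.partialD {θ : Eu N → ℝ} (hθ : IsTest Ω θ) (i : Fin N) :
    IsTest Ω (Conductivity.partialD i θ) := by
  refine ⟨(hθ.smooth.fderiv_right (m := ∞) (by simp)).clm_apply contDiff_const,
    hθ.compact.fderiv_apply (𝕜 := ℝ) _, ?_⟩
  exact (closure_mono fun x hx => by
    rw [Function.mem_support] at hx ⊢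
    intro h
    exact hx (by rw [Conductivity.partialD, h]; rfl)).trans
      ((tsupport_fderiv_subset ℝ).trans hθ.support)

/-- The embedding of `L²(Ω)` as the `i`-th component of `L²(Ω, ℝ^N)`. -/
noncomputable def embL (Ω : Set (Eu N)) (i : Fin N) : L2 Ω →L[ℝ] L2Vec Ω :=
  (ContinuousLinearMap.toSpanSingleton ℝ (EuclideanSpace.single i (1 : ℝ))).compLpL 2
    (volume.restrict Ω)

theorem mulG_eq_sum (hb : Bornology.IsBounded Ω) {θ : Eu N → ℝ} (hθ : IsTest Ω θ) (u : W12 Ω) :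
    mulG hb hθ.smooth u.fn = ∑ i, embL Ω i (smulW hb (hθ.partialD i).smooth u).fn := by
  refine Lp.ext ?_
  have h1 : ∀ i : Fin N, ∀ᵐ x ∂(volume.restrict Ω),
      embL Ω i (smulW hb (hθ.partialD i).smooth u).fn x =
        (Conductivity.partialD i θ x * u.fn x) • EuclideanSpace.single i (1 : ℝ) := by
    intro i
    filter_upwards [(ContinuousLinearMap.toSpanSingleton ℝ
      (EuclideanSpace.single i (1 : ℝ))).coeFn_compLpL (smulW hb (hθ.partialD i).smooth u).fn,
      smulW_fn hb (hθ.partialD i).smooth u] with x h1 h2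
    rw [embL, h1, h2, ContinuousLinearMap.toSpanSingleton_apply]
  filter_upwards [mulG_ae hb hθ.smooth u.fn, ae_all_iff.2 h1,
    Lp.coeFn_finsetSum Finset.univ fun i => embL Ω i (smulW hb (hθ.partialD i).smooth u).fn]
    with x h2 h3 h4
  rw [h2, h4, Finset.sum_apply]
  simp only [h3]
  ext j
  simp [gradient_apply, Pi.single_apply, mul_comm]

/-- The div-curl lemma: the localized product of weakly convergent fields with prescribed divergence
and of weakly convergent gradients converges to the product of the limits. -/
theorem tendsto_inner_mulS (hΩ : IsBoundedLipschitzDomain Ω) {θ : Eu N → ℝ} (hθ : IsTest Ω θ)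
    {σ : ℕ → L2Vec Ω} {τ : L2Vec Ω} (hσ : WeakTendsto σ τ) {y : ℕ → W12 Ω} {z : W12 Ω}
    (hy : ∀ n, y n ∈ traceDomain Ω) (hyz : WeakTendsto y z) (F : W12 Ω →L[ℝ] ℝ)
    (hF : ∀ n, ∀ ψ ∈ W120S Ω, inner ℝ (σ n) ψ.grad = F ψ) :
    Tendsto (fun n => inner ℝ (mulS hΩ.isBounded hθ.smooth (σ n)) (y n).grad) atTop
      (𝓝 (inner ℝ (mulS hΩ.isBounded hθ.smooth τ) z.grad)) := by
  have hb := hΩ.isBounded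
  have hτ : ∀ ψ ∈ W120S Ω, inner ℝ τ ψ.grad = F ψ := by
    intro ψ hψ
    refine tendsto_nhds_unique (hσ.inner_tendsto tendsto_const_nhds) ?_
    simp only [hF _ ψ hψ]
    exact tendsto_const_nhds
  have hw : ∀ {χ : Eu N → ℝ} (hχ : IsTest Ω χ),
      WeakTendsto (fun n => smulW hb hχ.smooth (y n)) (smulW hb hχ.smooth z) := fun hχ =>
    hyz.map (smulW hb hχ.smooth)
  have hmem : ∀ {χ : Eu N → ℝ} (hχ : IsTest Ω χ) (n : ℕ), smulW hb hχ.smooth (y n) ∈ W120S Ω :=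
    fun hχ n => smulW_mem_of_mem_traceDomain hΩ hχ (hy n)
  have hzmem : smulW hb hθ.smooth z ∈ W120S Ω := (hw hθ).mem isClosed_W120S (hmem hθ)
  have hsplit : ∀ (s : L2Vec Ω) (u : W12 Ω), inner ℝ (mulS hb hθ.smooth s) u.grad =
      inner ℝ s (smulW hb hθ.smooth u).grad - inner ℝ s (mulG hb hθ.smooth u.fn) := by
    intro s u
    rw [inner_mulS, grad_smulW, inner_add_right, add_sub_cancel_right]
  simp only [hsplit, hF _ _ (hmem hθ _), hτ _ hzmem]
  refine ((hw hθ).dual F).sub (hσ.inner_tendsto ?_)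
  simp only [mulG_eq_sum hb hθ]
  refine tendsto_finsetSum _ fun i _ => ((embL Ω i).continuous.tendsto _).comp ?_
  exact tendsto_fn_of_weakTendsto hΩ.isOpen hb (hmem (hθ.partialD i)) (hw (hθ.partialD i))

/-! ### Consequences of `H`-convergence -/

theorem grad_add (u v : W12 Ω) : (u + v).grad = u.grad + v.grad := rfl

theorem grad_sub (u v : W12 Ω) : (u - v).grad = u.grad - v.grad := rfl

theorem grad_smul (c : ℝ) (u : W12 Ω) : (c • u).grad = c • u.grad := rfl

theorem HConverges.weakTendsto {An : ℕ → Eu N → Mat N} {A : Eu N → Mat N} (h : HConverges Ω An A)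
    (hCn : ∀ n, IsCoef Ω (An n)) (hC : IsCoef Ω A) {F : W12 Ω →L[ℝ] ℝ} {un : ℕ → W12 Ω} {u : W12 Ω}
    (hun : ∀ n, IsDirichletSol (An n) F 0 (un n)) (hu : IsDirichletSol A F 0 u) :
    WeakTendsto un u ∧ WeakTendsto (fun n => mulM (hCn n) (un n).grad) (mulM hC u.grad) := by
  obtain ⟨h1, h2⟩ := h F un u hun hu
  refine ⟨WeakTendsto.of_dual h1, fun G => ?_⟩
  have := h2 G
  simp only [integral_mulVec_eq (hCn _), integral_mulVec_eq hC] at this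
  simpa only [real_inner_comm] using this

theorem IsDirichletSol.mem {A : Eu N → Mat N} {F : W12 Ω →L[ℝ] ℝ} {u : W12 Ω}
    (h : IsDirichletSol A F 0 u) : u ∈ W120S Ω := by
  have := h.1
  rwa [sub_zero] at this

section HConvergence

variable {α β : ℝ} {An : ℕ → Eu N → Mat N} {A : Eu N → Mat N}

theorem IsDirichletSol.unique (hN : 1 ≤ N) (hΩ : IsBoundedLipschitzDomain Ω) (hα : 0 < α)
    (hβ : 0 < β) (hA : IsTensor Ω α β A) {F : W12 Ω →L[ℝ] ℝ} {u v : W12 Ω}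
    (hu : IsDirichletSol A F 0 u) (hv : IsDirichletSol A F 0 v) : u = v := by
  have h1 : u - v ∈ W120S Ω := sub_mem hu.mem hv.mem
  rw [← sub_eq_zero]
  refine eq_zero_of_form_eq_zero hα hβ hA (exists_poincare_W120S hN hΩ) h1 ?_
  rw [form_sub_left (hA.isCoef hα hβ), hu.2 _ h1, hv.2 _ h1, sub_self]

/-- Existence of solutions is needed: a sequence of solutions for the subsequence has to be completed
to one for the whole sequence. -/
theorem HConverges.subseq (hN : 1 ≤ N) (hΩ : IsBoundedLipschitzDomain Ω) (hα : 0 < α)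
    (hβ : 0 < β) (hAn : ∀ n, IsTensor Ω α β (An n)) (h : HConverges Ω An A) {k : ℕ → ℕ}
    (hk : Tendsto k atTop atTop) : HConverges Ω (fun n => An (k n)) A := by
  intro F un u hun hu
  choose w hw using fun n => exists_isDirichletSol hN hΩ hα hβ (hAn n) F 0
  have heq : ∀ n, un n = w (k n) := fun n => (hun n).unique hN hΩ hα hβ (hAn _) (hw _)
  obtain ⟨h1, h2⟩ := h F w u hw hu
  simp only [heq]
  exact ⟨fun l => (h1 l).comp hk, fun G => (h2 G).comp hk⟩

theorem inner_mulS_mulM_nonneg (hb : Bornology.IsBounded Ω) (hα : 0 < α) (hβ : 0 < β)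
    (hA : IsTensor Ω α β A) {θ : Eu N → ℝ} (hθ : ContDiff ℝ ∞ θ) (hθ0 : ∀ x, 0 ≤ θ x)
    (G : L2Vec Ω) : 0 ≤ inner ℝ (mulS hb hθ (mulM (hA.isCoef hα hβ) G)) G := by
  rw [inner_mulS_eq_integral]
  refine integral_nonneg_of_ae ?_
  filter_upwards [mulM_ae (hA.isCoef hα hβ) G, hA.elliptic] with x h1 h2
  rw [Pi.zero_apply, h1]
  refine mul_nonneg (hθ0 x) (le_trans ?_ (h2.le_inner _))
  positivity

theorem eq_zero_of_quadratic_nonneg {a b : ℝ} (h : ∀ s : ℝ, 0 ≤ - s * a + s ^ 2 * b) : a = 0 := by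
  by_contra ha
  have hb : 0 < |b| + 1 := by positivity
  have h1 := h (a / (|b| + 1))
  have h2 : - (a / (|b| + 1)) * a + (a / (|b| + 1)) ^ 2 * b =
      a ^ 2 * (b - (|b| + 1)) / (|b| + 1) ^ 2 := by
    field_simp
    ring
  rw [h2, le_div_iff₀ (by positivity), zero_mul] at h1
  have h3 : 0 < a ^ 2 := by positivity
  nlinarith [le_abs_self b]

/-- The flux of a weak limit of solutions is the limit of the fluxes. By the div-curl lemma the
monotonicity of the localized forms passes to the limit, when the solutions are compared with
solutions which converge to a given function, and a variation of this function identifies the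
limit. -/
theorem HConverges.flux_eq (hN : 1 ≤ N) (hΩ : IsBoundedLipschitzDomain Ω) (hα : 0 < α)
    (hβ : 0 < β) (hAn : ∀ n, IsTensor Ω α β (An n)) (hA : IsTensor Ω α β A)
    (h : HConverges Ω An A) {z : ℕ → W12 Ω} {a : W12 Ω} {τ : L2Vec Ω}
    (hz : ∀ n, z n ∈ traceDomain Ω) (hza : WeakTendsto z a)
    (hzτ : WeakTendsto (fun n => mulM ((hAn n).isCoef hα hβ) (z n).grad) τ)
    (hh : ∀ n, ∀ ψ ∈ W120S Ω, form (An n) (z n) ψ = 0) :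
    τ = mulM (hA.isCoef hα hβ) a.grad := by
  have hb := hΩ.isBounded
  have hC := hA.isCoef hα hβ
  have hCn := fun n => (hAn n).isCoef hα hβ
  have ha : a ∈ traceDomain Ω := hza.mem (isClosed_traceDomain hN hΩ) hz
  rw [← sub_eq_zero]
  refine eq_zero_of_forall_inner hN hΩ fun θ hθ hθ0 v hv => ?_
  obtain ⟨χ, hχ, -, hχ1⟩ := hθ.exists_eq_one hN hΩ
  set T := mulS hb hθ.smooth with hT
  refine eq_zero_of_quadratic_nonneg (b := inner ℝ (T (mulM hC v.grad)) v.grad) fun s => ?_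
  -- where `θ ≠ 0`, the gradient of `w` is that of `a + s v`
  set w := smulW hb hχ.smooth a + s • v with hw
  have hwm : w ∈ W120S Ω :=
    add_mem (smulW_mem_of_mem_traceDomain hΩ hχ ha) (Submodule.smul_mem _ s hv)
  have hws : IsDirichletSol A (formB hC w) 0 w :=
    ⟨by rw [sub_zero]; exact hwm, fun ψ _ => (formB_apply hC w ψ).symm⟩
  -- with the right-hand side `-div (A ∇w)`, the limit of the solutions for `An` is `w`
  choose wn hwn using fun n => exists_isDirichletSol hN hΩ hα hβ (hAn n) (formB hC w) 0
  obtain ⟨h1, h2⟩ := h.weakTendsto hCn hC hwn hws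
  have hlim := tendsto_inner_mulS hΩ hθ (hzτ.sub h2) (y := fun n => z n - wn n)
    (fun n => sub_mem (hz n) (W120S_le_traceDomain hΩ (hwn n).mem)) (hza.sub h1) (-formB hC w)
    fun n ψ hψ => by
      rw [inner_sub_left, ← form_eq (hCn n), ← form_eq (hCn n), hh n ψ hψ, (hwn n).2 ψ hψ, zero_sub]
      rfl
  have h0 := ge_of_tendsto' hlim fun n => by
    rw [← map_sub, ← grad_sub]
    exact inner_mulS_mulM_nonneg hb hα hβ (hAn n) hθ.smooth hθ0 _
  refine h0.trans_eq ?_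
  have hTw : T w.grad = T a.grad + s • T v.grad := by
    rw [hw, grad_add, grad_smul, map_add, map_smul, mulS_grad_smulW hb hθ.smooth hχ.smooth hχ1]
  have e1 : T (τ - mulM hC w.grad) =
      T (τ - mulM hC a.grad) - s • T (mulM hC v.grad) := by
    rw [map_sub, map_sub, hT, mulS_mulM, ← hT, hTw, map_add, map_smul, hT, mulS_mulM, mulS_mulM]
    abel
  have e2 : inner ℝ (T (τ - mulM hC w.grad)) (a - w).grad =
      -s * inner ℝ (T (τ - mulM hC w.grad)) v.grad := by
    rw [hT, inner_mulS, inner_mulS, ← hT, grad_sub, map_sub, hTw, sub_add_cancel_left, inner_neg_right,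
      real_inner_smul_right, neg_mul]
  rw [e2, e1, inner_sub_left, real_inner_smul_left]
  ring

/-- Bounded sequences of solutions whose limits are determined converge weakly, together with
their fluxes. -/
theorem HConverges.weakTendsto_of_unique (hN : 1 ≤ N) (hΩ : IsBoundedLipschitzDomain Ω) (hα : 0 < α)
    (hβ : 0 < β) (hAn : ∀ n, IsTensor Ω α β (An n)) (hA : IsTensor Ω α β A)
    (h : HConverges Ω An A) {z : ℕ → W12 Ω} {a : W12 Ω} {M : ℝ} (hM : ∀ n, ‖z n‖ ≤ M)
    (hz : ∀ n, z n ∈ traceDomain Ω) (hh : ∀ n, ∀ ψ ∈ W120S Ω, form (An n) (z n) ψ = 0)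
    (huniq : ∀ (k : ℕ → ℕ) (b : W12 Ω), WeakTendsto (fun n => z (k n)) b →
      WeakTendsto (fun n => mulM ((hAn (k n)).isCoef hα hβ) (z (k n)).grad)
        (mulM (hA.isCoef hα hβ) b.grad) → b = a) :
    WeakTendsto z a ∧ WeakTendsto (fun n => mulM ((hAn n).isCoef hα hβ) (z n).grad)
      (mulM (hA.isCoef hα hβ) a.grad) := by
  have hσM : ∀ n, ‖mulM ((hAn n).isCoef hα hβ) (z n).grad‖ ≤ β * M := fun n =>
    ((hAn n).norm_mulM_le hα hβ _).trans (by gcongr; exact (norm_grad_le _).trans (hM n))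
  have key : ∀ (k : ℕ → ℕ) (b : W12 Ω) (τ : L2Vec Ω), StrictMono k →
      WeakTendsto (fun n => z (k n)) b →
      WeakTendsto (fun n => mulM ((hAn (k n)).isCoef hα hβ) (z (k n)).grad) τ →
      b = a ∧ τ = mulM (hA.isCoef hα hβ) a.grad := by
    intro k b τ hk hb hτ
    have h1 := (h.subseq hN hΩ hα hβ hAn hk.tendsto_atTop).flux_eq hN hΩ hα hβ (fun n => hAn (k n))
      hA (fun n => hz (k n)) hb hτ fun n => hh (k n)
    rw [h1] at hτ
    have h2 := huniq k b hb hτ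
    rw [h1, h2]
    exact ⟨rfl, rfl⟩
  constructor
  · refine WeakTendsto.of_subseq hM fun k b hk hb => ?_
    obtain ⟨τ, j, hj, hτ⟩ := exists_weakTendsto_subseq
      (u := fun n => mulM ((hAn (k n)).isCoef hα hβ) (z (k n)).grad) fun n => hσM (k n)
    exact (key (fun n => k (j n)) b τ (hk.comp hj) (hb.subseq hj.tendsto_atTop) hτ).1
  · refine WeakTendsto.of_subseq hσM fun k τ hk hτ => ?_
    obtain ⟨b, j, hj, hb⟩ := exists_weakTendsto_subseq (u := fun n => z (k n)) fun n => hM (k n)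
    exact (key (fun n => k (j n)) b τ (hk.comp hj) hb
      (hτ.subseq (u := fun n => mulM ((hAn (k n)).isCoef hα hβ) (z (k n)).grad)
        hj.tendsto_atTop)).2

theorem HConverges.weakTendsto_dirichlet (hN : 1 ≤ N) (hΩ : IsBoundedLipschitzDomain Ω) (hα : 0 < α)
    (hβ : 0 < β) (hAn : ∀ n, IsTensor Ω α β (An n)) (hA : IsTensor Ω α β A)
    (h : HConverges Ω An A) {φ : W12half Ω} {un : ℕ → W12 Ω} {u : W12 Ω}
    (hun : ∀ n, IsDirichletSolBdry (An n) φ (un n)) (hu : IsDirichletSolBdry A φ u) :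
    WeakTendsto un u ∧ WeakTendsto (fun n => mulM ((hAn n).isCoef hα hβ) (un n).grad)
      (mulM (hA.isCoef hα hβ) u.grad) := by
  obtain ⟨C, -, hC⟩ := exists_dirichlet_bound hN hΩ hα hβ
  refine h.weakTendsto_of_unique hN hΩ hα hβ hAn hA (fun n => hC _ (hAn n) φ _ (hun n))
    (fun n => mem_traceDomain.2 ⟨φ, (hun n).isTrace hΩ⟩) (fun n ψ hψ => (hun n).form_eq_zero hψ)
    fun k b hb hτ => ?_
  refine IsDirichletSolBdry.unique hN hΩ hα hβ hA (φ := φ) ?_ hu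
  rw [isDirichletSolBdry_iff hN hΩ]
  constructor
  · refine (hu.isTrace hΩ).of_sub_mem hΩ ?_
    exact (hb.sub (WeakTendsto.const u)).mem isClosed_W120S fun n =>
      ((hun (k n)).isTrace hΩ).sub_mem hN hΩ (hu.isTrace hΩ)
  · intro ψ hψ
    rw [form_eq (hA.isCoef hα hβ)]
    refine tendsto_nhds_unique (hτ.inner_tendsto tendsto_const_nhds) ?_
    simp only [← form_eq, (hun (k _)).form_eq_zero hψ]
    exact tendsto_const_nhds

theorem HConverges.weakTendsto_neumann (hN : 1 ≤ N) (hΩ : IsBoundedLipschitzDomain Ω) (hα : 0 < α)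
    (hβ : 0 < β) (hAn : ∀ n, IsTensor Ω α β (An n)) (hA : IsTensor Ω α β A)
    (h : HConverges Ω An A) {g : W12minusStar Ω} {vn : ℕ → W12 Ω} {v : W12 Ω}
    (hvn : ∀ n, IsNeumannSol (An n) g (vn n)) (hv : IsNeumannSol A g v) :
    WeakTendsto vn v ∧ WeakTendsto (fun n => mulM ((hAn n).isCoef hα hβ) (vn n).grad)
      (mulM (hA.isCoef hα hβ) v.grad) := by
  obtain ⟨C, -, hC⟩ := exists_neumann_bound hN hΩ hα hβ
  refine h.weakTendsto_of_unique hN hΩ hα hβ hAn hA (fun n => hC _ (hAn n) g _ (hvn n))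
    (fun n => ?_) (fun n ψ hψ => (hvn n).form_eq_zero hΩ hψ) fun k b hb hτ => ?_
  · obtain ⟨t, -, ht⟩ := (hvn n).mem_star
    exact mem_traceDomain.2 ⟨t, ht⟩
  refine IsNeumannSol.unique hN hΩ hα hβ hA (g := g) ⟨?_, fun ψ t ht => ?_⟩ hv
  · exact hb.mem (isClosed_traceDomainStar hN hΩ) fun n => (hvn (k n)).mem_star
  · rw [form_eq (hA.isCoef hα hβ)]
    refine tendsto_nhds_unique (hτ.inner_tendsto tendsto_const_nhds) ?_
    simp only [← form_eq, (hvn (k _)).2 ψ t ht]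
    exact tendsto_const_nhds

/-- `H`-limits of symmetric tensors are symmetric: the localized form of the solutions which
converge to two coordinate functions is symmetric, and it converges by the div-curl lemma. -/
theorem HConverges.isSymmTensor (hN : 1 ≤ N) (hΩ : IsBoundedLipschitzDomain Ω) (hα : 0 < α)
    (hβ : 0 < β) (hAn : ∀ n, IsTensor Ω α β (An n)) (hA : IsTensor Ω α β A)
    (h : HConverges Ω An A) (hs : ∀ n, IsSymmTensor Ω (An n)) : IsSymmTensor Ω A := by
  have hb := hΩ.isBounded
  have hfin : IsFiniteMeasure (volume.restrict Ω) := ⟨by simpa using hb.measure_lt_top⟩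
  have hC := hA.isCoef hα hβ
  have hCn := fun n => (hAn n).isCoef hα hβ
  have hentry : ∀ i j : Fin N, ∀ᵐ x ∂(volume.restrict Ω),
      inner ℝ (mulM hC (coordW hb i).grad x) ((coordW hb j).grad x) = A x j i := by
    intro i j
    filter_upwards [mulM_ae hC (coordW hb i).grad, coordW_grad hb i, coordW_grad hb j]
      with x h1 h2 h3
    rw [h1, h2, h3, inner_clmM]
    simp [Matrix.mulVec_single]
  have hint : ∀ i j : Fin N, IntegrableOn (fun x => A x i j) Ω := fun i j =>
    (L2.integrable_inner (𝕜 := ℝ) (mulM hC (coordW hb j).grad) (coordW hb i).grad).congr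
      (hentry j i)
  have key : ∀ i j : Fin N, ∀ᵐ x ∂(volume.restrict Ω), A x j i - A x i j = 0 := by
    intro i j
    refine ae_eq_zero_of_forall_test hN hΩ ((hint j i).sub (hint i j)) fun θ hθ hθ0 => ?_
    obtain ⟨χ, hχ, -, hχ1⟩ := hθ.exists_eq_one hN hΩ
    set T := mulS hb hθ.smooth with hT
    set w : Fin N → W12 Ω := fun i => smulW hb hχ.smooth (coordW hb i) with hw
    have hws : ∀ i, IsDirichletSol A (formB hC (w i)) 0 (w i) := fun i =>
      ⟨by
        rw [sub_zero]
        exact smulW_mem_of_mem_traceDomain hΩ hχ (ofSmooth_mem_traceDomain hN hΩ _),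
        fun ψ _ => (formB_apply hC (w i) ψ).symm⟩
    choose wn hwn using fun (i : Fin N) n =>
      exists_isDirichletSol hN hΩ hα hβ (hAn n) (formB hC (w i)) 0
    have hlim : ∀ i j, Tendsto (fun n => inner ℝ (T (mulM (hCn n) (wn i n).grad)) (wn j n).grad)
        atTop (𝓝 (inner ℝ (T (mulM hC (coordW hb i).grad)) (coordW hb j).grad)) := by
      intro i j
      have h1 := tendsto_inner_mulS hΩ hθ (h.weakTendsto hCn hC (hwn i) (hws i)).2
        (fun n => W120S_le_traceDomain hΩ (hwn j n).mem)
        (h.weakTendsto hCn hC (hwn j) (hws j)).1 (formB hC (w i)) fun n ψ hψ => by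
          rw [← form_eq (hCn n), (hwn i n).2 ψ hψ]
      have e1 : ∀ i, T (w i).grad = T (coordW hb i).grad := fun i =>
        mulS_grad_smulW hb hθ.smooth hχ.smooth hχ1 _
      have e2 : inner ℝ (T (mulM hC (w i).grad)) (w j).grad =
          inner ℝ (T (mulM hC (coordW hb i).grad)) (coordW hb j).grad := by
        rw [hT, mulS_mulM, ← hT, e1, hT, ← mulS_mulM, inner_mulS, ← hT, e1, hT, ← inner_mulS]
      rwa [← e2]
    have hsymm : ∀ n, inner ℝ (T (mulM (hCn n) (wn i n).grad)) (wn j n).grad =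
        inner ℝ (T (mulM (hCn n) (wn j n).grad)) (wn i n).grad := by
      intro n
      rw [hT, inner_mulS_eq_integral, inner_mulS_eq_integral]
      refine integral_congr_ae ?_
      filter_upwards [mulM_ae (hCn n) (wn i n).grad, mulM_ae (hCn n) (wn j n).grad, hs n]
        with x h1 h2 h3
      rw [h1, h2, inner_clmM_symm h3, real_inner_comm]
    have h2 := hlim i j
    simp only [hsymm] at h2
    have h3 := tendsto_nhds_unique h2 (hlim j i)
    have h4 : ∀ i j, inner ℝ (T (mulM hC (coordW hb i).grad)) (coordW hb j).grad =
        ∫ x in Ω, θ x * A x j i := by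
      intro i j
      rw [hT, inner_mulS_eq_integral]
      refine integral_congr_ae ?_
      filter_upwards [hentry i j] with x hx
      rw [hx]
    rw [h4, h4] at h3
    simp only [mul_sub]
    rw [integral_sub (hθ.integrable_mul (hint j i)) (hθ.integrable_mul (hint i j)), h3, sub_self]
  have h1 : ∀ᵐ x ∂(volume.restrict Ω), ∀ i j, A x j i - A x i j = 0 :=
    ae_all_iff.2 fun i => ae_all_iff.2 fun j => key i j
  filter_upwards [h1] with x hx
  ext i j
  exact sub_eq_zero.1 (hx i j)

end HConvergence

/-! ### Lower semicontinuity of the operator norms -/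

/-- Lower semicontinuity of operator norms follows from pointwise lower semicontinuity. -/
theorem enorm_le_liminf_of_forall {E F : Type*} [SeminormedAddCommGroup E] [NormedSpace ℝ E]
    [SeminormedAddCommGroup F] [NormedSpace ℝ F] {T : E →L[ℝ] F} {Tn : ℕ → E →L[ℝ] F}
    (h : ∀ x, ‖T x‖ₑ ≤ liminf (fun n => ‖Tn n x‖ₑ) atTop) :
    ‖T‖ₑ ≤ liminf (fun n => ‖Tn n‖ₑ) atTop := by
  refine le_of_forall_gt fun L hL => ?_
  have h1 : ∃ᶠ n in atTop, ‖Tn n‖ₑ < L := frequently_lt_of_liminf_lt (by isBoundedDefault) hL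
  obtain ⟨K, hK1, hK2⟩ := ENNReal.lt_iff_exists_nnreal_btwn.1 hL
  have h2 : ∃ᶠ n in atTop, ‖Tn n‖ₑ < K := frequently_lt_of_liminf_lt (by isBoundedDefault) hK1
  refine lt_of_le_of_lt ?_ hK2
  have h3 : ‖T‖ ≤ K := by
    refine T.opNorm_le_bound K.2 fun x => ?_
    have h4 : ‖T x‖ₑ ≤ K * ‖x‖ₑ := by
      refine (h x).trans (liminf_le_of_frequently_le' (h2.mono fun n hn => ?_))
      exact ((Tn n).le_opENorm x).trans (by gcongr)
    have h5 := ENNReal.toReal_mono (by finiteness) h4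
    simpa using h5
  rw [← ofReal_norm, ← ENNReal.ofReal_coe_nnreal]
  exact ENNReal.ofReal_le_ofReal h3

/-- Cut-off functions which exhaust the domain. -/
theorem exists_cutoff_seq (hN : 1 ≤ N) (hΩ : IsBoundedLipschitzDomain Ω) :
    ∃ η : ℕ → Eu N → ℝ, (∀ m, IsTest Ω (η m)) ∧ (∀ m x, 0 ≤ η m x) ∧ (∀ m x, η m x ≤ 1) ∧
      ∀ x ∈ Ω, Tendsto (fun m => η m x) atTop (𝓝 1) := by
  choose η h1 h2 h3 h4 _ using fun m : ℕ =>
    exists_cutoff hΩ.isBounded (δ := 1 / ((m : ℝ) + 1)) (by positivity)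
  refine ⟨η, h1, h2, h3, fun x hx => ?_⟩
  have hpos : 0 < Metric.infDist x Ωᶜ := by
    rw [← (hΩ.isOpen.isClosed_compl).notMem_iff_infDist_pos (hΩ.nonempty_compl hN)]
    exact fun h => h hx
  refine tendsto_const_nhds.congr' ?_
  filter_upwards [(tendsto_order.1 tendsto_one_div_add_atTop_nhds_zero_nat).2 _ hpos] with m hm
  exact (h4 m x hm.le).1.symm

section Lsc

variable {α β : ℝ} {An : ℕ → Eu N → Mat N} {A : Eu N → Mat N}

/-- The value of the Dirichlet-to-Neumann operator at a pair of data is a linear function of the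
flux. -/
theorem HConverges.enorm_DN_le (hN : 1 ≤ N) (hΩ : IsBoundedLipschitzDomain Ω) (hα : 0 < α)
    (hβ : 0 < β) (hAn : ∀ n, IsTensor Ω α β (An n)) (hA : IsTensor Ω α β A)
    (h : HConverges Ω An A) (Λ : W12half Ω →L[ℝ] W12minusStar Ω) :
    ‖DN Ω A - Λ‖ₑ ≤ liminf (fun n => ‖DN Ω (An n) - Λ‖ₑ) atTop := by
  refine enorm_le_liminf_of_forall fun φ => ?_
  obtain ⟨u, hu, hu'⟩ := isDN_DN hN hΩ hα hβ hA φ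
  choose un hun hun' using fun n => isDN_DN hN hΩ hα hβ (hAn n) φ
  have hlim := (h.weakTendsto_dirichlet hN hΩ hα hβ hAn hA hun hu).2
  have key : ‖((DN Ω A - Λ) φ).1‖ₑ ≤ liminf (fun n => ‖((DN Ω (An n) - Λ) φ).1‖ₑ) atTop := by
    refine enorm_le_liminf_of_forall fun ψ => ?_
    obtain ⟨ψ', hψ⟩ := ψ.exists_isTrace
    have h1 : Tendsto (fun n => ((DN Ω (An n) - Λ) φ).1 ψ) atTop
        (𝓝 (((DN Ω A - Λ) φ).1 ψ)) := by
      have h2 : Tendsto (fun n => (DN Ω (An n) φ).1 ψ - (Λ φ).1 ψ) atTop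
          (𝓝 ((DN Ω A φ).1 ψ - (Λ φ).1 ψ)) := by
        simp only [hun' _ ψ ψ' hψ, hu' ψ ψ' hψ, form_eq (hA.isCoef hα hβ),
          form_eq ((hAn _).isCoef hα hβ)]
        exact (hlim.inner_tendsto tendsto_const_nhds).sub tendsto_const_nhds
      exact h2
    exact (h1.enorm.liminf_eq).ge
  exact key

/-- The norm of a trace is the norm of the orthogonal projection of an extension, and the projections
of the solutions converge weakly. -/
theorem HConverges.enorm_ND_le (hN : 1 ≤ N) (hΩ : IsBoundedLipschitzDomain Ω) (hα : 0 < α)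
    (hβ : 0 < β) (hAn : ∀ n, IsTensor Ω α β (An n)) (hA : IsTensor Ω α β A)
    (h : HConverges Ω An A) (Λ : W12minusStar Ω →L[ℝ] W12halfStar Ω) :
    ‖ND Ω A - Λ‖ₑ ≤ liminf (fun n => ‖ND Ω (An n) - Λ‖ₑ) atTop := by
  refine enorm_le_liminf_of_forall fun g => ?_
  obtain ⟨v, hv, hv'⟩ := isND_ND hN hΩ hα hβ hA g
  choose vn hvn hvn' using fun n => isND_ND hN hΩ hα hβ (hAn n) g
  obtain ⟨z, hz⟩ := (Λ g).1.exists_isTrace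
  have hlim := (h.weakTendsto_neumann hN hΩ hα hβ hAn hA hvn hv).1
  have hP := ((hlim.sub (WeakTendsto.const z)).map (traceProj Ω)).enorm_le_liminf
  have e : ∀ {w : W12 Ω} {k : W12half Ω}, IsTrace w k → ‖k‖ₑ = ‖traceProj Ω w‖ₑ := fun hw => by
    rw [← ofReal_norm, ← ofReal_norm, hw.norm_eq hN hΩ]
  rw [← e (hv'.sub hz)] at hP
  simp only [← e ((hvn' _).sub hz)] at hP
  exact hP

/-- Lower semicontinuity of the misfit for the fluxes and, in the symmetric case, for the energies.
The energies of the localized misfits converge, and their limits exhaust the energy of the limit. -/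
theorem HConverges.enorm_misfit_le (hN : 1 ≤ N) (hΩ : IsBoundedLipschitzDomain Ω) (hα : 0 < α)
    (hβ : 0 < β) (hAn : ∀ n, IsTensor Ω α β (An n)) (hA : IsTensor Ω α β A)
    (h : HConverges Ω An A) {i : ℕ} (hi : i = 2 ∨ (i = 1 ∧ ∀ n, IsSymmTensor Ω (An n)))
    (hHn : ∀ n, IsCoef Ω fun x => halfPow i (An n x)) (hH : IsCoef Ω fun x => halfPow i (A x))
    {φ : W12half Ω} {g : W12minusStar Ω} {un vn : ℕ → W12 Ω} {u v : W12 Ω}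
    (hun : ∀ n, IsDirichletSolBdry (An n) φ (un n)) (hu : IsDirichletSolBdry A φ u)
    (hvn : ∀ n, IsNeumannSol (An n) g (vn n)) (hv : IsNeumannSol A g v) :
    ‖mulM hH (u.grad - v.grad)‖ₑ ≤
      liminf (fun n => ‖mulM (hHn n) ((un n).grad - (vn n).grad)‖ₑ) atTop := by
  have hCn := fun n => (hAn n).isCoef hα hβ
  have hC := hA.isCoef hα hβ
  obtain ⟨hu1, hu2⟩ := h.weakTendsto_dirichlet hN hΩ hα hβ hAn hA hun hu
  obtain ⟨hv1, hv2⟩ := h.weakTendsto_neumann hN hΩ hα hβ hAn hA hvn hv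
  rcases hi with rfl | ⟨rfl, hs⟩
  · have e : ∀ {B : Eu N → Mat N} (hB : IsCoef Ω B) (hB2 : IsCoef Ω fun x => halfPow 2 (B x))
        (G : L2Vec Ω), mulM hB2 G = mulM hB G := by
      intro B hB hB2 G
      refine Lp.ext ?_
      filter_upwards [mulM_ae hB G, mulM_ae hB2 G] with x h1 h2
      rw [h1, h2, halfPow_two]
    rw [e hC]
    simp only [fun n => e (hCn n) (hHn n)]
    have := (hu2.sub hv2).enorm_le_liminf
    simpa only [← map_sub] using this
  · have hb := hΩ.isBounded
    have hsA := h.isSymmTensor hN hΩ hα hβ hAn hA hs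
    obtain ⟨η, hη, hη0, hη1, hηlim⟩ := exists_cutoff_seq hN hΩ
    -- the square of the norm is the energy
    have hpt : ∀ {B : Eu N → Mat N} (hB : IsTensor Ω α β B) (_ : IsSymmTensor Ω B)
        (hB1 : IsCoef Ω fun x => halfPow 1 (B x)) (G : L2Vec Ω), ∀ᵐ x ∂(volume.restrict Ω),
        inner ℝ (mulM (hB.isCoef hα hβ) G x) (G x) = ‖mulM hB1 G x‖ ^ 2 := by
      intro B hB hBs hB1 G
      filter_upwards [mulM_ae (hB.isCoef hα hβ) G, mulM_ae hB1 G, hB.elliptic, hBs]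
        with x h1 h2 h3 h4
      rw [h1, h2, norm_sq_halfPow_one h3 hα hβ h4]
    have hsq : ∀ F : L2Vec Ω, Integrable (fun x => ‖F x‖ ^ 2) (volume.restrict Ω) := fun F =>
      (L2.integrable_inner (𝕜 := ℝ) F F).congr (Eventually.of_forall fun x =>
        real_inner_self_eq_norm_sq (F x))
    have hnorm : ∀ F : L2Vec Ω, ‖F‖ ^ 2 = ∫ x in Ω, ‖F x‖ ^ 2 := by
      intro F
      rw [← real_inner_self_eq_norm_sq, L2.inner_def]
      simp only [real_inner_self_eq_norm_sq]
    have hη_eq : ∀ {B : Eu N → Mat N} (hB : IsTensor Ω α β B) (_ : IsSymmTensor Ω B)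
        (hB1 : IsCoef Ω fun x => halfPow 1 (B x)) (G : L2Vec Ω) (m : ℕ),
        inner ℝ (mulS hb (hη m).smooth (mulM (hB.isCoef hα hβ) G)) G =
          ∫ x in Ω, η m x * ‖mulM hB1 G x‖ ^ 2 := by
      intro B hB hBs hB1 G m
      rw [inner_mulS_eq_integral]
      refine integral_congr_ae ?_
      filter_upwards [hpt hB hBs hB1 G] with x hx
      rw [hx]
    have hle : ∀ (F : L2Vec Ω) (m : ℕ), ∫ x in Ω, η m x * ‖F x‖ ^ 2 ≤ ‖F‖ ^ 2 := by
      intro F m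
      rw [hnorm]
      refine integral_mono ((hη m).integrable_mul (hsq F)) (hsq F) fun x => ?_
      exact mul_le_of_le_one_left (by positivity) (hη1 m x)
    set G := u.grad - v.grad with hG
    have hexh : Tendsto (fun m => ∫ x in Ω, η m x * ‖mulM hH G x‖ ^ 2) atTop
        (𝓝 (‖mulM hH G‖ ^ 2)) := by
      rw [hnorm]
      refine tendsto_integral_of_dominated_convergence (fun x => ‖mulM hH G x‖ ^ 2)
        (fun m => ((hη m).integrable_mul (hsq _)).aestronglyMeasurable) (hsq _) ?_ ?_
      · refine fun m => Eventually.of_forall fun x => ?_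
        rw [Real.norm_of_nonneg (mul_nonneg (hη0 m x) (by positivity))]
        exact mul_le_of_le_one_left (by positivity) (hη1 m x)
      · filter_upwards [ae_restrict_mem hΩ.isOpen.measurableSet] with x hx
        simpa using (hηlim x hx).mul_const (‖mulM hH G x‖ ^ 2)
    have hdc : ∀ m, Tendsto (fun n => ∫ x in Ω, η m x *
        ‖mulM (hHn n) ((un n).grad - (vn n).grad) x‖ ^ 2) atTop
        (𝓝 (∫ x in Ω, η m x * ‖mulM hH G x‖ ^ 2)) := by
      intro m
      rw [← hη_eq hA hsA hH G m]
      simp only [← hη_eq (hAn _) (hs _) (hHn _) _ m]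
      have h1 := tendsto_inner_mulS hΩ (hη m) (hu2.sub hv2) (y := fun n => un n - vn n)
        (z := u - v) (fun n => ?_) (hu1.sub hv1) 0 (fun n ψ hψ => ?_)
      · simpa only [← map_sub, grad_sub] using h1
      · obtain ⟨k, -, hk⟩ := (hvn n).mem_star
        exact sub_mem (mem_traceDomain.2 ⟨φ, (hun n).isTrace hΩ⟩) (mem_traceDomain.2 ⟨k, hk⟩)
      · rw [inner_sub_left, ← form_eq (hCn n), ← form_eq (hCn n), (hun n).form_eq_zero hψ,
          (hvn n).form_eq_zero hΩ hψ, sub_zero]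
        rfl
    refine le_of_forall_lt fun L hL => ?_
    obtain ⟨K, hLK, hK⟩ := ENNReal.lt_iff_exists_nnreal_btwn.1 hL
    refine hLK.trans_le (le_liminf_of_le (by isBoundedDefault) ?_)
    have hK' : (K : ℝ) ^ 2 < ‖mulM hH G‖ ^ 2 := by
      have h1 : (K : ℝ) < ‖mulM hH G‖ := by
        rw [← ofReal_norm, ← ENNReal.ofReal_coe_nnreal] at hK
        exact (ENNReal.ofReal_lt_ofReal_iff_of_nonneg K.2).1 hK
      have := K.2
      gcongr
    obtain ⟨m, hm⟩ := ((tendsto_order.1 hexh).1 _ hK').exists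
    filter_upwards [(tendsto_order.1 (hdc m)).1 _ hm] with n hn
    have h1 : (K : ℝ) ≤ ‖mulM (hHn n) ((un n).grad - (vn n).grad)‖ :=
      le_of_sq_le_sq (hn.le.trans (hle _ m)) (norm_nonneg _)
    rw [← ofReal_norm, ← ENNReal.ofReal_coe_nnreal]
    exact ENNReal.ofReal_le_ofReal h1

theorem HConverges.enorm_KD_le (hN : 1 ≤ N) (hΩ : IsBoundedLipschitzDomain Ω) (hα : 0 < α)
    (hβ : 0 < β) (hAn : ∀ n, IsTensor Ω α β (An n)) (hA : IsTensor Ω α β A)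
    (h : HConverges Ω An A) {i : ℕ} (hi : i = 2 ∨ (i = 1 ∧ ∀ n, IsSymmTensor Ω (An n)))
    (hHn : ∀ n, IsCoef Ω fun x => halfPow i (An n x)) (hH : IsCoef Ω fun x => halfPow i (A x))
    (Λ : W12half Ω →L[ℝ] W12minusStar Ω) :
    ‖KD Λ i A‖ₑ ≤ liminf (fun n => ‖KD Λ i (An n)‖ₑ) atTop := by
  refine enorm_le_liminf_of_forall fun φ => ?_
  obtain ⟨u, v, hu, hv, hK⟩ := (isKD_iff hH).1 (isKD_KD hN hΩ hα hβ hA Λ hH) φ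
  choose un vn hun hvn hKn using fun n =>
    (isKD_iff (hHn n)).1 (isKD_KD hN hΩ hα hβ (hAn n) Λ (hHn n)) φ
  rw [hK]
  simp only [hKn]
  exact h.enorm_misfit_le hN hΩ hα hβ hAn hA hi hHn hH hun hu hvn hv

theorem HConverges.enorm_KN_le (hN : 1 ≤ N) (hΩ : IsBoundedLipschitzDomain Ω) (hα : 0 < α)
    (hβ : 0 < β) (hAn : ∀ n, IsTensor Ω α β (An n)) (hA : IsTensor Ω α β A)
    (h : HConverges Ω An A) {i : ℕ} (hi : i = 2 ∨ (i = 1 ∧ ∀ n, IsSymmTensor Ω (An n)))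
    (hHn : ∀ n, IsCoef Ω fun x => halfPow i (An n x)) (hH : IsCoef Ω fun x => halfPow i (A x))
    (Λ : W12minusStar Ω →L[ℝ] W12halfStar Ω) :
    ‖KN Λ i A‖ₑ ≤ liminf (fun n => ‖KN Λ i (An n)‖ₑ) atTop := by
  refine enorm_le_liminf_of_forall fun g => ?_
  obtain ⟨u, v, hu, hv, hK⟩ := (isKN_iff hH).1 (isKN_KN hN hΩ hα hβ hA Λ hH) g
  choose un vn hun hvn hKn using fun n =>
    (isKN_iff (hHn n)).1 (isKN_KN hN hΩ hα hβ (hAn n) Λ (hHn n)) g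
  rw [hK]
  simp only [hKn]
  exact h.enorm_misfit_le hN hΩ hα hβ hAn hA hi hHn hH hun hu hvn hv

end Lsc

end Conductivity

/-- Lower semicontinuity of the forward operators under `H`-convergence. The first block says that
the operators are well defined, so that the values of `DN`, `ND`, `KD` and `KN` are the intended
ones; operator norms are compared in `[0, ∞]`. -/
theorem theorem3p1 {N : ℕ} (hN : 2 ≤ N) (Ω : Set (Eu N)) (hΩ : IsBoundedLipschitzDomain Ω)
    (α β : ℝ) (hα : 0 < α) (hαβ : α ≤ β)
    (ΛD : W12half Ω →L[ℝ] W12minusStar Ω) (ΛN : W12minusStar Ω →L[ℝ] W12halfStar Ω) :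
    (∀ B : Eu N → Mat N, IsTensor Ω α β B →
      ((∃! Λ : W12half Ω →L[ℝ] W12minusStar Ω, IsDN B Λ) ∧ IsDN B (DN Ω B)) ∧
      ((∃! Λ : W12minusStar Ω →L[ℝ] W12halfStar Ω, IsND B Λ) ∧ IsND B (ND Ω B)) ∧
      ∀ i : ℕ, (i = 2 ∨ (i = 1 ∧ IsSymmTensor Ω B)) →
        ((∃! K : W12half Ω →L[ℝ] L2Vec Ω, IsKD ΛD i B K) ∧ IsKD ΛD i B (KD ΛD i B)) ∧
        ((∃! K : W12minusStar Ω →L[ℝ] L2Vec Ω, IsKN ΛN i B K) ∧ IsKN ΛN i B (KN ΛN i B))) ∧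
    ∀ (An : ℕ → Eu N → Mat N) (A : Eu N → Mat N),
      (∀ n, IsTensor Ω α β (An n)) → IsTensor Ω α β A → HConverges Ω An A →
        ‖DN Ω A - ΛD‖ₑ ≤ liminf (fun n => ‖DN Ω (An n) - ΛD‖ₑ) atTop ∧
        ‖ND Ω A - ΛN‖ₑ ≤ liminf (fun n => ‖ND Ω (An n) - ΛN‖ₑ) atTop ∧
        ((∀ n, IsSymmTensor Ω (An n)) → IsSymmTensor Ω A) ∧
        ∀ i : ℕ, (i = 2 ∨ (i = 1 ∧ ∀ n, IsSymmTensor Ω (An n))) →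
          ‖KD ΛD i A‖ₑ ≤ liminf (fun n => ‖KD ΛD i (An n)‖ₑ) atTop ∧
          ‖KN ΛN i A‖ₑ ≤ liminf (fun n => ‖KN ΛN i (An n)‖ₑ) atTop := by
  have hN1 : 1 ≤ N := by omega
  have hβ : 0 < β := hα.trans_le hαβ
  refine ⟨fun B hB => ⟨⟨existsUnique_isDN hN1 hΩ hα hβ hB, isDN_DN hN1 hΩ hα hβ hB⟩,
    ⟨existsUnique_isND hN1 hΩ hα hβ hB, isND_ND hN1 hΩ hα hβ hB⟩, fun i hi => ?_⟩, ?_⟩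
  · have hH := hB.isCoef_halfPow hα hβ hi
    exact ⟨⟨existsUnique_isKD hN1 hΩ hα hβ hB ΛD hH, isKD_KD hN1 hΩ hα hβ hB ΛD hH⟩,
      existsUnique_isKN hN1 hΩ hα hβ hB ΛN hH, isKN_KN hN1 hΩ hα hβ hB ΛN hH⟩
  · intro An A hAn hA hH
    have hsymm := hH.isSymmTensor hN1 hΩ hα hβ hAn hA
    refine ⟨hH.enorm_DN_le hN1 hΩ hα hβ hAn hA ΛD, hH.enorm_ND_le hN1 hΩ hα hβ hAn hA ΛN, hsymm,
      fun i hi => ?_⟩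
    have hCn : ∀ n, IsCoef Ω fun x => halfPow i (An n x) := fun n =>
      (hAn n).isCoef_halfPow hα hβ (hi.imp_right fun h => ⟨h.1, h.2 n⟩)
    have hC : IsCoef Ω fun x => halfPow i (A x) :=
      hA.isCoef_halfPow hα hβ (hi.imp_right fun h => ⟨h.1, hsymm h.2⟩)
    exact ⟨hH.enorm_KD_le hN1 hΩ hα hβ hAn hA hi hCn hC ΛD,
      hH.enorm_KN_le hN1 hΩ hα hβ hAn hA hi hCn hC ΛN⟩
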